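/- **The mirror game.** In the mirror game on $N$ elements, Alice and Bob alternately say numbers from $[N]=\{1,\dots,N\}$, Alice first. A player who says a number that was said before loses and the other player wins; if $N$ distinct numbers have been said, both win. **Strategies.** Let $N$ be even. A randomized strategy of Alice with memory $m$ and oracle access to a perfect matching $M$ on $K_N$ consists of an initial memory state $s_0\in[2^m]$, a randomized transition function $f$, which maps the previous reply $b\in[N]$ of Bob, the current memory state $s\in[2^m]$ and the turn $t\in[N]$ to a new memory state (using $M$ and fresh random bits at each turn), and a function $g:[2^m]\to[N]$ which maps Alice's (updated) memory state to the number she says; her first number is $g(s_0)$. A family of such strategies, one for each even $N>0$, with memory $m=m(N)$, is *computable in memory* $m(N)$ if there is one (multitape) Turing machine that, given $N,b,s,t$ in binary, an oracle that returns the match $M(x)$ of any queried $x\in[N]$, and a read-once tape of $\mathrm{poly}(N,m)$ random bits, always halts and computes $f$ in space $O(m)$, and one deterministic Turing machine without oracle that computes $g$ from $N$ and $s$ in space $O(m)$. The matching $M$ is chosen uniformly at random among all perfect matchings on $K_N$, independently of the random bits, and is not revealed to Bob. The strategy wins with probability at least $p$ if, against every (possibly randomized, history-dependent) strategy of Bob,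 the probability that Alice wins is at least $p$. **Theorem.** There are a family of randomized strategies for Alice with oracle access to a uniformly random perfect matching on $K_N$, one for each even $N>0$, computable in memory $m(N)$, and a constant $C$ such that for every even $N>0$ $$m(N)\le C\sqrt N\,\log^2 N,$$ and the strategy for $N$ wins with probability at least $1-C/N$. -/

import Mathlib

namespace MirrorGame

/-! ### Space-bounded oracle Turing machines -/

/-- A tape that is infinite in both directions: `left` (nearest cell first), `head`, `right`
(nearest cell first) are the cells that carried the input or have been visited so far; all other
cells are blank. The tape alphabet is `{blank, 0, 1}`, with `none` for blank. -/
structure Tape where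
  left : List (Option Bool)
  head : Option Bool
  right : List (Option Bool)

namespace Tape

/-- The tape with the word `w` written on it and the head on the first letter of `w`. -/
def ofWord : List Bool → Tape
  | [] => ⟨[], none, []⟩
  | b :: w => ⟨[], some b, w.map some⟩

/-- The maximal word over `{0, 1}` at the beginning of a list of cells. -/
def prefixWord : List (Option Bool) → List Bool
  | some b :: l => b :: prefixWord l
  | _ => []

/-- The word that starts at the head and ends before the first blank. -/
def word (t : Tape) : List Bool := prefixWord (t.head :: t.right)

/-- Number of cells in use. -/
def size (t : Tape) : ℕ := t.left.length + 1 + t.right.length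

/-- Write a symbol at the head. -/
def write (t : Tape) (a : Option Bool) : Tape := { t with head := a }

/-- Move the head by one cell, or (`none`) leave it where it is. -/
def move (t : Tape) : Option Turing.Dir → Tape
  | none => t
  | some .left =>
      match t.left with
      | [] => ⟨[], none, t.head :: t.right⟩
      | a :: l => ⟨l, a, t.head :: t.right⟩
  | some .right =>
      match t.right with
      | [] => ⟨t.head :: t.left, none, []⟩
      | a :: r => ⟨t.head :: t.left, a, r⟩

end Tape

/-- The number with binary expansion `w`, least significant bit first (as in `Nat.bits`). -/
def value (w : List Bool) : ℕ := w.foldr Nat.bit 0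

/-- The named tapes of a machine: the tape for the parameter `N`, for a number said by a player,
for Alice's memory, for the turn, and for the oracle. -/
inductive Port
  | size | said | memory | turn | oracle
  deriving DecidableEq

instance : Fintype Port := ⟨{.size, .said, .memory, .turn, .oracle}, by rintro (_ | _) <;> simp⟩

/-- What a machine does in one step: halt, call the oracle, or act on all its tapes. In the last
case `advance` says whether the head of the random tape, which never moves back, moves on. -/
inductive Action (Q ι : Type)
  | halt
  | query (q : Q)
  | act (q : Q) (write : ι → Option Bool) (dir : ι → Option Turing.Dir) (advance : Bool)

/-- A deterministic multitape Turing machine with an oracle tape and a one-way, read-only random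
tape: finitely many states, the five named tapes and finitely many further work tapes. The
transition function reads the state, the symbols under all heads, and the current random bit
(`none` beyond the end of the random tape). -/
structure OracleTM where
  State : Type
  [finite : Finite State]
  work : ℕ
  start : State
  next : State → (Port ⊕ Fin work → Option Bool) → Option Bool →
    Action State (Port ⊕ Fin work)

namespace OracleTM

variable (T : OracleTM)

/-- A configuration; `random` is the part of the random tape from its head on. -/
structure Config where
  state : T.State
  tape : Port ⊕ Fin T.work → Tape
  random : List Bool

/-- One step with the oracle `O`; `none` if the machine halts. A query replaces the word on the
oracle tape by the answer of the oracle. -/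
def step (O : List Bool → List Bool) (c : T.Config) : Option T.Config :=
  match T.next c.state (fun i => (c.tape i).head) c.random.head? with
  | .halt => none
  | .query q =>
      some ⟨q, Function.update c.tape (.inl .oracle)
        (Tape.ofWord (O (c.tape (.inl .oracle)).word)), c.random⟩
  | .act q w d adv =>
      some ⟨q, fun i => ((c.tape i).write (w i)).move (d i),
        if adv then c.random.tail else c.random⟩

/-- The initial configuration, with the words `input` on the named tapes and blank work tapes. -/
def init (input : Port → List Bool) (random : List Bool) : T.Config :=
  ⟨T.start, Sum.elim (fun p => Tape.ofWord (input p)) (fun _ => Tape.ofWord []), random⟩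

/-- The space that a configuration takes: the number of cells in use on all tapes but the random
tape (the cells of the inputs, of the output and of the oracle tape are counted). -/
def space {T : OracleTM} (c : T.Config) : ℕ := ∑ i, (c.tape i).size

/-- Started on `input`, with the oracle `O` and the random tape `random`, the machine halts with
the number `v` in binary on tape `out`, and never takes more space than `S`. -/
def Computes (O : List Bool → List Bool) (S : ℕ) (input : Port → List Bool)
    (random : List Bool) (out : Port) (v : ℕ) : Prop :=
  (∃ c, StateTransition.Reaches (T.step O) (T.init input random) c ∧ T.step O c = none ∧
      value (c.tape (.inl out)).word = v) ∧
    ∀ c, StateTransition.Reaches (T.step O) (T.init input random) c → space c ≤ S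

end OracleTM

/-! ### Perfect matchings of the complete graph

The set of the numbers `1, …, N` is represented by `Fin N = {0, …, N - 1}`. -/

/-- The perfect matchings of the complete graph on `N` vertices. -/
abbrev Matching (N : ℕ) : Type :=
  {M : (⊤ : SimpleGraph (Fin N)).Subgraph // M.IsPerfectMatching}

noncomputable instance (N : ℕ) : Fintype (Matching N) := Fintype.ofFinite _

theorem nonempty_matching {N : ℕ} (hN : Even N) : Nonempty (Matching N) := by
  have hc : (⊤ : SimpleGraph (Fin N)).IsClique Set.univ := fun _ _ _ _ h => h
  have hu : Even (Set.univ : Set (Fin N)).ncard := by simpa [Set.ncard_univ] using hN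
  obtain ⟨M, hv, hM⟩ := (hc.even_iff_exists_isMatching Set.finite_univ).mp hu
  exact ⟨⟨M, hM, fun v => hv ▸ Set.mem_univ v⟩⟩

/-- The vertex to which `M` matches `x`. -/
noncomputable def Matching.mate {N : ℕ} (M : Matching N) (x : Fin N) : Fin N :=
  (SimpleGraph.Subgraph.isPerfectMatching_iff.mp M.2 x).choose

/-- The oracle for `M`: it maps the binary expansion of `x` to that of the match of `x`. Words
that do not represent a vertex are left unchanged. -/
noncomputable def Matching.oracle {N : ℕ} (M : Matching N) (w : List Bool) : List Bool :=
  if h : value w < N then (M.mate ⟨value w, h⟩ : ℕ).bits else w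

/-! ### The mirror game -/

/-- A randomized strategy of Alice with `m` bits of memory in the mirror game on `N` elements, with
access to a perfect matching. `f M ω b s t` is the memory state after `b`, the previous reply of
Bob, in memory state `s`, at turn `t`, where `ω` is the content of the random tape of length `L`;
`g s` is the number that Alice says in memory state `s`. -/
structure Strategy (N m L : ℕ) where
  init : Fin (2 ^ m)
  f : Matching N → (Fin L → Bool) → Fin N → Fin (2 ^ m) → Fin N → Fin (2 ^ m)
  g : Fin (2 ^ m) → Fin N

/-- A deterministic strategy of Bob: his next number as a function of all the numbers said so far,
in the order in which they were said. -/
abbrev BobStrategy (N : ℕ) : Type := List (Fin N) → Fin N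

namespace Strategy

variable {N m L : ℕ}

/-- Alice does not lose in the next `n` rounds, if the numbers in `said` have been said so far, it
is her turn, and her memory state is `s`. Turns are counted from `0`. In a round Alice says a
number, and loses if it was said before; otherwise Bob replies, and Alice wins if his number was
said before. If neither happens and turns remain, she updates her memory, with the fresh random
tape `ω t` for her next turn `t`. -/
def WinsFrom (σ : Strategy N m L) (M : Matching N) (ω : Fin N → Fin L → Bool)
    (β : BobStrategy N) : ℕ → List (Fin N) → Fin (2 ^ m) → Prop
  | 0, _, _ => True
  | n + 1, said, s =>
      let a := σ.g s
      let b := β (said ++ [a])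
      a ∉ said ∧ (b ∈ said ++ [a] ∨
        ∀ ht : said.length + 2 < N,
          WinsFrom σ M ω β n (said ++ [a, b]) (σ.f M (ω ⟨_, ht⟩) b s ⟨_, ht⟩))

/-- For even `N`: Alice wins the game of `N` turns (`N / 2` rounds). -/
def Wins (σ : Strategy N m L) (M : Matching N) (ω : Fin N → Fin L → Bool)
    (β : BobStrategy N) : Prop :=
  σ.WinsFrom M ω β (N / 2) [] σ.init

/-- The joint law of a uniformly random perfect matching, independent uniformly random tapes for
the turns, and, independently of these, a random choice of Bob's strategy according to `B`. -/
noncomputable def law (L : ℕ) (hN : Even N) (B : PMF (BobStrategy N)) :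
    PMF (Matching N × (Fin N → Fin L → Bool) × BobStrategy N) :=
  haveI := nonempty_matching hN
  (PMF.uniformOfFintype (Matching N)).bind fun M =>
    (PMF.uniformOfFintype (Fin N → Fin L → Bool)).bind fun ω =>
      B.map fun β => (M, ω, β)

/-- The probability that Alice wins against Bob's (possibly randomized) strategy `B`. -/
noncomputable def winProb (σ : Strategy N m L) (hN : Even N) (B : PMF (BobStrategy N)) : ENNReal :=
  (law L hN B).toOuterMeasure {x | σ.Wins x.1 x.2.1 x.2.2}

end Strategy

/-- The input of a machine that computes the transition function `f`. -/
def transitionInput (N b s t : ℕ) : Port → List Bool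
  | .size => N.bits
  | .said => b.bits
  | .memory => s.bits
  | .turn => t.bits
  | .oracle => []

/-- The input of a machine that computes the output function `g`. -/
def outputInput (N s : ℕ) : Port → List Bool
  | .size => N.bits
  | .memory => s.bits
  | _ => []

/-- The strategies `σ N`, for even `N > 0`, are computable in memory `m N`: up to a constant factor
in the space, one machine with access to the matching and to a random tape of length polynomial in
`N` and `m N` computes all transition functions `f` in space `m N`, and one machine with neither (a
trivial oracle and an empty random tape) computes all output functions `g` in space `m N`. -/
def ComputableInMemory (m L : ℕ → ℕ)
    (σ : ∀ N, 0 < N → Even N → Strategy N (m N) (L N)) : Prop :=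
  ∃ (F G : OracleTM) (c : ℕ), ∀ (N : ℕ) (h₀ : 0 < N) (hN : Even N),
    L N ≤ c * (N + m N) ^ c ∧
    (∀ (M : Matching N) (ω : Fin (L N) → Bool) (b : Fin N) (s : Fin (2 ^ m N)) (t : Fin N),
      F.Computes M.oracle (c * m N) (transitionInput N b s t) (List.ofFn ω) .memory
        ((σ N h₀ hN).f M ω b s t)) ∧
    ∀ s : Fin (2 ^ m N),
      G.Computes id (c * m N) (outputInput N s) [] .said ((σ N h₀ hN).g s)

end MirrorGame

/-! Alice opens with 0 and keeps one open number `h` whose match has not been said; all other said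
numbers form pairs of the matching. If Bob says `b` with match different from `h`, Alice replies
with the match of `b`, which is new because the rest is paired (`Paired.reply`). Only when Bob hits
the match of `h` is the set of said numbers closed under matching, and Alice needs a fresh number,
which becomes the new `h` (`Paired.fresh`).

Fresh numbers have two sources. Let w = `width N` and r = `side N`, which is about √N. While more
than `threshold N` = r w numbers are left, they come from a pool of random candidates, stored once
and divided into `groups N` = 2w groups of `groupSize N` = 4r candidates of w bits. Said candidates
are struck out, each hit uses up one group, and the first usable candidate of the group is taken.
Later they come from algebra: each number has an odd prime as its label, polynomially bounded, and
Alice stores the product of the labels of all said numbers modulo a power of 2. This product is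
invertible, so the known product of all labels gives the product of the missing ones modulo the
power of 2, and exactly, since few labels are missing. Its prime factors are the unsaid numbers
(`recover_eq`). Both stores take O(r w²) bits (`memory_le`).

Failure is bounded by deferred decisions. Given the revealed pairs, the match of Bob's new number is
uniform over the u possible ones, because conjugation by a transposition permutes the remaining
matchings (`card_fiber_mul`). So a hit has conditional probability 1/u while u drops by 2 per round,
and the potential R ε + (u + 1)/2^R, with R groups left, bounds the probability of failure
(`failBound_step`, `failsRarely`). Here ε = 1/N² bounds the probability that a group has no usable
candidate (`sum_ind_exhausted_le`), and unused groups are independent of the history. At the start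
the potential is at most 3/N. A bound against every deterministic Bob carries over to randomized
ones by averaging (`Strategy.le_winProb`).

For the computability, binary counters on tapes implement programs with increment, decrement, oracle
call and loop (`Exec.runs`). These programs compute a class of functions closed under recursion with
values of linearly many bits (`Cmp.recOn`). Running time is irrelevant, so primes, labels and
quotients are found by exhaustive search, and the transition and output functions lie in the class
(`strategy_computable`). -/

namespace MirrorGame

open Relation

/-! ### Machine fragments -/

/-- The index type of the tapes of a machine with `k` work tapes. -/
abbrev TapeIx (k : ℕ) : Type := Port ⊕ Fin k

/-- A machine fragment: the control of an oracle machine with `k` work tapes and one exit, which is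
the state `none`. The second component of `next` is `none` for a call of the oracle, and otherwise
consists of the symbols to be written, the moves, and the advance of the random tape. -/
structure Frag (k : ℕ) where
  State : Type
  [finite : Finite State]
  start : State
  next : State → (TapeIx k → Option Bool) → Option Bool →
    Option State × Option ((TapeIx k → Option Bool) × (TapeIx k → Option Turing.Dir) × Bool)

namespace Frag

variable {k : ℕ}

/-- The contents of all tapes. -/
abbrev Data (k : ℕ) : Type := (TapeIx k → Tape) × List Bool

/-- The effect of the second component of `Frag.next` on the tapes. -/
def applyTo (O : List Bool → List Bool) (x : Data k) :
    Option ((TapeIx k → Option Bool) × (TapeIx k → Option Turing.Dir) × Bool) → Data k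
  | none => (Function.update x.1 (.inl .oracle) (Tape.ofWord (O (x.1 (.inl .oracle)).word)), x.2)
  | some (w, d, adv) =>
      (fun i => ((x.1 i).write (w i)).move (d i), if adv then x.2.tail else x.2)

/-- The data after one step in state `q`. -/
def step (F : Frag k) (O : List Bool → List Bool) (q : F.State) (x : Data k) :
    Option F.State × Data k :=
  ((F.next q (fun i => (x.1 i).head) x.2.head?).1,
    applyTo O x (F.next q (fun i => (x.1 i).head) x.2.head?).2)

/-- One step after which no tape has more than `B` cells in use. -/
def Step (F : Frag k) (O : List Bool → List Bool) (B : ℕ)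
    (c c' : Option F.State × Data k) : Prop :=
  ∃ q, c.1 = some q ∧ c' = F.step O q c.2 ∧ ∀ i, (c'.2.1 i).size ≤ B

/-- The fragment, entered with data `x`, exits with data `y`, and no tape ever has more than `B`
cells in use. -/
def Runs (F : Frag k) (O : List Bool → List Bool) (B : ℕ) (x y : Data k) : Prop :=
  ReflTransGen (F.Step O B) (some F.start, x) (none, y)

/-- The machine that runs a fragment and then halts. -/
def toTM (F : Frag k) : OracleTM where
  State := Option F.State
  finite := haveI := F.finite; inferInstance
  work := k
  start := some F.start
  next q sym rnd := match q with
    | none => .halt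
    | some q => match F.next q sym rnd with
      | (q', none) => .query q'
      | (q', some (w, d, adv)) => .act q' w d adv

theorem toTM_step (F : Frag k) (O : List Bool → List Bool) (q : F.State) (x : Data k) :
    F.toTM.step O ⟨some q, x.1, x.2⟩ =
      some ⟨(F.step O q x).1, (F.step O q x).2.1, (F.step O q x).2.2⟩ := by
  obtain ⟨T, r⟩ := x
  simp only [OracleTM.step, toTM, step]
  rcases h : F.next q (fun i => (T i).head) r.head? with ⟨q', _ | ⟨w, d, adv⟩⟩
  · simp only [applyTo]
    rfl
  · rfl

/-- The machine is deterministic, so every reachable configuration lies on the given run, and a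
bound for each tape along the run bounds the space of all of them. -/
theorem Runs.computes {F : Frag k} {O : List Bool → List Bool} {B : ℕ}
    {input : Port → List Bool} {random : List Bool} {y : Data k}
    (h : F.Runs O B
      (Sum.elim (fun p => Tape.ofWord (input p)) (fun _ => Tape.ofWord []), random) y)
    (h₀ : ∀ p, (Tape.ofWord (input p)).size ≤ B) (hB : 1 ≤ B) (out : Port) :
    F.toTM.Computes O (Fintype.card (TapeIx k) * B) input random out
      (value (y.1 (.inl out)).word) := by
  let cfg : Option F.State × Data k → F.toTM.Config := fun c => ⟨c.1, c.2.1, c.2.2⟩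
  have hstep : ∀ c c', F.Step O B c c' → F.toTM.step O (cfg c) = some (cfg c') := by
    rintro ⟨q, x⟩ c' ⟨q', rfl, rfl, -⟩
    exact F.toTM_step O q' x
  have hhalt : ∀ x, F.toTM.step O (cfg (none, x)) = none := fun x => rfl
  have hspace : ∀ c : Option F.State × Data k, (∀ i, (c.2.1 i).size ≤ B) →
      OracleTM.space (cfg c) ≤ Fintype.card (TapeIx k) * B := by
    intro c hc
    refine (Finset.sum_le_card_nsmul _ _ B fun i _ => hc i).trans ?_
    rw [smul_eq_mul]; rfl
  refine ⟨⟨cfg (none, y), ?_, hhalt y, rfl⟩, ?_⟩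
  · exact ReflTransGen.lift cfg (fun a b hab => hstep a b hab) _ _ h
  · have key : ∀ c, ReflTransGen (F.Step O B) c (none, y) → (∀ i, (c.2.1 i).size ≤ B) →
        ∀ d, StateTransition.Reaches (F.toTM.step O) (cfg c) d →
          OracleTM.space d ≤ Fintype.card (TapeIx k) * B := by
      intro c hc
      induction hc using ReflTransGen.head_induction_on with
      | refl =>
        intro hs d hd
        rcases ReflTransGen.cases_head hd with h | ⟨e, he, -⟩
        · exact h ▸ hspace _ hs
        · rw [hhalt] at he; cases he
      | head hab hbc ih =>
        intro hs d hd
        rcases ReflTransGen.cases_head hd with h | ⟨e, he, hed⟩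
        · exact h ▸ hspace _ hs
        · rw [hstep _ _ hab] at he
          cases he
          obtain ⟨q, -, -, hb⟩ := hab
          exact ih hb d hed
    refine key _ h ?_
    rintro (p | i)
    · exact h₀ p
    · simpa [Tape.ofWord, Tape.size] using hB

/-- Run `F`, then `G`. -/
def seq (F G : Frag k) : Frag k where
  State := F.State ⊕ G.State
  finite := haveI := F.finite; haveI := G.finite; inferInstance
  start := .inl F.start
  next q sym rnd := match q with
    | .inl q => ((F.next q sym rnd).1.elim (some (.inr G.start)) (fun q' => some (.inl q')),
        (F.next q sym rnd).2)
    | .inr q => ((G.next q sym rnd).1.map .inr, (G.next q sym rnd).2)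

theorem Runs.seq {F G : Frag k} {O : List Bool → List Bool} {B : ℕ} {x y z : Data k}
    (h₁ : F.Runs O B x y) (h₂ : G.Runs O B y z) : (F.seq G).Runs O B x z := by
  refine ReflTransGen.trans (b := (some (.inr G.start), y)) ?_ ?_
  · refine ReflTransGen.lift (r := F.Step O B) (p := (F.seq G).Step O B)
      (fun c => (c.1.elim (some (.inr G.start)) (fun q' => some (.inl q')), c.2)) ?_ _ _ h₁
    rintro ⟨_, x⟩ _ ⟨q, rfl, rfl, hb⟩
    exact ⟨.inl q, rfl, rfl, hb⟩
  · refine ReflTransGen.lift (r := G.Step O B) (p := (F.seq G).Step O B)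
      (fun c => (c.1.map .inr, c.2)) ?_ _ _ h₂
    rintro ⟨_, x⟩ _ ⟨q, rfl, rfl, hb⟩
    exact ⟨.inr q, rfl, rfl, hb⟩

/-- Run `F` as long as the symbol under the head of tape `i` is not blank. -/
def loop (i : TapeIx k) (F : Frag k) : Frag k where
  State := Option F.State
  finite := haveI := F.finite; inferInstance
  start := none
  next q sym rnd := match q with
    -- The state `none` of the loop is the test, which writes back what it reads. The exit of `F`
    -- becomes `some none`, which is this state again.
    | none => (if sym i = none then none else some (some F.start),
        some (sym, fun _ => none, false))
    | some q => (some (F.next q sym rnd).1, (F.next q sym rnd).2)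

theorem Runs.loop_exit {F : Frag k} {O : List Bool → List Bool} {B : ℕ} {x : Data k}
    {i : TapeIx k} (hB : ∀ j, (x.1 j).size ≤ B) (h : (x.1 i).head = none) :
    (F.loop i).Runs O B x x := by
  refine ReflTransGen.single ⟨none, rfl, ?_, hB⟩
  simp only [step, loop, h, if_true]
  rfl

theorem Runs.loop_again {F : Frag k} {O : List Bool → List Bool} {B : ℕ} {x y z : Data k}
    {i : TapeIx k} (hB : ∀ j, (x.1 j).size ≤ B) (h : (x.1 i).head ≠ none) (h₁ : F.Runs O B x y)
    (h₂ : (F.loop i).Runs O B y z) : (F.loop i).Runs O B x z := by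
  refine ReflTransGen.head (b := (some (some F.start), x)) ⟨none, rfl, ?_, hB⟩ ?_
  · simp only [step, loop, h, if_false]
    rfl
  · refine ReflTransGen.trans ?_ h₂
    refine ReflTransGen.lift (r := F.Step O B) (p := (F.loop i).Step O B)
      (fun c => (some c.1, c.2)) ?_ _ _ h₁
    rintro ⟨_, x⟩ _ ⟨q, rfl, rfl, hb⟩
    exact ⟨some q, rfl, rfl, hb⟩

/-- Call the oracle. -/
def query : Frag k where
  State := Unit
  start := ()
  next _ _ _ := (none, none)

theorem Runs.query {O : List Bool → List Bool} {B : ℕ} {x : Data k}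
    (hB : ∀ j, (x.1 j).size ≤ B)
    (hO : (Tape.ofWord (O (x.1 (.inl .oracle)).word)).size ≤ B) :
    (Frag.query (k := k)).Runs O B x
      (Function.update x.1 (.inl .oracle) (Tape.ofWord (O (x.1 (.inl .oracle)).word)), x.2) := by
  refine ReflTransGen.single ⟨(), rfl, rfl, fun j => ?_⟩
  by_cases hj : j = .inl .oracle
  · subst hj; simpa using hO
  · simpa [hj] using hB j

/-! ### Fragments that act on one tape -/

/-- The control of a machine with one tape and a random tape. -/
abbrev Local (Q : Type) : Type :=
  Q → Option Bool → Option Bool → Option Q × Option Bool × Option Turing.Dir × Bool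

/-- One step of a machine with one tape. -/
def LocalStep {Q : Type} (δ : Local Q) (B : ℕ) (c c' : Option Q × Tape × List Bool) : Prop :=
  ∃ q, c.1 = some q ∧
    c' = ((δ q c.2.1.head c.2.2.head?).1,
      (c.2.1.write (δ q c.2.1.head c.2.2.head?).2.1).move (δ q c.2.1.head c.2.2.head?).2.2.1,
      if (δ q c.2.1.head c.2.2.head?).2.2.2 then c.2.2.tail else c.2.2) ∧
    c'.2.1.size ≤ B

/-- Act on tape `i` and leave the other tapes alone. -/
def onTape (i : TapeIx k) {Q : Type} [Finite Q] (q₀ : Q) (δ : Local Q) : Frag k where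
  State := Q
  start := q₀
  next q sym rnd := ((δ q (sym i) rnd).1,
    some (Function.update sym i (δ q (sym i) rnd).2.1,
      Function.update (fun _ => none) i (δ q (sym i) rnd).2.2.1, (δ q (sym i) rnd).2.2.2))

theorem Runs.onTape {O : List Bool → List Bool} {B : ℕ} {Q : Type} [Finite Q] {q₀ : Q}
    {δ : Local Q} {T : TapeIx k → Tape} {i : TapeIx k} {rnd rnd' : List Bool} {t : Tape}
    (hB : ∀ j, (T j).size ≤ B)
    (h : ReflTransGen (LocalStep δ B) (some q₀, T i, rnd) (none, t, rnd')) :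
    (Frag.onTape i q₀ δ).Runs O B (T, rnd) (Function.update T i t, rnd') := by
  have h' := ReflTransGen.lift (r := LocalStep δ B) (p := (Frag.onTape i q₀ δ).Step O B)
    (fun c => (c.1, Function.update T i c.2.1, c.2.2)) ?_ _ _ h
  · rw [Function.onFun, Function.update_eq_self] at h'
    exact h'
  · rintro ⟨_, t, r⟩ _ ⟨q, rfl, rfl, hb⟩
    refine ⟨q, rfl, ?_, fun j => ?_⟩
    · simp only [step, Frag.onTape, applyTo, Function.update_self, Prod.mk.injEq, true_and, and_true]
      funext j
      by_cases hj : j = i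
      · subst hj; simp
      · simp [hj, Tape.move, Tape.write]
    · by_cases hj : j = i
      · subst hj; simpa using hb
      · simpa [hj] using hB j

end Frag

end MirrorGame

namespace MirrorGame

open Relation

/-! ### Binary counters on tapes -/

/-- The tape with the cells `l` (nearest first) to the left of the head and the cells `r` from the
head on. -/
def Tape.zip (l r : List (Option Bool)) : Tape := ⟨l, r.headD none, r.tail⟩

namespace Tape

theorem ofWord_eq_zip (w : List Bool) : ofWord w = zip [] (w.map some) := by
  cases w <;> rfl

theorem move_right_zip (l r : List (Option Bool)) (a : Option Bool) :
    (zip l (a :: r)).move (some .right) = zip (a :: l) r := by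
  cases r <;> rfl

theorem size_zip_le (l r : List (Option Bool)) : (zip l r).size ≤ l.length + r.length + 1 := by
  cases r <;> simp [zip, size]; omega

theorem prefixWord_append (w : List Bool) (j : ℕ) :
    prefixWord (w.map some ++ List.replicate j none) = w := by
  induction w with
  | nil => cases j <;> rfl
  | cons a w ih => simp [prefixWord, ih]

theorem word_zip (l : List (Option Bool)) (w : List Bool) (j : ℕ) :
    (zip l (w.map some ++ List.replicate j none)).word = w := by
  have h : ∀ r : List (Option Bool), (zip l r).word = prefixWord r := by
    rintro (_ | ⟨a, r⟩) <;> rfl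
  rw [h, prefixWord_append]

end Tape

/-- The successor on binary expansions. -/
def incBits : List Bool → List Bool
  | [] => [true]
  | false :: w => true :: w
  | true :: w => false :: incBits w

/-- The predecessor on binary expansions. -/
def decBits : List Bool → List Bool
  | [] => []
  | [true] => []
  | true :: w => false :: w
  | false :: w => true :: decBits w

theorem bits_succ (n : ℕ) : (n + 1).bits = incBits n.bits := by
  induction n using Nat.binaryRecFromOne with
  | zero => simp [incBits]
  | one =>
    rw [show (1 + 1 : ℕ) = 2 * 1 from rfl, Nat.bit0_bits 1 one_ne_zero, Nat.one_bits]
    rfl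
  | bit b n hn ih =>
    cases b
    · rw [show Nat.bit false n = 2 * n from rfl, Nat.bit1_bits, Nat.bit0_bits n hn, incBits]
    · rw [show Nat.bit true n = 2 * n + 1 from rfl, Nat.bit1_bits, incBits, ← ih,
        ← Nat.bit0_bits _ n.succ_ne_zero]
      congr 1

/-- The top bit must be 1: `[false]` is incremented to `[true]`, which is decremented to `[]`. -/
theorem decBits_incBits (w : List Bool) (hw : ∀ h : w ≠ [], w.getLast h = true) :
    decBits (incBits w) = w := by
  induction w with
  | nil => rfl
  | cons a w ih =>
    cases a
    · cases w with
      | nil => simp at hw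
      | cons b w => simp [incBits, decBits]
    · rw [incBits, decBits, ih]
      intro h
      simpa [List.getLast_cons h] using hw (by simp)

theorem getLast_bits (n : ℕ) (h : n.bits ≠ []) : n.bits.getLast h = true := by
  induction n using Nat.binaryRecFromOne with
  | zero => simp at h
  | one => simp
  | bit b n hn ih =>
    have hb : (Nat.bit b n).bits = b :: n.bits := Nat.bits_append_bit _ _ (fun h => absurd h hn)
    have hne : n.bits ≠ [] := by
      intro h0
      have := Nat.size_eq_bits_len n
      rw [h0] at this
      exact hn (Nat.size_eq_zero.mp this.symm)
    simp [hb, List.getLast_cons hne, ih]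

theorem bits_pred (n : ℕ) : (n - 1).bits = decBits n.bits := by
  cases n with
  | zero => simp [decBits]
  | succ n => rw [bits_succ, decBits_incBits _ (getLast_bits n), Nat.add_sub_cancel]

theorem value_bits (n : ℕ) : value n.bits = n := by
  induction n using Nat.binaryRecFromOne with
  | zero => simp [value]
  | one => simp [value]
  | bit b n hn ih =>
    rw [Nat.bits_append_bit _ _ (fun h => absurd h hn)]
    simpa [value] using congrArg (Nat.bit b) ih

theorem value_lt (w : List Bool) : value w < 2 ^ w.length := by
  induction w with
  | nil => simp [value]
  | cons b w ih =>
    have : value (b :: w) = 2 * value w + b.toNat := by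
      simp [value, Nat.bit_val]
    rw [this, List.length_cons, pow_succ]
    have := b.toNat_le
    omega

theorem bits_value (w : List Bool) (hw : ∀ h : w ≠ [], w.getLast h = true) :
    (value w).bits = w := by
  induction w with
  | nil => simp [value]
  | cons a w ih =>
    have hw' : ∀ h : w ≠ [], w.getLast h = true := fun h => by
      simpa [List.getLast_cons h] using hw (by simp)
    rw [show value (a :: w) = Nat.bit a (value w) from rfl, Nat.bits_append_bit, ih hw']
    intro h0
    have h1 := ih hw'
    rw [h0] at h1
    have : w = [] := by simpa using h1.symm
    subst this
    simpa using hw (by simp)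

theorem value_append_false (w : List Bool) : value (w ++ [false]) = value w := by
  induction w with
  | nil => simp [value]
  | cons a w ih => exact congrArg (Nat.bit a) ih

/-- The tape `t` holds the number `n` in binary, with the head on the least significant bit, and
uses at most `B + 1` cells to the right of its left end. -/
def Holds (B n : ℕ) (t : Tape) : Prop :=
  ∃ i j, i ≤ 1 ∧ t = Tape.zip (List.replicate i none) (n.bits.map some ++ List.replicate j none) ∧
    n.size ≤ B ∧ n.size + j ≤ B + 1

namespace Holds

variable {B n : ℕ} {t : Tape}

theorem size_le (h : Holds B n t) : t.size ≤ B + 3 := by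
  obtain ⟨i, j, hi, rfl, -, hj⟩ := h
  refine (Tape.size_zip_le _ _).trans ?_
  simp [Nat.size_eq_bits_len]
  omega

theorem word_eq (h : Holds B n t) : t.word = n.bits := by
  obtain ⟨i, j, -, rfl, -, -⟩ := h
  exact Tape.word_zip _ _ _

/-- Zero has the empty expansion, so the loop test for a blank symbol is a test for zero. -/
theorem head_eq_none_iff (h : Holds B n t) : t.head = none ↔ n = 0 := by
  obtain ⟨i, j, -, rfl, -, -⟩ := h
  rcases Nat.eq_zero_or_pos n with rfl | hn
  · cases j <;> simp [Tape.zip, List.replicate_succ]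
  · have : n.bits ≠ [] := by
      intro h0
      have := Nat.size_eq_bits_len n
      rw [h0] at this
      exact hn.ne' (Nat.size_eq_zero.mp this.symm)
    obtain ⟨a, w, hw⟩ := List.exists_cons_of_ne_nil this
    simp [Tape.zip, hw, hn.ne']

theorem ofWord (h : n < 2 ^ B) : Holds B n (Tape.ofWord n.bits) := by
  have := Nat.size_le.mpr h
  exact ⟨0, 0, by simp, by simp [Tape.ofWord_eq_zip], this, by omega⟩

end Holds

/-! ### Increment, decrement and copying of the random tape, on one tape. -/

namespace Frag

/-- Control states of the fragments for binary counters. -/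
inductive CounterState
  | scan | check | erase | trim | rewind

instance : Finite CounterState :=
  Finite.of_surjective (fun i : Fin 5 => ![.scan, .check, .erase, .trim, .rewind] i) fun q => by
    cases q
    exacts [⟨0, rfl⟩, ⟨1, rfl⟩, ⟨2, rfl⟩, ⟨3, rfl⟩, ⟨4, rfl⟩]

/-- Move left to the next blank, then one cell to the right, and exit. -/
def rewindRule (a : Option Bool) : Option CounterState × Option Bool × Option Turing.Dir × Bool :=
  match a with
  | none => (none, none, some .right, false)
  | some b => (some .rewind, some b, some .left, false)

/-- Here `v` is the part of the word that has been passed, nearest cell first. Whether or not a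
blank cell on the left was in use before, exactly one is in use afterwards. -/
theorem local_rewind {δ : Local CounterState} (hδ : ∀ a b, δ .rewind a b = rewindRule a) {B : ℕ}
    {rnd : List Bool} (v : List Bool) (i : ℕ) (a : Option Bool) (r : List (Option Bool))
    (hi : i ≤ 1) (hB : v.length + r.length + 4 ≤ B) :
    ReflTransGen (LocalStep δ B)
      (some .rewind, (Tape.zip (v.map some ++ List.replicate i none) (a :: r)).move (some .left),
        rnd)
      (none, Tape.zip (List.replicate 1 none) (v.reverse.map some ++ a :: r), rnd) := by
  induction v generalizing a r with
  | nil =>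
    refine ReflTransGen.single ⟨.rewind, rfl, ?_, ?_⟩
    · rw [hδ]
      have : i = 0 ∨ i = 1 := by omega
      rcases this with rfl | rfl
      · simp [Tape.zip, rewindRule, Tape.move, Tape.write]
      · simp [Tape.zip, rewindRule, Tape.move, Tape.write]
    · refine (Tape.size_zip_le _ _).trans ?_
      simp at hB ⊢
      omega
  | cons x v ih =>
    refine ReflTransGen.head (b := (some .rewind,
      (Tape.zip (v.map some ++ List.replicate i none) (some x :: a :: r)).move (some .left),
        rnd)) ⟨.rewind, rfl, ?_, ?_⟩ ?_
    · rw [hδ]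
      simp [Tape.zip, Tape.move, rewindRule, Tape.write]
    · have : i = 0 ∨ i = 1 := by omega
      simp only [List.length_cons] at hB
      cases v <;> rcases this with rfl | rfl <;> simp [Tape.zip, Tape.move, Tape.size] at hB ⊢ <;>
        omega
    · have := ih (some x) (a :: r) (by simp at hB ⊢; omega)
      simpa using this

/-- Control of the increment. -/
def incRule : Local CounterState
  | .scan, some true, _ => (some .scan, some false, some .right, false)
  | .scan, _, _ => (some .rewind, some true, some .left, false)
  | .rewind, a, _ => rewindRule a
  | _, a, _ => (none, a, none, false)

theorem local_step_size_left {l r : List (Option Bool)} {a : Option Bool} {B : ℕ}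
    (hB : l.length + r.length + 2 ≤ B) :
    ((Tape.zip l (a :: r)).move (some .left)).size ≤ B := by
  cases l <;> simp [Tape.zip, Tape.move, Tape.size] at hB ⊢ <;> omega

/-- Induction on the unread part `w`; the carry has already passed over `v`. The bound on `j'` says
that the tape grows only if the number needs a new bit, so that repeated increments do not
accumulate space. -/
theorem local_inc {B : ℕ} {rnd : List Bool} (w v : List Bool) (i j : ℕ) (hi : i ≤ 1)
    (hB : v.length + w.length + j + 5 ≤ B) :
    ∃ j', (incBits w).length + j' ≤ max (w.length + j) (incBits w).length ∧
      ReflTransGen (LocalStep incRule B)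
        (some .scan, Tape.zip (v.map some ++ List.replicate i none)
          (w.map some ++ List.replicate j none), rnd)
        (none, Tape.zip (List.replicate 1 none)
          (v.reverse.map some ++ ((incBits w).map some ++ List.replicate j' none)), rnd) := by
  induction w generalizing v with
  | nil =>
    -- The new top bit takes the place of one trailing blank, if there is one.
    refine ⟨j - 1, by simp [incBits]; omega, ?_⟩
    have hz : Tape.zip (v.map some ++ List.replicate i none)
        (([] : List Bool).map some ++ List.replicate j none) =
        Tape.zip (v.map some ++ List.replicate i none) (none :: List.replicate (j - 1) none) := by
      cases j <;> simp [List.replicate_succ, Tape.zip]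
    rw [hz]
    refine ReflTransGen.head (b := (some .rewind,
      (Tape.zip (v.map some ++ List.replicate i none)
        (some true :: List.replicate (j - 1) none)).move (some .left), rnd))
      ⟨.scan, rfl, rfl, ?_⟩ ?_
    · refine local_step_size_left ?_
      simp at hB ⊢
      omega
    · have := local_rewind (δ := incRule) (fun _ _ => rfl) (rnd := rnd) v i (some true)
        (List.replicate (j - 1) none) hi (B := B) (by simp at hB ⊢; omega)
      simpa [incBits] using this
  | cons a w ih =>
    cases a
    · refine ⟨j, by simp [incBits], ?_⟩
      refine ReflTransGen.head (b := (some .rewind,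
        (Tape.zip (v.map some ++ List.replicate i none)
          (some true :: (w.map some ++ List.replicate j none))).move (some .left), rnd))
        ⟨.scan, rfl, rfl, ?_⟩ ?_
      · refine local_step_size_left ?_
        simp at hB ⊢
        omega
      · have := local_rewind (δ := incRule) (fun _ _ => rfl) (rnd := rnd) v i (some true)
          (w.map some ++ List.replicate j none) hi (B := B) (by simp at hB ⊢; omega)
        simpa [incBits] using this
    · obtain ⟨j', hj', hr⟩ := ih (false :: v) (by simp at hB ⊢; omega)
      refine ⟨j', by simp [incBits] at hj' ⊢; omega, ?_⟩
      refine ReflTransGen.head (b := (some .scan,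
        Tape.zip ((false :: v).map some ++ List.replicate i none)
          (w.map some ++ List.replicate j none), rnd)) ⟨.scan, rfl, ?_, ?_⟩ ?_
      · refine Prod.ext rfl (Prod.ext ?_ rfl)
        exact (Tape.move_right_zip _ _ _).symm
      · refine (Tape.size_zip_le _ _).trans ?_
        simp at hB ⊢
        omega
      · simpa [incBits] using hr

/-- Control of the decrement. -/
def decRule : Local CounterState
  | .scan, some false, _ => (some .scan, some true, some .right, false)
  | .scan, some true, _ => (some .check, some false, some .right, false)
  | .check, none, _ => (some .erase, none, some .left, false)
  | .check, some a, _ => (some .rewind, some a, some .left, false)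
  | .erase, _, _ => (some .rewind, none, some .left, false)
  | .rewind, a, _ => rewindRule a
  | _, a, _ => (none, a, none, false)

/-- When the borrow ends at a 1, the next cell is inspected: if it is blank, that 1 was the top bit
and is erased to keep the expansion free of leading zeros. This inspection is why the bound allows
`w.length + 1`. -/
theorem local_dec {B : ℕ} {rnd : List Bool} (w v : List Bool) (i j : ℕ) (hi : i ≤ 1)
    (hw : w ≠ []) (hlast : w.getLast hw = true) (hB : v.length + w.length + j + 6 ≤ B) :
    ∃ j', (decBits w).length + j' ≤ max (w.length + j) (w.length + 1) ∧
      ReflTransGen (LocalStep decRule B)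
        (some .scan, Tape.zip (v.map some ++ List.replicate i none)
          (w.map some ++ List.replicate j none), rnd)
        (none, Tape.zip (List.replicate 1 none)
          (v.reverse.map some ++ ((decBits w).map some ++ List.replicate j' none)), rnd) := by
  induction w generalizing v with
  | nil => exact absurd rfl hw
  | cons a w ih =>
    cases a
    · have hw' : w ≠ [] := by
        rintro rfl
        simp at hlast
      obtain ⟨j', hj', hr⟩ := ih (true :: v) hw' (by simpa [List.getLast_cons hw'] using hlast)
        (by simp at hB ⊢; omega)
      refine ⟨j', by simp [decBits] at hj' ⊢; omega, ?_⟩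
      refine ReflTransGen.head (b := (some .scan,
        Tape.zip ((true :: v).map some ++ List.replicate i none)
          (w.map some ++ List.replicate j none), rnd)) ⟨.scan, rfl, ?_, ?_⟩ ?_
      · refine Prod.ext rfl (Prod.ext ?_ rfl)
        exact (Tape.move_right_zip _ _ _).symm
      · refine (Tape.size_zip_le _ _).trans ?_
        simp at hB ⊢
        omega
      · simpa [decBits] using hr
    · cases w with
      | nil =>
        -- Two blanks come from the erased top bit and the inspected cell; `j - 1` trailing blanks
        -- follow them.
        refine ⟨j - 1 + 2, by simp [decBits]; omega, ?_⟩
        have hz : Tape.zip ((false :: v).map some ++ List.replicate i none)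
            (([] : List Bool).map some ++ List.replicate j none) =
            Tape.zip ((false :: v).map some ++ List.replicate i none)
              (none :: List.replicate (j - 1) none) := by
          cases j <;> simp [List.replicate_succ, Tape.zip]
        refine ReflTransGen.head (b := (some .check,
          Tape.zip ((false :: v).map some ++ List.replicate i none)
            (none :: List.replicate (j - 1) none), rnd)) ⟨.scan, rfl, ?_, ?_⟩ ?_
        · refine Prod.ext rfl (Prod.ext ?_ rfl)
          exact hz.symm.trans (Tape.move_right_zip _ _ _).symm
        · refine (Tape.size_zip_le _ _).trans ?_
          simp at hB ⊢
          omega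
        refine ReflTransGen.head (b := (some .erase,
          Tape.zip (v.map some ++ List.replicate i none)
            (some false :: none :: List.replicate (j - 1) none), rnd)) ⟨.check, rfl, rfl, ?_⟩ ?_
        · refine (Tape.size_zip_le _ _).trans ?_
          simp at hB ⊢
          omega
        refine ReflTransGen.head (b := (some .rewind,
          (Tape.zip (v.map some ++ List.replicate i none)
            (none :: none :: List.replicate (j - 1) none)).move (some .left), rnd))
          ⟨.erase, rfl, rfl, ?_⟩ ?_
        · refine local_step_size_left ?_
          simp at hB ⊢
          omega
        have := local_rewind (δ := decRule) (fun _ _ => rfl) (rnd := rnd) v i none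
          (none :: List.replicate (j - 1) none) hi (B := B) (by simp at hB ⊢; omega)
        simpa [decBits, List.replicate_succ] using this
      | cons b w =>
        refine ⟨j, by simp [decBits], ?_⟩
        refine ReflTransGen.head (b := (some .check,
          Tape.zip ((false :: v).map some ++ List.replicate i none)
            (some b :: (w.map some ++ List.replicate j none)), rnd)) ⟨.scan, rfl, ?_, ?_⟩ ?_
        · refine Prod.ext rfl (Prod.ext ?_ rfl)
          exact (Tape.move_right_zip _ _ _).symm
        · refine (Tape.size_zip_le _ _).trans ?_
          simp at hB ⊢
          omega
        refine ReflTransGen.head (b := (some .rewind,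
          (Tape.zip ((false :: v).map some ++ List.replicate i none)
            (some b :: (w.map some ++ List.replicate j none))).move (some .left), rnd))
          ⟨.check, rfl, rfl, ?_⟩ ?_
        · refine local_step_size_left ?_
          simp at hB ⊢
          omega
        have := local_rewind (δ := decRule) (fun _ _ => rfl) (rnd := rnd) (false :: v) i (some b)
          (w.map some ++ List.replicate j none) hi (B := B) (by simp at hB ⊢; omega)
        simpa [decBits] using this

/-- Control of the fragment that copies the random tape. -/
def readRule : Local CounterState
  | .scan, _, some b => (some .scan, some b, some .right, true)
  | .scan, a, none => (some .trim, a, some .left, false)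
  | .trim, some false, _ => (some .trim, none, some .left, false)
  | .trim, some true, _ => (some .rewind, some true, some .left, false)
  | .trim, none, _ => (none, none, some .right, false)
  | .rewind, a, _ => rewindRule a
  | _, a, _ => (none, a, none, false)

/-- A random word may end in zeros, which are leading zeros of its value. They are blanked from the
end, so that the tape holds the canonical expansion. -/
theorem local_trim {B : ℕ} (v : List Bool) (j : ℕ) (hB : v.length + j + 6 ≤ B) :
    ∃ j', (value v.reverse).size + j' ≤ v.length + j + 1 ∧
      ReflTransGen (LocalStep readRule B)
        (some .trim, (Tape.zip (v.map some) (List.replicate (j + 1) none)).move (some .left), [])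
        (none, Tape.zip (List.replicate 1 none)
          ((value v.reverse).bits.map some ++ List.replicate j' none), []) := by
  induction v generalizing j with
  | nil =>
    refine ⟨j + 1, by simp [value], ReflTransGen.single ⟨.trim, rfl, ?_, ?_⟩⟩
    · simp [Tape.zip, readRule, Tape.move, Tape.write, List.replicate_succ, value]
    · refine (Tape.size_zip_le _ _).trans ?_
      simp [value] at hB ⊢
      omega
  | cons a v ih =>
    cases a
    · obtain ⟨j', hj', hr⟩ := ih (j + 1) (by simp at hB ⊢; omega)
      have hv : value (false :: v).reverse = value v.reverse := by
        simp [value_append_false]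
      refine ⟨j', by rw [hv]; simp at hj' ⊢; omega, ?_⟩
      refine ReflTransGen.head (b := (some .trim,
        (Tape.zip (v.map some) (List.replicate (j + 1 + 1) none)).move (some .left), []))
        ⟨.trim, rfl, rfl, ?_⟩ ?_
      · rw [List.replicate_succ]
        refine local_step_size_left ?_
        simp at hB ⊢
        omega
      · rw [hv]
        exact hr
    · have hb : (value (true :: v).reverse).bits = (true :: v).reverse :=
        bits_value _ (by simp)
      refine ⟨j + 1, ?_, ?_⟩
      · rw [← Nat.size_eq_bits_len, hb]
        simp
        omega
      · refine ReflTransGen.head (b := (some .rewind,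
          (Tape.zip (v.map some ++ List.replicate 0 none)
            (some true :: List.replicate (j + 1) none)).move (some .left), []))
          ⟨.trim, rfl, ?_, ?_⟩ ?_
        · simp [Tape.zip, readRule, Tape.move, Tape.write, List.replicate_succ]
        · refine local_step_size_left ?_
          simp at hB ⊢
          omega
        · have := local_rewind (δ := readRule) (fun _ _ => rfl) (rnd := []) v 0 (some true)
            (List.replicate (j + 1) none) (by simp) (B := B) (by simp at hB ⊢; omega)
          rw [hb]
          simpa using this

theorem local_read {B : ℕ} (rnd v : List Bool) (hB : v.length + rnd.length + 6 ≤ B) :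
    ∃ j', (value (v.reverse ++ rnd)).size + j' ≤ v.length + rnd.length + 1 ∧
      ReflTransGen (LocalStep readRule B)
        (some .scan, Tape.zip (v.map some) [], rnd)
        (none, Tape.zip (List.replicate 1 none)
          ((value (v.reverse ++ rnd)).bits.map some ++ List.replicate j' none), []) := by
  induction rnd generalizing v with
  | nil =>
    obtain ⟨j', hj', hr⟩ := local_trim v 0 (B := B) (by simpa using hB)
    refine ⟨j', by simpa using hj', ?_⟩
    rw [List.append_nil]
    refine ReflTransGen.head ⟨.scan, rfl, rfl, ?_⟩ hr
    refine local_step_size_left (l := v.map some) (r := []) (a := none) ?_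
    simp at hB ⊢
    omega
  | cons b rnd ih =>
    obtain ⟨j', hj', hr⟩ := ih (b :: v) (by simp at hB ⊢; omega)
    refine ⟨j', by simp at hj' ⊢; omega, ?_⟩
    refine ReflTransGen.head (b := (some .scan, Tape.zip ((b :: v).map some) [], rnd))
      ⟨.scan, rfl, rfl, ?_⟩ ?_
    · refine (Tape.size_zip_le _ _).trans ?_
      simp at hB ⊢
      omega
    · simpa using hr

variable {k : ℕ}

/-- Increment the number on tape `i`. -/
def inc (i : TapeIx k) : Frag k := onTape i .scan incRule

/-- Decrement the number on tape `i`. -/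
def dec (i : TapeIx k) : Frag k := onTape i .scan decRule

/-- Copy the random tape to tape `i`. -/
def read (i : TapeIx k) : Frag k := onTape i .scan readRule

theorem runs_inc {O : List Bool → List Bool} {B n : ℕ} {T : TapeIx k → Tape} {i : TapeIx k}
    {rnd : List Bool} (hB : ∀ j, (T j).size ≤ B + 7) (h : Holds B n (T i)) (hn : n + 1 < 2 ^ B) :
    ∃ t, Holds B (n + 1) t ∧ (inc i).Runs O (B + 7) (T, rnd) (Function.update T i t, rnd) := by
  obtain ⟨p, j, hp, ht, hs, hj⟩ := h
  obtain ⟨j', hj', hr⟩ := local_inc (B := B + 7) (rnd := rnd) n.bits [] p j hp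
    (by simp [Nat.size_eq_bits_len]; omega)
  have hlen : (incBits n.bits).length = (n + 1).size := by
    rw [← bits_succ, Nat.size_eq_bits_len]
  have hs' := Nat.size_le.mpr hn
  rw [hlen, Nat.size_eq_bits_len] at hj'
  refine ⟨_, ⟨1, j', le_rfl, rfl, hs', by omega⟩, Runs.onTape hB ?_⟩
  rw [ht, bits_succ]
  simpa using hr

theorem runs_dec {O : List Bool → List Bool} {B n : ℕ} {T : TapeIx k → Tape} {i : TapeIx k}
    {rnd : List Bool} (hB : ∀ j, (T j).size ≤ B + 7) (h : Holds B n (T i)) :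
    ∃ t, Holds B (n - 1) t ∧ (dec i).Runs O (B + 7) (T, rnd) (Function.update T i t, rnd) := by
  rcases Nat.eq_zero_or_pos n with rfl | hn
  -- On zero the head reads a blank and the control exits at once, which agrees with truncated
  -- subtraction.
  · refine ⟨T i, h, Runs.onTape hB (ReflTransGen.single ⟨.scan, rfl, ?_, hB i⟩)⟩
    simp [h.head_eq_none_iff.mpr rfl, decRule, Tape.move, Tape.write]
    rw [← h.head_eq_none_iff.mpr rfl]
  obtain ⟨p, j, hp, ht, hs, hj⟩ := h
  have hne : n.bits ≠ [] := by
    intro h0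
    have := Nat.size_eq_bits_len n
    rw [h0] at this
    exact hn.ne' (Nat.size_eq_zero.mp this.symm)
  obtain ⟨j', hj', hr⟩ := local_dec (B := B + 7) (rnd := rnd) n.bits [] p j hp hne
    (getLast_bits n hne) (by simp [Nat.size_eq_bits_len]; omega)
  have hlen : (decBits n.bits).length = (n - 1).size := by
    rw [← bits_pred, Nat.size_eq_bits_len]
  have hs' : (n - 1).size ≤ n.size := Nat.size_le_size (Nat.sub_le _ _)
  rw [hlen, Nat.size_eq_bits_len] at hj'
  refine ⟨_, ⟨1, j', le_rfl, rfl, by omega, by omega⟩, Runs.onTape hB ?_⟩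
  rw [ht, bits_pred]
  simpa using hr

theorem runs_read {O : List Bool → List Bool} {B : ℕ} {T : TapeIx k → Tape} {i : TapeIx k}
    {rnd : List Bool} (hB : ∀ j, (T j).size ≤ B + 7) (h : T i = Tape.ofWord [])
    (hrnd : rnd.length ≤ B) :
    ∃ t, Holds B (value rnd) t ∧
      (read i).Runs O (B + 7) (T, rnd) (Function.update T i t, []) := by
  obtain ⟨j', hj', hr⟩ := local_read (B := B + 7) rnd [] (by simp; omega)
  have hs := Nat.size_le.mpr ((value_lt rnd).trans_le (Nat.pow_le_pow_right two_pos hrnd))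
  refine ⟨_, ⟨1, j', le_rfl, rfl, hs, by simp at hj'; omega⟩, Runs.onTape hB ?_⟩
  rw [h]
  exact hr

end Frag

end MirrorGame

namespace MirrorGame

open Relation

/-! ### Counter programs -/

/-- Programs over registers that hold natural numbers. Register `4` is that of the oracle;
`loop r p` runs `p` as long as register `r` is not zero. -/
inductive Cmd
  | inc (r : ℕ)
  | dec (r : ℕ)
  | query
  | seq (p q : Cmd)
  | loop (r : ℕ) (p : Cmd)

/-- `Exec o X p s s'`: with the oracle `o`, the program `p` turns the register contents `s` into
`s'`, and the numbers that it writes are less than `X`. -/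
inductive Exec (o : ℕ → ℕ) (X : ℕ) : Cmd → (ℕ → ℕ) → (ℕ → ℕ) → Prop
  | inc {r : ℕ} {s : ℕ → ℕ} (h : s r + 1 < X) :
      Exec o X (.inc r) s (Function.update s r (s r + 1))
  | dec {r : ℕ} {s : ℕ → ℕ} : Exec o X (.dec r) s (Function.update s r (s r - 1))
  | query {s : ℕ → ℕ} (h : o (s 4) < X) : Exec o X .query s (Function.update s 4 (o (s 4)))
  | seq {p q : Cmd} {s s' s'' : ℕ → ℕ} (h₁ : Exec o X p s s') (h₂ : Exec o X q s' s'') :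
      Exec o X (.seq p q) s s''
  | loop_exit {r : ℕ} {p : Cmd} {s : ℕ → ℕ} (h : s r = 0) : Exec o X (.loop r p) s s
  | loop_again {r : ℕ} {p : Cmd} {s s' s'' : ℕ → ℕ} (h : s r ≠ 0) (h₁ : Exec o X p s s')
      (h₂ : Exec o X (.loop r p) s' s'') : Exec o X (.loop r p) s s''

namespace Cmd

/-- A bound for the registers that occur in a program. -/
def bound : Cmd → ℕ
  | inc r => r + 1
  | dec r => r + 1
  | query => 5
  | seq p q => max p.bound q.bound
  | loop r p => max (r + 1) p.bound

/-- The number of a port as a register. -/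
def portReg : Port → ℕ
  | .size => 0
  | .said => 1
  | .memory => 2
  | .turn => 3
  | .oracle => 4

/-- The register that is stored on a tape. -/
def regOf {k : ℕ} : TapeIx k → ℕ
  | .inl p => portReg p
  | .inr i => 5 + i

/-- The tape that stores a register. -/
def tapeOf (k r : ℕ) : TapeIx k :=
  match r with
  | 0 => .inl .size
  | 1 => .inl .said
  | 2 => .inl .memory
  | 3 => .inl .turn
  | 4 => .inl .oracle
  | r + 5 => if h : r < k then .inr ⟨r, h⟩ else .inl .size

theorem regOf_tapeOf {k r : ℕ} (h : r < k + 5) : regOf (tapeOf k r) = r := by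
  match r, h with
  | 0, _ => rfl
  | 1, _ => rfl
  | 2, _ => rfl
  | 3, _ => rfl
  | 4, _ => rfl
  | r + 5, h =>
    have : r < k := by omega
    simp [tapeOf, this, regOf, Nat.add_comm]

theorem regOf_injective {k : ℕ} : Function.Injective (regOf (k := k)) := by
  rintro (p | i) (q | j) h
  · cases p <;> cases q <;> simp [regOf, portReg] at h ⊢
  · cases p <;> simp [regOf, portReg] at h <;> omega
  · cases q <;> simp [regOf, portReg] at h <;> omega
  · simp only [regOf] at h
    have : i = j := by omega
    rw [this]

/-- Compilation of a program to a machine fragment. -/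
def compile (k : ℕ) : Cmd → Frag k
  | inc r => Frag.inc (tapeOf k r)
  | dec r => Frag.dec (tapeOf k r)
  | query => Frag.query
  | seq p q => (p.compile k).seq (q.compile k)
  | loop r p => (p.compile k).loop (tapeOf k r)

end Cmd

open Cmd

/-- The tapes hold the contents of the registers. -/
def HoldsAll {k : ℕ} (B : ℕ) (s : ℕ → ℕ) (T : TapeIx k → Tape) : Prop :=
  ∀ i, Holds B (s (regOf i)) (T i)

theorem HoldsAll.update {k B : ℕ} {s : ℕ → ℕ} {T : TapeIx k → Tape} (h : HoldsAll B s T)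
    (i : TapeIx k) {n : ℕ} {t : Tape} (ht : Holds B n t) :
    HoldsAll B (Function.update s (regOf i) n) (Function.update T i t) := by
  intro j
  by_cases hj : j = i
  · subst hj; simpa using ht
  · simpa [hj, regOf_injective.ne hj] using h j

theorem HoldsAll.size_le {k B : ℕ} {s : ℕ → ℕ} {T : TapeIx k → Tape} (h : HoldsAll B s T)
    (i : TapeIx k) : (T i).size ≤ B + 7 :=
  (h i).size_le.trans (by omega)

/-- Registers are always stored as canonical expansions, so it is enough to know `O` on these words.
-/
theorem Exec.runs {o : ℕ → ℕ} {O : List Bool → List Bool} (hO : ∀ n, O n.bits = (o n).bits)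
    {B k : ℕ} {p : Cmd} {s s' : ℕ → ℕ} (h : Exec o (2 ^ B) p s s') (hp : p.bound ≤ k + 5)
    {T : TapeIx k → Tape} (hT : HoldsAll B s T) (rnd : List Bool) :
    ∃ T', HoldsAll B s' T' ∧ (p.compile k).Runs O (B + 7) (T, rnd) (T', rnd) := by
  induction h generalizing T with
  | @inc r s h =>
    have hr := regOf_tapeOf (k := k) (r := r) (by simp [bound] at hp; omega)
    have h1 := hT (tapeOf k r)
    rw [hr] at h1
    obtain ⟨t, ht, hrun⟩ := Frag.runs_inc (O := O) (rnd := rnd) hT.size_le h1 h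
    refine ⟨_, ?_, hrun⟩
    have := hT.update (tapeOf k r) ht
    rwa [hr] at this
  | @dec r s =>
    have hr := regOf_tapeOf (k := k) (r := r) (by simp [bound] at hp; omega)
    have h1 := hT (tapeOf k r)
    rw [hr] at h1
    obtain ⟨t, ht, hrun⟩ := Frag.runs_dec (O := O) (rnd := rnd) hT.size_le h1
    refine ⟨_, ?_, hrun⟩
    have := hT.update (tapeOf k r) ht
    rwa [hr] at this
  | @query s h =>
    have h1 : Holds B (s 4) (T (.inl .oracle)) := hT (.inl .oracle)
    have hw : O (T (.inl .oracle)).word = (o (s 4)).bits := by rw [h1.word_eq, hO]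
    have h2 := Holds.ofWord h
    rw [← hw] at h2
    exact ⟨_, hT.update (.inl .oracle) h2,
      Frag.Runs.query hT.size_le (h2.size_le.trans (by omega))⟩
  | @seq p q s s' s'' h₁ h₂ ih₁ ih₂ =>
    simp only [bound, max_le_iff] at hp
    obtain ⟨T', hT', hr⟩ := ih₁ hp.1 hT
    obtain ⟨T'', hT'', hr'⟩ := ih₂ hp.2 hT'
    exact ⟨T'', hT'', hr.seq hr'⟩
  | @loop_exit r p s h =>
    have hr := regOf_tapeOf (k := k) (r := r) (by simp [bound] at hp; omega)
    have h1 := hT (tapeOf k r)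
    rw [hr] at h1
    exact ⟨T, hT, Frag.Runs.loop_exit hT.size_le (h1.head_eq_none_iff.mpr h)⟩
  | @loop_again r p s s' s'' h h₁ h₂ ih₁ ih₂ =>
    have hr := regOf_tapeOf (k := k) (r := r) (by simp [bound] at hp; omega)
    have h1 := hT (tapeOf k r)
    rw [hr] at h1
    obtain ⟨T', hT', hrun⟩ := ih₁ (by simp [bound] at hp; omega) hT
    obtain ⟨T'', hT'', hrun'⟩ := ih₂ hp hT'
    exact ⟨T'', hT'', Frag.Runs.loop_again hT.size_le
      (fun h0 => h (h1.head_eq_none_iff.mp h0)) hrun hrun'⟩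

/-- The initial contents of the registers: the inputs, and the random tape as a number. -/
def initRegs (n : Port → ℕ) (ρ : ℕ) : ℕ → ℕ
  | 0 => n .size
  | 1 => n .said
  | 2 => n .memory
  | 3 => n .turn
  | 4 => n .oracle
  | 5 => ρ
  | _ => 0

/-- Every counter program, run on registers of `B` bits, is carried out by a machine in space
`O(B)`. -/
theorem exists_machine (p : Cmd) : ∃ (T : OracleTM) (c : ℕ), ∀ (o : ℕ → ℕ)
    (O : List Bool → List Bool) (_ : ∀ n, O n.bits = (o n).bits) (B : ℕ) (n : Port → ℕ)
    (_ : ∀ i, n i < 2 ^ B) (rnd : List Bool) (_ : rnd.length ≤ B) (s : ℕ → ℕ)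
    (_ : Exec o (2 ^ B) p (initRegs n (value rnd)) s) (out : Port),
    T.Computes O (c * (B + 7)) (fun i => (n i).bits) rnd out (s (portReg out)) := by
  -- The extra tape ensures that register 5 exists. It receives the random tape before the program
  -- starts; the program itself never reads the random tape.
  let k := p.bound + 1
  let i₀ : TapeIx k := .inr ⟨0, Nat.succ_pos _⟩
  refine ⟨((Frag.read i₀).seq (p.compile k)).toTM, Fintype.card (TapeIx k), ?_⟩
  intro o O hO B n hn rnd hrnd s hs out
  let T : TapeIx k → Tape :=
    Sum.elim (fun i => Tape.ofWord (n i).bits) (fun _ => Tape.ofWord [])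
  have hT : HoldsAll B (initRegs n 0) T := by
    rintro (i | i)
    · have := Holds.ofWord (hn i)
      cases i <;> exact this
    · have h0 : initRegs n 0 (regOf (.inr i : TapeIx k)) = 0 := by
        rw [regOf, Nat.add_comm]
        rcases i with ⟨_ | i, _⟩ <;> rfl
      rw [h0]
      have := Holds.ofWord (B := B) (n := 0) (by positivity)
      rwa [Nat.zero_bits] at this
  obtain ⟨t, ht, hr⟩ := Frag.runs_read (O := O) (i := i₀) hT.size_le rfl hrnd
  have hT' := hT.update i₀ ht
  have hi : Function.update (initRegs n 0) (regOf i₀) (value rnd) = initRegs n (value rnd) := by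
    funext j
    by_cases hj : j = 5
    · subst hj
      exact Function.update_self _ _ _
    · rw [Function.update_of_ne (show j ≠ regOf i₀ from hj)]
      match j, hj with
      | 0, _ => rfl
      | 1, _ => rfl
      | 2, _ => rfl
      | 3, _ => rfl
      | 4, _ => rfl
      | 5, hj => exact absurd rfl hj
      | j + 6, _ => rfl
  rw [hi] at hT'
  obtain ⟨T', hT', hr'⟩ := hs.runs hO (by show p.bound ≤ p.bound + 1 + 5; omega) hT' []
  have hc := (hr.seq hr').computes (fun i => ?_) (by omega) out
  · have hv : value (T' (.inl out)).word = s (portReg out) := by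
      rw [(hT' (.inl out)).word_eq, value_bits]
      rfl
    rw [← hv]
    exact hc
  · exact hT.size_le (.inl i)

end MirrorGame

namespace MirrorGame

/-! ### Functions computable in linear space -/

namespace Cmd

/-- Add register `a` to register `b` and clear `a`. -/
def move (a b : ℕ) : Cmd := .loop a (.seq (.dec a) (.inc b))

/-- Clear register `a`. -/
def clear (a : ℕ) : Cmd := .loop a (.dec a)

/-- Copy register `a` to register `b`, with the auxiliary register `c`. -/
def copy (a b c : ℕ) : Cmd :=
  .seq (.loop a (.seq (.dec a) (.seq (.inc b) (.inc c)))) (move c a)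

/-- Rename the registers of a program. -/
def rename (φ : ℕ → ℕ) : Cmd → Cmd
  | inc r => inc (φ r)
  | dec r => dec (φ r)
  | query => query
  | seq p q => seq (p.rename φ) (q.rename φ)
  | loop r p => loop (φ r) (p.rename φ)

end Cmd

namespace Exec

variable {o : ℕ → ℕ} {X : ℕ}

theorem move {a b : ℕ} (hab : a ≠ b) {s : ℕ → ℕ} (h : s b + s a < X) :
    Exec o X (Cmd.move a b) s (Function.update (Function.update s b (s b + s a)) a 0) := by
  generalize hn : s a = n at h
  induction n generalizing s with
  | zero =>
    have : Function.update (Function.update s b (s b + 0)) a 0 = s := by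
      rw [Nat.add_zero, Function.update_eq_self, ← hn, Function.update_eq_self]
    rw [this]
    exact .loop_exit hn
  | succ n ih =>
    have h1 := @Exec.dec o X a s
    have h2 := @Exec.inc o X b (Function.update s a (s a - 1)) (by simp [hab.symm]; omega)
    refine .loop_again (by omega) (.seq h1 h2) ?_
    have h3 := ih (s := Function.update (Function.update s a (s a - 1)) b
      (Function.update s a (s a - 1) b + 1)) (by simp [hab]; omega) (by simp [hab.symm]; omega)
    convert! h3 using 1
    funext j
    simp only [Function.update_apply]
    split_ifs <;> (simp_all; try omega)

theorem clear {a : ℕ} {s : ℕ → ℕ} : Exec o X (Cmd.clear a) s (Function.update s a 0) := by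
  generalize hn : s a = n
  induction n generalizing s with
  | zero =>
    rw [← hn, Function.update_eq_self]
    exact .loop_exit hn
  | succ n ih =>
    refine .loop_again (by omega) .dec ?_
    have h3 := ih (s := Function.update s a (s a - 1)) (by simp; omega)
    rwa [Function.update_idem] at h3

theorem copy {a b c : ℕ} (hab : a ≠ b) (hac : a ≠ c) (hbc : b ≠ c) {s : ℕ → ℕ} (hb : s b = 0)
    (hc : s c = 0) (h : s a < X) :
    Exec o X (Cmd.copy a b c) s (Function.update s b (s a)) := by
  have key : ∀ n m, n + m < X → Exec o X (.loop a (.seq (.dec a) (.seq (.inc b) (.inc c))))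
      (Function.update (Function.update (Function.update s a n) b m) c m)
      (Function.update (Function.update (Function.update s a 0) b (n + m)) c (n + m)) := by
    intro n
    induction n with
    | zero =>
      intro m _
      rw [Nat.zero_add]
      exact .loop_exit (by simp [hab, hac])
    | succ n ih =>
      intro m hm
      have h1 := @Exec.dec o X a
        (Function.update (Function.update (Function.update s a (n + 1)) b m) c m)
      have h2 := Exec.inc (o := o) (X := X) (r := b) (s := Function.update (Function.update (Function.update
        (Function.update s a (n + 1)) b m) c m) a
        ((Function.update (Function.update (Function.update s a (n + 1)) b m) c m) a - 1))
        (by simp [hab.symm, hbc]; omega)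
      refine .loop_again (by simp [hab, hac]) (.seq h1 (.seq h2 (.inc ?_))) ?_
      · simp [hac.symm, hbc.symm]
        omega
      have h4 := ih (m + 1) (by omega)
      rw [show n + 1 + m = n + (m + 1) by omega]
      convert! h4 using 1
      funext j
      simp only [Function.update_apply]
      split_ifs <;> simp_all
  have h1 := key (s a) 0 (by omega)
  have h0 : Function.update (Function.update (Function.update s a (s a)) b 0) c 0 = s := by
    funext j
    simp only [Function.update_apply]
    split_ifs <;> simp_all
  rw [h0] at h1
  have h2 := Exec.move (o := o) (X := X) hac.symm (s := Function.update (Function.update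
    (Function.update s a 0) b (s a + 0)) c (s a + 0)) (by simp [hab, hac]; omega)
  convert! Exec.seq h1 h2 using 1
  funext j
  simp only [Function.update_apply]
  split_ifs <;> simp_all

/-- Register 4 must be fixed because `query` always acts on it. -/
theorem rename {φ : ℕ → ℕ} (hφ : Function.Injective φ) (h4 : φ 4 = 4) {p : Cmd} {s s' : ℕ → ℕ}
    (h : Exec o X p s s') {u : ℕ → ℕ} (hu : ∀ i, u (φ i) = s i) :
    ∃ u', Exec o X (p.rename φ) u u' ∧ (∀ i, u' (φ i) = s' i) ∧
      ∀ j, (∀ i, φ i ≠ j) → u' j = u j := by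
  have upd : ∀ (s u : ℕ → ℕ) (r n : ℕ), (∀ i, u (φ i) = s i) →
      (∀ i, Function.update u (φ r) n (φ i) = Function.update s r n i) ∧
      ∀ j, (∀ i, φ i ≠ j) → Function.update u (φ r) n j = u j := by
    intro s u r n hu
    refine ⟨fun i => ?_, fun j hj => Function.update_of_ne (hj r).symm _ _⟩
    simp only [Function.update_apply, hφ.eq_iff, hu]
  induction h generalizing u with
  | @inc r s h =>
    have h' := @Exec.inc o X (φ r) u (by rw [hu]; exact h)
    rw [hu] at h'
    exact ⟨_, h', upd s u r _ hu⟩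
  | @dec r s =>
    have h' := @Exec.dec o X (φ r) u
    rw [hu] at h'
    exact ⟨_, h', upd s u r _ hu⟩
  | @query s h =>
    have hu4 : u 4 = s 4 := by rw [← hu 4, h4]
    have h' := @Exec.query o X u (by rw [hu4]; exact h)
    rw [hu4] at h'
    have := upd s u 4 (o (s 4)) hu
    rw [h4] at this
    exact ⟨_, h', this⟩
  | seq h₁ h₂ ih₁ ih₂ =>
    obtain ⟨u', e1, a1, b1⟩ := ih₁ hu
    obtain ⟨u'', e2, a2, b2⟩ := ih₂ a1
    exact ⟨u'', .seq e1 e2, a2, fun j hj => (b2 j hj).trans (b1 j hj)⟩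
  | loop_exit h => exact ⟨u, .loop_exit (by rw [hu]; exact h), hu, fun _ _ => rfl⟩
  | loop_again h h₁ h₂ ih₁ ih₂ =>
    obtain ⟨u', e1, a1, b1⟩ := ih₁ hu
    obtain ⟨u'', e2, a2, b2⟩ := ih₂ a1
    exact ⟨u'', .loop_again (by rw [hu]; exact h) e1 e2, a2,
      fun j hj => (b2 j hj).trans (b1 j hj)⟩

end Exec

/-- A type of contexts, in which numbers are computed: a context determines the contents of the
registers below `len`, the oracle, and the number of bits that are available up to a constant
factor. -/
class Ctx (Γ : Type) where
  len : ℕ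
  regs : Γ → ℕ → ℕ
  size : Γ → ℕ
  oracle : Γ → ℕ → ℕ
  five_le_len : 5 ≤ len
  regs_four : ∀ γ, regs γ 4 = 0
  regs_of_le : ∀ γ i, len ≤ i → regs γ i = 0
  regs_lt : ∀ γ i, regs γ i < 2 ^ size γ
  size_pos : ∀ γ, 0 < size γ
  -- Oracle answers fit into any registers that are long enough for the context and the question, so
  -- calls preserve linear size.
  oracle_lt : ∀ γ x n, size γ ≤ n → x < 2 ^ n → oracle γ x < 2 ^ n

open Ctx

/-- A context extended by one number. -/
instance Ctx.prod (Γ : Type) [Ctx Γ] : Ctx (Γ × ℕ) where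
  len := len Γ + 1
  regs p := Function.update (regs p.1) (len Γ) p.2
  size p := size p.1 + p.2.size
  oracle p := oracle p.1
  five_le_len := (five_le_len (Γ := Γ)).trans (Nat.le_succ _)
  regs_four p := by
    have := five_le_len (Γ := Γ)
    rw [Function.update_of_ne (by omega), regs_four]
  regs_of_le p i hi := by
    rw [Function.update_of_ne (by omega), regs_of_le _ _ (by omega)]
  regs_lt p i := by
    by_cases h : i = len Γ
    · subst h
      rw [Function.update_self]
      exact (Nat.lt_size_self _).trans_le (Nat.pow_le_pow_right two_pos (Nat.le_add_left _ _))
    · rw [Function.update_of_ne h]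
      exact (regs_lt _ _).trans_le (Nat.pow_le_pow_right two_pos (Nat.le_add_right _ _))
  size_pos p := Nat.add_pos_left (size_pos _) _
  oracle_lt p x n hn := oracle_lt p.1 x n (by omega)

variable {Γ : Type} [Ctx Γ]

/-- The program `p` computes `f` on registers with at least `c * size` bits: it writes the value of
`f` to the first free register and leaves the others as they were. -/
def Cmd.Calculates (p : Cmd) (c : ℕ) (f : Γ → ℕ) : Prop :=
  ∀ γ, f γ < 2 ^ (c * size γ) ∧ ∀ B, c * size γ ≤ B →
    Exec (oracle γ) (2 ^ B) p (regs γ) (Function.update (regs γ) (len Γ) (f γ))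

/-- The function `f` is computable in linear space. -/
def Cmp (f : Γ → ℕ) : Prop := ∃ (p : Cmd) (c : ℕ), p.Calculates c f

/-- The values of `f` have linearly many bits. -/
def Small (f : Γ → ℕ) : Prop := ∃ c, ∀ γ, f γ < 2 ^ (c * size γ)

theorem Small.mono {f g : Γ → ℕ} (hg : Small g) (h : ∀ γ, f γ ≤ g γ) : Small f :=
  let ⟨c, hc⟩ := hg
  ⟨c, fun γ => (h γ).trans_lt (hc γ)⟩

theorem Small.mul {f g : Γ → ℕ} (hf : Small f) (hg : Small g) : Small fun γ => f γ * g γ := by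
  obtain ⟨c, hc⟩ := hf
  obtain ⟨d, hd⟩ := hg
  refine ⟨c + d, fun γ => ?_⟩
  rw [Nat.add_mul, pow_add]
  exact Nat.mul_lt_mul'' (hc γ) (hd γ)

theorem Small.add {f g : Γ → ℕ} (hf : Small f) (hg : Small g) : Small fun γ => f γ + g γ := by
  obtain ⟨c, hc⟩ := hf
  obtain ⟨d, hd⟩ := hg
  refine ⟨c + d + 1, fun γ => ?_⟩
  have h1 : 2 ^ (c * size γ) ≤ 2 ^ ((c + d) * size γ) :=
    Nat.pow_le_pow_right two_pos (Nat.mul_le_mul_right _ (by omega))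
  have h2 : 2 ^ (d * size γ) ≤ 2 ^ ((c + d) * size γ) :=
    Nat.pow_le_pow_right two_pos (Nat.mul_le_mul_right _ (by omega))
  have h3 : 2 ^ ((c + d) * size γ + 1) ≤ 2 ^ ((c + d + 1) * size γ) :=
    Nat.pow_le_pow_right two_pos (by have := size_pos γ; rw [Nat.succ_mul]; omega)
  have := hc γ
  have := hd γ
  rw [pow_succ] at h3
  show f γ + g γ < _
  omega

theorem Small.const (n : ℕ) : Small fun _ : Γ => n :=
  ⟨n, fun γ => (Nat.lt_two_pow_self).trans_le
    (Nat.pow_le_pow_right two_pos (Nat.le_mul_of_pos_right _ (size_pos γ)))⟩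

namespace Cmp

theorem small {f : Γ → ℕ} (h : Cmp f) : Small f :=
  let ⟨_, c, h⟩ := h
  ⟨c, fun γ => (h γ).1⟩

theorem of_eq {f g : Γ → ℕ} (hf : Cmp f) (h : ∀ γ, f γ = g γ) : Cmp g :=
  (funext h : f = g) ▸ hf

theorem zero : Cmp fun _ : Γ => 0 := by
  -- Decrementing a register that is zero serves as the idle program.
  refine ⟨.dec (len Γ), 0, fun γ => ⟨by simp, fun B _ => ?_⟩⟩
  have h := @Exec.dec (oracle γ) (2 ^ B) (len Γ) (regs γ)
  rwa [regs_of_le γ _ le_rfl] at h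

theorem reg {i : ℕ} (hi : i < len Γ) : Cmp fun γ : Γ => regs γ i := by
  refine ⟨Cmd.copy i (len Γ) (len Γ + 1), 1, fun γ => ⟨by simpa using regs_lt γ i, fun B hB => ?_⟩⟩
  refine Exec.copy (by omega) (by omega) (by omega) (regs_of_le _ _ le_rfl)
    (regs_of_le _ _ (Nat.le_succ _)) ?_
  exact (regs_lt γ i).trans_le (Nat.pow_le_pow_right two_pos (by omega))

theorem snd : Cmp fun p : Γ × ℕ => p.2 := by
  have h := Cmp.reg (Γ := Γ × ℕ) (i := len Γ) (Nat.lt_succ_self _)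
  refine h.of_eq fun p => ?_
  exact Function.update_self _ _ _

/-- The renaming that makes room for a register at position `l`. -/
def shift (l r : ℕ) : ℕ := if r < l then r else r + 1

theorem shift_injective (l : ℕ) : Function.Injective (shift l) := by
  intro a b h
  simp only [shift] at h
  split_ifs at h <;> omega

theorem shift_four {l : ℕ} (h : 5 ≤ l) : shift l 4 = 4 := by
  simp [shift]; omega

theorem shift_ne (l i : ℕ) : shift l i ≠ l := by
  simp only [shift]
  split_ifs <;> omega

theorem eq_or_exists_shift (l j : ℕ) : j = l ∨ ∃ i, shift l i = j := by
  rcases lt_trichotomy j l with h | h | h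
  · exact .inr ⟨j, by simp [shift, h]⟩
  · exact .inl h
  · exact .inr ⟨j - 1, by simp only [shift]; split_ifs <;> omega⟩

/-- Every register except `l` is in the range of `shift l`, so the conditions determine the final
contents completely. -/
theorem exec_shift {o : ℕ → ℕ} {X l : ℕ} (hl : 5 ≤ l) {p : Cmd} {s s' u u' : ℕ → ℕ}
    (h : Exec o X p s s') (hu : ∀ i, u (shift l i) = s i) (hu' : ∀ i, u' (shift l i) = s' i)
    (hl' : u' l = u l) : Exec o X (p.rename (shift l)) u u' := by
  obtain ⟨v, e, a, b⟩ := h.rename (shift_injective l) (shift_four hl) hu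
  have : v = u' := by
    funext j
    rcases eq_or_exists_shift l j with rfl | ⟨i, rfl⟩
    · rw [b j (shift_ne j), hl']
    · rw [a, hu']
  exact this ▸ e

/-- Weakening: the result and the scratch registers of the program move up by one to make room for
the new variable. -/
theorem fst {f : Γ → ℕ} (hf : Cmp f) : Cmp fun p : Γ × ℕ => f p.1 := by
  obtain ⟨p, c, h⟩ := hf
  have h5 := five_le_len (Γ := Γ)
  refine ⟨p.rename (shift (len Γ)), c, fun ⟨γ, a⟩ => ⟨(h γ).1.trans_le
    (Nat.pow_le_pow_right two_pos (Nat.mul_le_mul_left _ (Nat.le_add_right _ _))), fun B hB => ?_⟩⟩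
  have hB' : c * size γ ≤ B := (Nat.mul_le_mul_left _ (Nat.le_add_right _ _)).trans hB
  refine exec_shift h5 ((h γ).2 B hB') (fun i => ?_) (fun i => ?_) ?_
  · show Function.update (regs γ) (len Γ) a (shift (len Γ) i) = _
    rw [Function.update_of_ne (shift_ne _ _)]
    simp only [shift]
    split_ifs with hi
    · rfl
    · rw [regs_of_le _ _ (by omega), regs_of_le _ _ (by omega)]
  · show Function.update (Function.update (regs γ) (len Γ) a) (len Γ + 1) (f γ)
      (shift (len Γ) i) = _
    simp only [shift, Function.update_apply]
    split_ifs <;> first | omega | rfl | skip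
    rw [regs_of_le _ _ (by omega), regs_of_le _ _ (by omega)]
  · exact Function.update_of_ne (Nat.lt_succ_self _).ne _ _

theorem succ {f : Γ → ℕ} (hf : Cmp f) : Cmp fun γ => f γ + 1 := by
  obtain ⟨d, hd⟩ := hf.small.add (Small.const 1)
  obtain ⟨p, c, h⟩ := hf
  refine ⟨.seq p (.inc (len Γ)), c + d, fun γ => ⟨(hd γ).trans_le ?_, fun B hB => ?_⟩⟩
  · exact Nat.pow_le_pow_right two_pos (Nat.mul_le_mul_right _ (by omega))
  · rw [Nat.add_mul] at hB
    have h1 := (h γ).2 B (by omega)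
    have h2 := @Exec.inc (oracle γ) (2 ^ B) (len Γ) (Function.update (regs γ) (len Γ) (f γ)) (by
      rw [Function.update_self]
      exact (hd γ).trans_le (Nat.pow_le_pow_right two_pos (by omega)))
    rw [Function.update_self, Function.update_idem] at h2
    exact .seq h1 h2

theorem oracleCall {f : Γ → ℕ} (hf : Cmp f) : Cmp fun γ => oracle γ (f γ) := by
  obtain ⟨p, c, h⟩ := hf
  have h5 := five_le_len (Γ := Γ)
  have hlt : ∀ γ B, (c + 1) * size γ ≤ B → oracle γ (f γ) < 2 ^ B := by
    intro γ B hB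
    rw [Nat.succ_mul] at hB
    exact oracle_lt γ _ _ (by omega) ((h γ).1.trans_le (Nat.pow_le_pow_right two_pos (by omega)))
  -- Register 4 is zero in every context, so it is free to carry the question, and it is zero again
  -- after the answer is moved away.
  refine ⟨.seq p (.seq (.move (len Γ) 4) (.seq .query (.move 4 (len Γ)))), c + 1,
    fun γ => ⟨hlt γ _ le_rfl, fun B hB => ?_⟩⟩
  have h0 := hlt γ B hB
  rw [Nat.succ_mul] at hB
  have h1 := (h γ).2 B (by omega)
  have hf := (h γ).1.trans_le (Nat.pow_le_pow_right two_pos (show c * size γ ≤ B by omega))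
  have r4 := regs_four γ
  have rl := regs_of_le γ _ (le_refl (len Γ))
  have n4 : (4 : ℕ) ≠ len Γ := by omega
  have h2 := @Exec.move (oracle γ) (2 ^ B) (len Γ) 4 n4.symm
    (Function.update (regs γ) (len Γ) (f γ)) (by simp [n4, r4, hf])
  have e2 : Function.update (Function.update (Function.update (regs γ) (len Γ) (f γ)) 4
      (Function.update (regs γ) (len Γ) (f γ) 4 + Function.update (regs γ) (len Γ) (f γ) (len Γ)))
      (len Γ) 0 = Function.update (regs γ) 4 (f γ) := by
    funext j
    simp only [Function.update_apply]
    split_ifs <;> simp_all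
  rw [e2] at h2
  have h3 := @Exec.query (oracle γ) (2 ^ B) (Function.update (regs γ) 4 (f γ)) (by simpa using h0)
  rw [Function.update_self, Function.update_idem] at h3
  have h4 := @Exec.move (oracle γ) (2 ^ B) 4 (len Γ) n4
    (Function.update (regs γ) 4 (oracle γ (f γ))) (by simp [n4.symm, rl, h0])
  refine .seq h1 (.seq h2 (.seq h3 ?_))
  convert! h4 using 1
  funext j
  simp only [Function.update_apply]
  split_ifs <;> simp_all

end Cmp

end MirrorGame

/-! ### Closure under recursion with values of linear size. -/

namespace MirrorGame

open Ctx

variable {Γ : Type} [Ctx Γ]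

namespace Cmp

/-- The program for recursion: `l` is the first free register, and the programs `n`, `e`, `b`
compute the number of rounds, the initial value, and the step. -/
def recCmd (l : ℕ) (n e b : Cmd) : Cmd :=
  -- Layout: `l` holds the remaining rounds, `l + 1` the index, `l + 2` the accumulator and `l + 3`
  -- the result of the step. The shift hides the round counter from `e` and `b`.
  .seq n <| .seq (e.rename (shift l)) <| .seq (.move (l + 1) (l + 2)) <|
    .seq (.loop l (.seq (.dec l) <| .seq (b.rename (shift l)) <| .seq (.clear (l + 2)) <|
      .seq (.move (l + 3) (l + 2)) (.inc (l + 1)))) <|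
    .seq (.clear (l + 1)) (.move (l + 2) l)

/-- Recursion with values of linearly many bits. -/
theorem recOn {n e : Γ → ℕ} {b : (Γ × ℕ) × ℕ → ℕ} (hn : Cmp n) (he : Cmp e) (hb : Cmp b)
    (hs : ∃ c, ∀ γ i, i ≤ n γ →
      Nat.rec (e γ) (fun i a => b ((γ, i), a)) i < 2 ^ (c * size γ)) :
    Cmp fun γ => (Nat.rec (e γ) (fun i a => b ((γ, i), a)) (n γ) : ℕ) := by
  obtain ⟨pn, cn, hn⟩ := hn
  obtain ⟨pe, ce, he⟩ := he
  obtain ⟨pb, cb, hb⟩ := hb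
  obtain ⟨c, hc⟩ := hs
  have h5 := five_le_len (Γ := Γ)
  set l := len Γ with hl
  -- The step runs in the context extended by the index and the accumulator, whose size is at most
  -- `(1 + cn + c) * size γ`.
  set C := cn + ce + cb * (1 + cn + c) + c with hC
  refine ⟨recCmd l pn pe pb, C, fun γ => ⟨(hc γ (n γ) le_rfl).trans_le
    (Nat.pow_le_pow_right two_pos (Nat.mul_le_mul_right _ (by omega))), fun B hB => ?_⟩⟩
  set v : ℕ → ℕ := fun i => Nat.rec (e γ) (fun i a => b ((γ, i), a)) i with hv
  have hBn : cn * size γ ≤ B := (Nat.mul_le_mul_right _ (by omega)).trans hB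
  have hBe : ce * size γ ≤ B := (Nat.mul_le_mul_right _ (by omega)).trans hB
  have hBc : c * size γ ≤ B := (Nat.mul_le_mul_right _ (by omega)).trans hB
  have hBb : cb * (1 + cn + c) * size γ ≤ B := (Nat.mul_le_mul_right _ (by omega)).trans hB
  have hnB : n γ < 2 ^ B := (hn γ).1.trans_le (Nat.pow_le_pow_right two_pos hBn)
  have hvB : ∀ i, i ≤ n γ → v i < 2 ^ B := fun i hi =>
    (hc γ i hi).trans_le (Nat.pow_le_pow_right two_pos hBc)
  have he0 : e γ < 2 ^ B := hvB 0 (Nat.zero_le _)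
  have hz : ∀ j, l ≤ j → regs γ j = 0 := fun j hj => regs_of_le γ j hj
  let S : ℕ → ℕ → ℕ → ℕ → ℕ := fun r i a =>
    Function.update (Function.update (Function.update (regs γ) l r) (l + 1) i) (l + 2) a
  have h1 : Exec (oracle γ) (2 ^ B) pn (regs γ) (S (n γ) 0 0) := by
    convert! (hn γ).2 B hBn using 1
    funext j
    simp only [S, Function.update_apply]
    split_ifs <;> first | rfl | omega | (rw [hz j (by omega)])
  have h2 : Exec (oracle γ) (2 ^ B) (pe.rename (shift l)) (S (n γ) 0 0) (S (n γ) (e γ) 0) := by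
    refine exec_shift h5 ((he γ).2 B hBe) (fun i => ?_) (fun i => ?_) ?_
    · simp only [S, Function.update_apply, shift]
      split_ifs <;> first | rfl | omega |
        (rw [hz i (by omega), hz _ (by omega)]) | rw [hz i (by omega)]
    · simp only [S, Function.update_apply, shift, ← hl]
      split_ifs <;> first | rfl | omega |
        (rw [hz i (by omega), hz _ (by omega)]) | rw [hz i (by omega)]
    · simp [S]
  have h3 : Exec (oracle γ) (2 ^ B) (.move (l + 1) (l + 2)) (S (n γ) (e γ) 0)
      (S (n γ) 0 (e γ)) := by
    have := @Exec.move (oracle γ) (2 ^ B) (l + 1) (l + 2) (by omega) (S (n γ) (e γ) 0)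
      (by simpa [S] using he0)
    convert! this using 1
    funext j
    simp only [S, Function.update_apply]
    split_ifs <;> first | rfl | omega
  have h4 : ∀ r i, r + i = n γ →
      Exec (oracle γ) (2 ^ B) (.loop l (.seq (.dec l) <| .seq (pb.rename (shift l)) <|
        .seq (.clear (l + 2)) <| .seq (.move (l + 3) (l + 2)) (.inc (l + 1))))
        (S r i (v i)) (S 0 (n γ) (v (n γ))) := by
    intro r
    induction r with
    | zero =>
      intro i hi
      rw [Nat.zero_add] at hi
      rw [hi]
      exact .loop_exit (by simp [S])
    | succ r ih =>
      intro i hi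
      have hi' : i < n γ := by omega
      have hbs : cb * size ((γ, i), v i) ≤ B := by
        have e1 : i.size ≤ cn * size γ := Nat.size_le.mpr (hi'.trans (hn γ).1)
        have e2 : (v i).size ≤ c * size γ := Nat.size_le.mpr (hc γ i hi'.le)
        calc cb * (size γ + i.size + (v i).size) ≤ cb * (size γ + cn * size γ + c * size γ) := by
              gcongr
          _ = cb * (1 + cn + c) * size γ := by ring
          _ ≤ B := hBb
      have hbl := (hb ((γ, i), v i)).2 B hbs
      have hvs : v (i + 1) = b ((γ, i), v i) := rfl
      rw [← hvs] at hbl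
      have hrs : regs ((γ, i), v i) =
          Function.update (Function.update (regs γ) l i) (l + 1) (v i) := rfl
      have hln : len ((Γ × ℕ) × ℕ) = l + 2 := rfl
      rw [hrs, hln] at hbl
      have s1 : Exec (oracle γ) (2 ^ B) (.dec l) (S (r + 1) i (v i)) (S r i (v i)) := by
        have := @Exec.dec (oracle γ) (2 ^ B) l (S (r + 1) i (v i))
        convert! this using 1
        funext j
        simp only [S, Function.update_apply]
        split_ifs <;> first | rfl | omega
      have s2 : Exec (oracle γ) (2 ^ B) (pb.rename (shift l)) (S r i (v i))
          (Function.update (S r i (v i)) (l + 3) (v (i + 1))) := by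
        refine exec_shift h5 hbl (fun x => ?_) (fun x => ?_) ?_
        · simp only [S, Function.update_apply, shift]
          split_ifs <;> first | rfl | omega | (rw [hz x (by omega), hz _ (by omega)])
        · simp only [S, Function.update_apply, shift]
          split_ifs <;> first | rfl | omega | (rw [hz x (by omega), hz _ (by omega)])
        · simp [S]
      have s3 := @Exec.clear (oracle γ) (2 ^ B) (l + 2)
        (Function.update (S r i (v i)) (l + 3) (v (i + 1)))
      have s4 : Exec (oracle γ) (2 ^ B) (.move (l + 3) (l + 2))
          (Function.update (Function.update (S r i (v i)) (l + 3) (v (i + 1))) (l + 2) 0)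
          (S r i (v (i + 1))) := by
        have := @Exec.move (oracle γ) (2 ^ B) (l + 3) (l + 2) (by omega)
          (Function.update (Function.update (S r i (v i)) (l + 3) (v (i + 1))) (l + 2) 0)
          (by simpa [S] using hvB (i + 1) hi')
        convert! this using 1
        funext j
        simp only [S, Function.update_apply]
        split_ifs <;> first | rfl | omega | (rw [hz j (by omega)])
      have s5 : Exec (oracle γ) (2 ^ B) (.inc (l + 1)) (S r i (v (i + 1)))
          (S r (i + 1) (v (i + 1))) := by
        have := @Exec.inc (oracle γ) (2 ^ B) (l + 1) (S r i (v (i + 1)))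
          (by simp [S]; omega)
        convert! this using 1
        funext j
        simp only [S, Function.update_apply]
        split_ifs <;> first | rfl | omega
      exact .loop_again (by simp [S]) (.seq s1 (.seq s2 (.seq s3 (.seq s4 s5))))
        (ih (i + 1) (by omega))
  have h6 := @Exec.clear (oracle γ) (2 ^ B) (l + 1) (S 0 (n γ) (v (n γ)))
  have h7 := @Exec.move (oracle γ) (2 ^ B) (l + 2) l (by omega)
    (Function.update (S 0 (n γ) (v (n γ))) (l + 1) 0) (by simpa [S] using hvB (n γ) le_rfl)
  refine .seq h1 (.seq h2 (.seq h3 (.seq (h4 (n γ) 0 (by omega)) (.seq h6 ?_))))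
  convert! h7 using 1
  funext j
  simp only [S, Function.update_apply]
  split_ifs <;> first | rfl | omega | (rw [hz j (by omega)]) | rw [Nat.zero_add]

end Cmp

end MirrorGame

/-! ### Decidable predicates, bounded search and arithmetic in linear space. -/

namespace MirrorGame

open Ctx

variable {Γ : Type} [Ctx Γ]

/-- The predicate `P` is decidable in linear space. -/
def CmpP (P : Γ → Prop) : Prop := ∃ f : Γ → ℕ, Cmp f ∧ ∀ γ, P γ ↔ f γ ≠ 0

open Classical in
/-- The least `i < n` with `p i`, or `n` if there is none. -/
noncomputable def least (p : ℕ → Prop) (n : ℕ) : ℕ :=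
  -- The accumulator equals `i` exactly as long as no witness below `i` has been found.
  Nat.rec 0 (fun i a => if a = i ∧ ¬p i then i + 1 else a) n

section least

variable {p : ℕ → Prop}

open Classical in
theorem least_succ (n : ℕ) :
    least p (n + 1) = if least p n = n ∧ ¬p n then n + 1 else least p n := rfl

theorem least_le (n : ℕ) : least p n ≤ n := by
  induction n with
  | zero => exact le_rfl
  | succ n ih => rw [least_succ]; split_ifs <;> omega

theorem not_of_lt_least {n i : ℕ} (h : i < least p n) : ¬p i := by
  induction n with
  | zero => exact absurd h (Nat.not_lt_zero _)
  | succ n ih =>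
    rw [least_succ] at h
    split_ifs at h with hc
    · rcases Nat.lt_succ_iff_lt_or_eq.mp h with h | rfl
      · exact ih (by omega)
      · exact hc.2
    · exact ih h

theorem least_spec {n : ℕ} (h : least p n < n) : p (least p n) := by
  induction n with
  | zero => exact absurd h (Nat.not_lt_zero _)
  | succ n ih =>
    rw [least_succ] at h ⊢
    split_ifs at h ⊢ with hc
    · omega
    · by_cases hn : least p n = n
      · by_contra hp
        rw [hn] at hp
        exact hc ⟨hn, hp⟩
      · exact ih (lt_of_le_of_ne (least_le n) hn)

theorem least_eq {n x : ℕ} (hx : x ≤ n) (hp : x < n → p x) (hlt : ∀ y < x, ¬p y) :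
    least p n = x := by
  rcases lt_trichotomy (least p n) x with h | h | h
  · exact absurd (least_spec (h.trans_le hx)) (hlt _ h)
  · exact h
  · exact absurd (hp (h.trans_le (least_le n))) (not_of_lt_least h)

theorem least_eq_self_iff {n : ℕ} : least p n = n ↔ ∀ i < n, ¬p i := by
  refine ⟨fun h i hi => not_of_lt_least (h.symm ▸ hi), fun h => least_eq le_rfl (by simp) h⟩

end least

theorem CmpP.of_iff {P Q : Γ → Prop} (hP : CmpP P) (h : ∀ γ, P γ ↔ Q γ) : CmpP Q :=
  let ⟨f, hf, hP⟩ := hP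
  ⟨f, hf, fun γ => (h γ).symm.trans (hP γ)⟩

theorem CmpP.fst {P : Γ → Prop} (hP : CmpP P) : CmpP fun p : Γ × ℕ => P p.1 :=
  let ⟨_, hf, hP⟩ := hP
  ⟨_, hf.fst, fun p => hP p.1⟩

namespace Cmp

/-- A conditional is a recursion with a constant step: zero rounds give `g`, and any positive number
of rounds gives `f`. -/
theorem ite {P : Γ → Prop} [DecidablePred P] (hP : CmpP P) {f g : Γ → ℕ} (hf : Cmp f)
    (hg : Cmp g) : Cmp fun γ => if P γ then f γ else g γ := by
  obtain ⟨t, ht, hP⟩ := hP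
  obtain ⟨c, hc⟩ := hf.small.add hg.small
  have key : ∀ γ i, (Nat.rec (g γ) (fun _ _ => f γ) i : ℕ) = if i ≠ 0 then f γ else g γ := by
    rintro γ (_ | i) <;> simp
  refine (recOn ht hg hf.fst.fst ⟨c, fun γ i _ => ?_⟩).of_eq fun γ => ?_
  · refine lt_of_le_of_lt ?_ (hc γ)
    rw [key γ i]
    dsimp only
    split_ifs <;> omega
  · rw [key γ]
    simp only [hP]

theorem const (n : ℕ) : Cmp fun _ : Γ => n := by
  induction n with
  | zero => exact zero
  | succ n ih => exact ih.succ

theorem pred {f : Γ → ℕ} (hf : Cmp f) : Cmp fun γ => f γ - 1 := by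
  have key : ∀ i, (Nat.rec 0 (fun i _ => i) i : ℕ) = i - 1 := by rintro (_ | i) <;> rfl
  obtain ⟨c, hc⟩ := hf.small
  refine (recOn hf zero snd.fst ⟨c, fun γ i hi => ?_⟩).of_eq fun γ => key _
  exact lt_of_le_of_lt ((key i).le.trans (by omega)) (hc γ)

/-- Only space counts, so addition may use as many rounds as the value of `g`. Subtraction and
multiplication are iterated in the same way. -/
theorem add {f g : Γ → ℕ} (hf : Cmp f) (hg : Cmp g) : Cmp fun γ => f γ + g γ := by
  have key : ∀ γ i, (Nat.rec (f γ) (fun _ a => a + 1) i : ℕ) = f γ + i := by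
    intro γ i
    induction i with
    | zero => rfl
    | succ i ih => exact congrArg (· + 1) ih
  obtain ⟨c, hc⟩ := hf.small.add hg.small
  refine (recOn hg hf snd.succ ⟨c, fun γ i hi => ?_⟩).of_eq fun γ => key _ _
  exact lt_of_le_of_lt ((key γ i).le.trans (Nat.add_le_add_left hi _)) (hc γ)

theorem sub {f g : Γ → ℕ} (hf : Cmp f) (hg : Cmp g) : Cmp fun γ => f γ - g γ := by
  have key : ∀ γ i, (Nat.rec (f γ) (fun _ a => a - 1) i : ℕ) = f γ - i := by
    intro γ i
    induction i with
    | zero => rfl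
    | succ i ih => exact congrArg (· - 1) ih
  obtain ⟨c, hc⟩ := hf.small
  refine (recOn hg hf snd.pred ⟨c, fun γ i hi => ?_⟩).of_eq fun γ => key _ _
  exact lt_of_le_of_lt ((key γ i).le.trans (by omega)) (hc γ)

theorem mul {f g : Γ → ℕ} (hf : Cmp f) (hg : Cmp g) : Cmp fun γ => f γ * g γ := by
  have key : ∀ γ i, (Nat.rec 0 (fun _ a => a + f γ) i : ℕ) = f γ * i := by
    intro γ i
    induction i with
    | zero => rfl
    | succ i ih => exact congrArg (· + f γ) ih
  obtain ⟨c, hc⟩ := hf.small.mul hg.small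
  refine (recOn hg zero (snd.add hf.fst.fst) ⟨c, fun γ i hi => ?_⟩).of_eq fun γ => key _ _
  exact lt_of_le_of_lt ((key γ i).le.trans (Nat.mul_le_mul_left _ hi)) (hc γ)

end Cmp

namespace CmpP

variable {P Q : Γ → Prop} {f g : Γ → ℕ}

theorem not (hP : CmpP P) : CmpP fun γ => ¬P γ :=
  let ⟨t, ht, hP⟩ := hP
  ⟨_, (Cmp.const 1).sub ht, fun γ => by dsimp only; rw [hP]; omega⟩

theorem and (hP : CmpP P) (hQ : CmpP Q) : CmpP fun γ => P γ ∧ Q γ :=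
  let ⟨t, ht, hP⟩ := hP
  let ⟨u, hu, hQ⟩ := hQ
  ⟨_, ht.mul hu, fun γ => by dsimp only; rw [hP, hQ]; simp⟩

theorem or (hP : CmpP P) (hQ : CmpP Q) : CmpP fun γ => P γ ∨ Q γ :=
  let ⟨t, ht, hP⟩ := hP
  let ⟨u, hu, hQ⟩ := hQ
  ⟨_, ht.add hu, fun γ => by dsimp only; rw [hP, hQ]; omega⟩

theorem lt (hf : Cmp f) (hg : Cmp g) : CmpP fun γ => f γ < g γ :=
  ⟨_, hg.sub hf, fun γ => by omega⟩

theorem le (hf : Cmp f) (hg : Cmp g) : CmpP fun γ => f γ ≤ g γ :=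
  (lt hg hf).not.of_iff fun _ => not_lt

theorem eq (hf : Cmp f) (hg : Cmp g) : CmpP fun γ => f γ = g γ :=
  ((le hf hg).and (le hg hf)).of_iff fun _ => le_antisymm_iff.symm

end CmpP

namespace Cmp

variable {f g n : Γ → ℕ}

theorem least {P : Γ × ℕ → Prop} (hP : CmpP P) (hn : Cmp n) :
    Cmp fun γ => least (fun i => P (γ, i)) (n γ) := by
  classical
  obtain ⟨c, hc⟩ := hn.small
  refine (recOn (b := fun p => if p.2 = p.1.2 ∧ ¬P p.1 then p.1.2 + 1 else p.2) hn zero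
    (ite ((CmpP.eq snd snd.fst).and hP.not.fst) snd.fst.succ snd) ⟨c, fun γ i hi => ?_⟩).of_eq
    fun γ => ?_
  · have : MirrorGame.least (fun i => P (γ, i)) i < 2 ^ (c * size γ) :=
      lt_of_le_of_lt ((least_le i).trans hi) (hc γ)
    convert! this using 1
  · simp only [MirrorGame.least]

end Cmp

theorem CmpP.forall_lt {P : Γ × ℕ → Prop} (hP : CmpP P) {n : Γ → ℕ} (hn : Cmp n) :
    CmpP fun γ => ∀ i < n γ, P (γ, i) :=
  (CmpP.eq (Cmp.least hP.not hn) hn).of_iff fun γ => by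
    rw [least_eq_self_iff]
    simp

namespace Cmp

variable {f g n : Γ → ℕ}

theorem div (hf : Cmp f) (hg : Cmp g) : Cmp fun γ => f γ / g γ := by
  refine (ite (CmpP.eq hg zero) zero (least (P := fun p => f p.1 < (p.2 + 1) * g p.1)
    (CmpP.lt hf.fst (snd.succ.mul hg.fst)) hf)).of_eq fun γ => ?_
  split_ifs with h
  · simp [h]
  · have hg : 0 < g γ := Nat.pos_of_ne_zero h
    refine least_eq (Nat.div_le_self _ _) (fun _ => ?_) fun y hy => ?_
    · rw [mul_comm]
      exact Nat.lt_mul_div_succ _ hg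
    · rw [not_lt]
      exact (Nat.le_div_iff_mul_le hg).mp hy

theorem mod (hf : Cmp f) (hg : Cmp g) : Cmp fun γ => f γ % g γ :=
  (hf.sub (hg.mul (hf.div hg))).of_eq fun γ => by
    have := Nat.div_add_mod (f γ) (g γ)
    omega

/-- Dividing repeatedly avoids the power itself, which need not have linearly many bits. -/
theorem divPow (hf : Cmp f) (hg : Cmp g) (hn : Cmp n) : Cmp fun γ => f γ / g γ ^ n γ := by
  have key : ∀ γ i, (Nat.rec (f γ) (fun _ a => a / g γ) i : ℕ) = f γ / g γ ^ i := by
    intro γ i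
    induction i with
    | zero => simp
    | succ i ih =>
      rw [pow_succ, ← Nat.div_div_eq_div_mul]
      exact congrArg (· / g γ) ih
  obtain ⟨c, hc⟩ := hf.small
  refine (recOn hn hf (snd.div hg.fst.fst) ⟨c, fun γ i hi => ?_⟩).of_eq fun γ => key _ _
  exact lt_of_le_of_lt ((key γ i).le.trans (Nat.div_le_self _ _)) (hc γ)

theorem two_pow (hn : Cmp n) (hs : Small fun γ => 2 ^ n γ) : Cmp fun γ => 2 ^ n γ := by
  have key : ∀ i, (Nat.rec 1 (fun _ a => a * 2) i : ℕ) = 2 ^ i := by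
    intro i
    induction i with
    | zero => simp
    | succ i ih =>
      rw [pow_succ]
      exact congrArg (· * 2) ih
  obtain ⟨c, hc⟩ := hs
  refine (recOn hn (const 1) (snd.mul (const 2)) ⟨c, fun γ i hi => ?_⟩).of_eq fun γ => key _
  exact lt_of_le_of_lt ((key i).le.trans (Nat.pow_le_pow_right two_pos hi)) (hc γ)

theorem natSize (hf : Cmp f) : Cmp fun γ => (f γ).size := by
  refine (least (P := fun p => f p.1 / 2 ^ p.2 = 0)
    (CmpP.eq (divPow hf.fst (const 2) snd) zero) hf).of_eq fun γ => ?_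
  refine least_eq (Nat.size_le.mpr Nat.lt_two_pow_self) (fun _ => ?_) fun y hy => ?_
  · exact Nat.div_eq_of_lt (Nat.lt_size_self _)
  · have := Nat.lt_size.mp hy
    exact (Nat.div_pos this (by positivity)).ne'

theorem natSqrt (hf : Cmp f) : Cmp fun γ => (f γ).sqrt := by
  refine (least (P := fun p => f p.1 < (p.2 + 1) * (p.2 + 1))
    (CmpP.lt hf.fst (snd.succ.mul snd.succ)) hf).of_eq fun γ => ?_
  refine least_eq (Nat.sqrt_le_self _) (fun _ => Nat.lt_succ_sqrt _) fun y hy => ?_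
  rw [not_lt]
  exact Nat.le_sqrt.mp hy

end Cmp

theorem CmpP.dvd {f g : Γ → ℕ} (hf : Cmp f) (hg : Cmp g) : CmpP fun γ => f γ ∣ g γ :=
  (CmpP.eq (hg.mod hf) Cmp.zero).of_iff fun _ => (Nat.dvd_iff_mod_eq_zero).symm

theorem CmpP.prime {f : Γ → ℕ} (hf : Cmp f) : CmpP fun γ => (f γ).Prime := by
  refine ((CmpP.le (Cmp.const 2) hf).and (CmpP.forall_lt
    (P := fun p => ¬(2 ≤ p.2 ∧ p.2 ∣ f p.1))
    ((CmpP.le (Cmp.const 2) Cmp.snd).and (CmpP.dvd Cmp.snd hf.fst)).not hf)).of_iff fun γ => ?_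
  rw [Nat.prime_def_lt']
  simp only [not_and]
  exact and_congr_right fun _ => forall_congr' fun m => ⟨fun h a b => h b a, fun h a b => h b a⟩

end MirrorGame

namespace MirrorGame

open Ctx

/-! ### The strategy -/

/-- The label of a number: an odd prime. -/
noncomputable def label (x : ℕ) : ℕ := Nat.nth Nat.Prime (x + 1)

/-- A crude consequence of Chebyshev's lower bound for the number of primes up to y⁵. It is used to
bound the labels polynomially, hence by O(log N) bits. -/
theorem le_primeCounting'_pow {y : ℕ} (hy : 2 ≤ y) : y ≤ Nat.primeCounting' (y ^ 5) := by
  have hn : ¬(y ^ 5).Prime := Nat.Prime.not_prime_pow (by norm_num)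
  have h1 : Nat.primeCounting (y ^ 5) = Nat.primeCounting' (y ^ 5) := by
    rw [Nat.primeCounting, Nat.primeCounting', Nat.count_succ, if_neg hn, Nat.add_zero]
  rw [← h1]
  have h2 := Chebyshev.pi_ge (y ^ 5)
  have hy' : (2 : ℝ) ≤ y := by exact_mod_cast hy
  have hlog : 0 < Real.log y := Real.log_pos (by linarith)
  have h3 : (y : ℝ) ≤ (((y ^ 5 : ℕ) : ℝ) * Real.log 2 - Real.log (((y ^ 5 : ℕ) : ℝ) + 1)) /
      Real.log ((y ^ 5 : ℕ) : ℝ) := by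
    push_cast
    rw [Real.log_pow, le_div_iff₀ (by positivity)]
    have hp : (1 : ℝ) ≤ (y : ℝ) ^ 5 := one_le_pow₀ (by linarith)
    have e1 : Real.log ((y : ℝ) ^ 5 + 1) ≤ Real.log 2 + 5 * Real.log y := by
      have : Real.log ((y : ℝ) ^ 5 + 1) ≤ Real.log (2 * (y : ℝ) ^ 5) :=
        Real.log_le_log (by positivity) (by linarith)
      rwa [Real.log_mul (by norm_num) (by positivity), Real.log_pow] at this
    have e2 : Real.log y ≤ y - 1 := Real.log_le_sub_one_of_pos (by linarith)
    have e3 := Real.log_two_gt_d9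
    -- What remains to show is 5(y + 1) log y ≤ (y⁵ - 1) log 2. The left side is at most 5(y² - 1),
    -- and the right side is at least 0.69(8y² - 1).
    have e4 : (8 : ℝ) * y ^ 2 ≤ y ^ 5 := by
      have : (2 : ℝ) ^ 3 ≤ (y : ℝ) ^ 3 := pow_le_pow_left₀ (by norm_num) hy' 3
      nlinarith [sq_nonneg (y : ℝ)]
    have e5 : ((y : ℝ) + 1) * Real.log y ≤ (y + 1) * (y - 1) :=
      mul_le_mul_of_nonneg_left e2 (by linarith)
    have e6 : (0.69 : ℝ) * (y ^ 5 - 1) ≤ Real.log 2 * (y ^ 5 - 1) :=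
      mul_le_mul_of_nonneg_right (by linarith) (by linarith)
    push_cast
    nlinarith
  exact_mod_cast h3.trans h2

theorem label_prime (x : ℕ) : (label x).Prime := Nat.prime_nth_prime _

theorem label_injective : Function.Injective label := fun _ _ h =>
  Nat.succ_injective (Nat.nth_injective Nat.infinite_setOfPred_prime h)

theorem label_ne_two (x : ℕ) : label x ≠ 2 := by
  have := Nat.add_two_le_nth_prime (x + 1)
  rw [label]
  omega

theorem label_lt (x : ℕ) : label x < (x + 2) ^ 5 := by
  have h := le_primeCounting'_pow (y := x + 2) (by omega)
  rw [label]
  by_contra hc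
  push Not at hc
  have := Nat.monotone_primeCounting' hc
  rw [Nat.primeCounting'_nth_eq] at this
  omega

/-- The polynomial bound turns the label into the result of a bounded search, hence into a function
computable in linear space. -/
theorem label_eq_least (x : ℕ) :
    least (fun y => y.Prime ∧ Nat.count Nat.Prime y = x + 1) ((x + 2) ^ 5) = label x := by
  refine least_eq (label_lt x).le (fun _ => ⟨label_prime x, Nat.primeCounting'_nth_eq _⟩) ?_
  rintro y hy ⟨h1, h2⟩
  have := Nat.nth_count h1
  rw [h2] at this
  exact hy.ne this.symm

section Cmp

variable {Γ : Type} [Ctx Γ] {f g n : Γ → ℕ}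

theorem Cmp.count_prime (hf : Cmp f) : Cmp fun γ => Nat.count Nat.Prime (f γ) := by
  have key : ∀ i, (Nat.rec 0 (fun i a => a + if i.Prime then 1 else 0) i : ℕ) =
      Nat.count Nat.Prime i := by
    intro i
    induction i with
    | zero => rfl
    | succ i ih =>
      rw [Nat.count_succ, ← ih]
  obtain ⟨c, hc⟩ := hf.small
  refine (recOn (b := fun p => p.2 + if p.1.2.Prime then 1 else 0) hf zero
    (snd.add (ite (CmpP.prime snd.fst) (const 1) zero)) ⟨c, fun γ i hi => ?_⟩).of_eq
    fun γ => key _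
  exact lt_of_le_of_lt ((key i).le.trans ((Nat.count_le (p := Nat.Prime)).trans hi)) (hc γ)

theorem Cmp.label (hf : Cmp f) : Cmp fun γ => label (f γ) := by
  have h2 := hf.add (const 2)
  have h5 : Cmp fun γ => (f γ + 2) ^ 5 :=
    ((((h2.mul h2).mul h2).mul h2).mul h2).of_eq fun γ => by ring
  refine (least (P := fun p => p.2.Prime ∧ Nat.count Nat.Prime p.2 = f p.1 + 1)
    ((CmpP.prime snd).and (CmpP.eq snd.count_prime hf.fst.succ)) h5).of_eq fun γ => ?_
  exact label_eq_least (f γ)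

end Cmp

/-! ### Arithmetic of the memory: products of labels, digits of the pool, sizes. -/

/-- The product of the labels of all numbers below `N`, modulo `X`. -/
noncomputable def allLabels (X N : ℕ) : ℕ := Nat.rec (1 % X) (fun i a => a * label i % X) N

theorem allLabels_eq (X N : ℕ) : allLabels X N = (∏ x ∈ Finset.range N, label x) % X := by
  induction N with
  | zero => rfl
  | succ N ih =>
    rw [Finset.prod_range_succ, Nat.mul_mod, ← ih]
    show allLabels X N * label N % X = _
    rw [Nat.mul_mod, ih, Nat.mod_mod]

/-- Digit `j` of `P` in base `W`. -/
def digit (W P j : ℕ) : ℕ := P / W ^ j % W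

/-- The digits `a` and `b` are replaced by the largest digit. -/
def strike (W a b d : ℕ) : ℕ := if d = a ∨ d = b then W - 1 else d

/-- Replace all occurrences of `a` and `b` among the first `J` digits of `P`. -/
def strikeAll (W a b J P : ℕ) : ℕ :=
  Nat.rec 0 (fun i acc => acc * W + strike W a b (digit W P (J - 1 - i))) J

theorem digit_lt {W : ℕ} (hW : 0 < W) (P j : ℕ) : digit W P j < W := Nat.mod_lt _ hW

theorem digit_succ (W P j : ℕ) : digit W P (j + 1) = digit W (P / W) j := by
  rw [digit, digit, pow_succ', Nat.div_div_eq_div_mul]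

theorem digit_div_pow (W P i j : ℕ) : digit W (P / W ^ i) j = digit W P (i + j) := by
  rw [digit, digit, pow_add, Nat.div_div_eq_div_mul]

theorem strike_lt {W : ℕ} (hW : 0 < W) (a b : ℕ) {d : ℕ} (hd : d < W) : strike W a b d < W := by
  rw [strike]
  split_ifs <;> omega

/-- Horner's scheme reads the digits from position `J - 1` downwards, so after `i` rounds the
accumulator consists of the processed digits from `J - i` to `J - 1`. -/
theorem strikeAll_aux {W : ℕ} (hW : 0 < W) (a b J P i : ℕ) (hi : i ≤ J) :
    let v : ℕ := Nat.rec 0 (fun i acc => acc * W + strike W a b (digit W P (J - 1 - i))) i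
    v < W ^ i ∧ ∀ j < i, digit W v j = strike W a b (digit W P (J - i + j)) := by
  induction i with
  | zero => exact ⟨by simp, by simp⟩
  | succ i ih =>
    obtain ⟨h1, h2⟩ := ih (by omega)
    set v : ℕ := Nat.rec 0 (fun i acc => acc * W + strike W a b (digit W P (J - 1 - i))) i with hv
    have hs := strike_lt hW a b (digit_lt hW P (J - 1 - i))
    show v * W + strike W a b (digit W P (J - 1 - i)) < W ^ (i + 1) ∧ ∀ j < i + 1,
      digit W (v * W + strike W a b (digit W P (J - 1 - i))) j = _
    generalize hd : strike W a b (digit W P (J - 1 - i)) = d at hs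
    refine ⟨?_, ?_⟩
    · rw [pow_succ]
      calc v * W + d < v * W + W := by omega
        _ = (v + 1) * W := by ring
        _ ≤ W ^ i * W := Nat.mul_le_mul_right _ h1
    · rintro (_ | j) hj
      · rw [digit, pow_zero, Nat.div_one, Nat.mul_add_mod', Nat.mod_eq_of_lt hs, ← hd]
        congr 2
        omega
      · have : (v * W + d) / W = v := by
          rw [mul_comm, Nat.mul_add_div hW, Nat.div_eq_of_lt hs, Nat.add_zero]
        rw [digit_succ, this, h2 j (by omega)]
        congr 2
        omega

theorem strikeAll_lt {W : ℕ} (hW : 0 < W) (a b J P : ℕ) : strikeAll W a b J P < W ^ J :=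
  (strikeAll_aux hW a b J P J le_rfl).1

theorem digit_strikeAll {W : ℕ} (hW : 0 < W) (a b P : ℕ) {J j : ℕ} (hj : j < J) :
    digit W (strikeAll W a b J P) j = strike W a b (digit W P j) := by
  have := (strikeAll_aux hW a b J P J le_rfl).2 j hj
  rwa [Nat.sub_self, Nat.zero_add] at this

/-- The first of the first `K` digits of `P` that is less than `N`. -/
noncomputable def pick (W N K P : ℕ) : ℕ := digit W P (least (fun j => digit W P j < N) K)

/-- The first number below `N` whose label divides the quotient modulo `X` of the product of all
labels and `E`. -/
noncomputable def recover (X N E : ℕ) : ℕ :=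
  least (fun x => label x ∣ least (fun Q => E * Q % X = allLabels X N) X) N

/-- The number of bits of a number that is said. -/
def width (N : ℕ) : ℕ := N.size

/-- The order of the size of the groups of candidates. -/
def side (N : ℕ) : ℕ := N.sqrt + 1

/-- If at most this many numbers are left, then fresh numbers come from the product of labels. -/
def threshold (N : ℕ) : ℕ := side N * width N

/-- The size of a group of candidates. -/
def groupSize (N : ℕ) : ℕ := 4 * side N

/-- The number of groups of candidates. -/
def groups (N : ℕ) : ℕ := 2 * width N

/-- The number of bits of the product of labels. -/
def prodBits (N : ℕ) : ℕ := 5 * width N * threshold N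

/-- The number of bits of the candidates. -/
def poolBits (N : ℕ) : ℕ := width N * (groups N * groupSize N)

/-- The number of bits of Alice's memory. -/
def memory (N : ℕ) : ℕ := 2 * width N + prodBits N + poolBits N

/-- Alice's memory: the number `a` that she says next, the number `h` whose match has not been
said, the product `E` of the labels of the numbers said before `a`, and the candidates `P`. -/
def encode (N a h E P : ℕ) : ℕ :=
  a + 2 ^ width N * (h + 2 ^ width N * (E + 2 ^ prodBits N * P))

/-- The product of labels in the memory. -/
def memProd (N s : ℕ) : ℕ := s / 2 ^ width N / 2 ^ width N % 2 ^ prodBits N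

/-- The candidates in the memory. -/
def memPool (N s : ℕ) : ℕ := s / 2 ^ width N / 2 ^ width N / 2 ^ prodBits N

/-- The product of labels after `a` and `b` have been said. -/
noncomputable def nextProd (N a b E : ℕ) : ℕ := E * label a % 2 ^ prodBits N * label b % 2 ^ prodBits N

/-- The candidates after `a` and `b` have been said. -/
def nextPool (N a b P : ℕ) : ℕ := strikeAll (2 ^ width N) a b (groups N * groupSize N) P

/-- The next memory state, if Alice's last number was `a` and Bob's is `b`. -/
noncomputable def nextState (N t y a b h E P : ℕ) : ℕ :=
  if y ≠ h then encode N y h (nextProd N a b E) (nextPool N a b P)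
  -- Turns are counted from 0, so `t` numbers have been said and `N - t` are left.
  else if N ≤ t + threshold N then
    encode N (recover (2 ^ prodBits N) N (nextProd N a b E))
      (recover (2 ^ prodBits N) N (nextProd N a b E)) (nextProd N a b E) (nextPool N a b P)
  else
    encode N (pick (2 ^ width N) N (groupSize N) (nextPool N a b P))
      (pick (2 ^ width N) N (groupSize N) (nextPool N a b P)) (nextProd N a b E)
      (nextPool N a b P / (2 ^ width N) ^ groupSize N)

/-- The transition function on numbers: `ρ` is the content of the random tape, `y` the match of
Bob's number `b`. -/
noncomputable def transition (N b s t ρ y : ℕ) : ℕ :=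
  nextState N t y (s % 2 ^ width N) b (s / 2 ^ width N % 2 ^ width N) (memProd N s)
    -- Turn 2 is the first at which Alice updates her memory. The pool is drawn there, once; the
    -- random bits of later turns are ignored.
    (if t = 2 then ρ else memPool N s) % 2 ^ memory N

/-- The output function on numbers. -/
def output (N s : ℕ) : ℕ := s % 2 ^ width N % N

end MirrorGame

/-! ### Computability of the strategy. -/

namespace MirrorGame

open Ctx

namespace Cmp

variable {Γ : Type} [Ctx Γ] {f n a b J W P E : Γ → ℕ}

theorem allLabels (hf : Cmp f) (hpos : ∀ γ, 0 < f γ) (hn : Cmp n) :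
    Cmp fun γ => allLabels (f γ) (n γ) := by
  obtain ⟨c, hc⟩ := hf.small
  refine recOn (b := fun p => p.2 * MirrorGame.label p.1.2 % f p.1.1) hn
    ((const 1).mod hf) ((snd.mul snd.fst.label).mod hf.fst.fst) ⟨c, fun γ i _ => ?_⟩
  refine lt_of_lt_of_le ?_ (hc γ).le
  cases i <;> exact Nat.mod_lt _ (hpos γ)

theorem digit (hW : Cmp W) (hP : Cmp P) (hn : Cmp n) :
    Cmp fun γ => digit (W γ) (P γ) (n γ) :=
  (divPow hP hW hn).mod hW

theorem strike (hW : Cmp W) (ha : Cmp a) (hb : Cmp b) (hn : Cmp n) :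
    Cmp fun γ => strike (W γ) (a γ) (b γ) (n γ) :=
  ite ((CmpP.eq hn ha).or (CmpP.eq hn hb)) hW.pred hn

theorem strikeAll (hW : Cmp W) (hpos : ∀ γ, 0 < W γ) (ha : Cmp a) (hb : Cmp b) (hJ : Cmp J)
    (hP : Cmp P) (hs : Small fun γ => W γ ^ J γ) :
    Cmp fun γ => strikeAll (W γ) (a γ) (b γ) (J γ) (P γ) := by
  obtain ⟨c, hc⟩ := hs
  refine recOn (b := fun p => p.2 * W p.1.1 + MirrorGame.strike (W p.1.1) (a p.1.1) (b p.1.1)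
    (MirrorGame.digit (W p.1.1) (P p.1.1) (J p.1.1 - 1 - p.1.2))) hJ zero
    ((snd.mul hW.fst.fst).add (strike hW.fst.fst ha.fst.fst hb.fst.fst
      (digit hW.fst.fst hP.fst.fst (hJ.fst.fst.pred.sub snd.fst)))) ⟨c, fun γ i hi => ?_⟩
  refine lt_of_lt_of_le ?_ (hc γ).le
  exact ((strikeAll_aux (hpos γ) (a γ) (b γ) (J γ) (P γ) i hi).1).trans_le (Nat.pow_le_pow_right (hpos γ) hi)

theorem pick (hW : Cmp W) (hf : Cmp f) (hn : Cmp n) (hP : Cmp P) :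
    Cmp fun γ => pick (W γ) (f γ) (n γ) (P γ) :=
  digit hW hP (least (P := fun p => MirrorGame.digit (W p.1) (P p.1) p.2 < f p.1)
    (CmpP.lt (digit hW.fst hP.fst snd) hf.fst) hn)

theorem recover (hW : Cmp W) (hpos : ∀ γ, 0 < W γ) (hn : Cmp n) (hE : Cmp E) :
    Cmp fun γ => recover (W γ) (n γ) (E γ) := by
  have h1 := least (P := fun p => E p.1 * p.2 % W p.1 = MirrorGame.allLabels (W p.1) (n p.1))
    (CmpP.eq ((hE.fst.mul snd).mod hW.fst) (allLabels hW hpos hn).fst) hW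
  exact least (P := fun p => MirrorGame.label p.2 ∣ MirrorGame.least
    (fun Q => E p.1 * Q % W p.1 = MirrorGame.allLabels (W p.1) (n p.1)) (W p.1))
    (CmpP.dvd snd.label h1.fst) hn

end Cmp

/-- The inputs of the machines: the numbers on the tapes, an oracle, and a number of bits. -/
structure Input where
  n : Port → ℕ
  ρ : ℕ
  o : ℕ → ℕ
  bits : ℕ
  n_oracle : n .oracle = 0
  n_lt : ∀ i, n i < 2 ^ bits
  ρ_lt : ρ < 2 ^ bits
  o_lt : ∀ x k, bits ≤ k → x < 2 ^ k → o x < 2 ^ k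
  pos : 0 < bits
  memory_le : memory (n .size) ≤ bits

instance : Ctx Input where
  len := 6
  regs d := initRegs d.n d.ρ
  size d := d.bits
  oracle d := d.o
  five_le_len := by norm_num
  regs_four d := d.n_oracle
  regs_of_le d i hi := by
    obtain ⟨j, rfl⟩ := Nat.exists_eq_add_of_le' hi
    rfl
  regs_lt d i := by
    match i with
    | 0 => exact d.n_lt .size
    | 1 => exact d.n_lt .said
    | 2 => exact d.n_lt .memory
    | 3 => exact d.n_lt .turn
    | 4 => exact d.n_lt .oracle
    | 5 => exact d.ρ_lt
    | i + 6 => exact Nat.two_pow_pos _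
  size_pos d := d.pos
  oracle_lt d := d.o_lt

namespace Input

theorem cmp_size : Cmp fun d : Input => d.n .size := Cmp.reg (i := 0) (by decide)
theorem cmp_said : Cmp fun d : Input => d.n .said := Cmp.reg (i := 1) (by decide)
theorem cmp_memory : Cmp fun d : Input => d.n .memory := Cmp.reg (i := 2) (by decide)
theorem cmp_turn : Cmp fun d : Input => d.n .turn := Cmp.reg (i := 3) (by decide)
theorem cmp_random : Cmp fun d : Input => d.ρ := Cmp.reg (i := 5) (by decide)

theorem cmp_width : Cmp fun d : Input => width (d.n .size) := cmp_size.natSize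
theorem cmp_side : Cmp fun d : Input => side (d.n .size) := cmp_size.natSqrt.succ
theorem cmp_threshold : Cmp fun d : Input => threshold (d.n .size) := cmp_side.mul cmp_width
theorem cmp_groupSize : Cmp fun d : Input => groupSize (d.n .size) := (Cmp.const 4).mul cmp_side
theorem cmp_groups : Cmp fun d : Input => groups (d.n .size) := (Cmp.const 2).mul cmp_width
theorem cmp_prodBits : Cmp fun d : Input => prodBits (d.n .size) :=
  ((Cmp.const 5).mul cmp_width).mul cmp_threshold
theorem cmp_poolBits : Cmp fun d : Input => poolBits (d.n .size) :=
  cmp_width.mul (cmp_groups.mul cmp_groupSize)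
theorem cmp_memorySize : Cmp fun d : Input => memory (d.n .size) :=
  (((Cmp.const 2).mul cmp_width).add cmp_prodBits).add cmp_poolBits

theorem small_two_pow {e : Input → ℕ} (h : ∀ d, e d ≤ memory (d.n .size)) :
    Small fun d => 2 ^ e d :=
  ⟨2, fun d => Nat.pow_lt_pow_right one_lt_two (by
    have h1 := h d
    have h2 := d.memory_le
    have h3 := d.pos
    show e d < 2 * d.bits
    omega)⟩

theorem cmp_two_pow_width : Cmp fun d : Input => 2 ^ width (d.n .size) :=
  cmp_width.two_pow (small_two_pow fun d => by simp only [memory]; omega)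

theorem cmp_two_pow_prodBits : Cmp fun d : Input => 2 ^ prodBits (d.n .size) :=
  cmp_prodBits.two_pow (small_two_pow fun d => by simp only [memory]; omega)

theorem cmp_two_pow_memory : Cmp fun d : Input => 2 ^ memory (d.n .size) :=
  cmp_memorySize.two_pow (small_two_pow fun _ => le_rfl)

theorem cmp_encode {a h E P : Input → ℕ} (ha : Cmp a) (hh : Cmp h) (hE : Cmp E) (hP : Cmp P) :
    Cmp fun d => encode (d.n .size) (a d) (h d) (E d) (P d) :=
  ha.add (cmp_two_pow_width.mul (hh.add (cmp_two_pow_width.mul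
    (hE.add (cmp_two_pow_prodBits.mul hP)))))

theorem cmp_nextProd {a b E : Input → ℕ} (ha : Cmp a) (hb : Cmp b) (hE : Cmp E) :
    Cmp fun d => nextProd (d.n .size) (a d) (b d) (E d) :=
  (((hE.mul ha.label).mod cmp_two_pow_prodBits).mul hb.label).mod cmp_two_pow_prodBits

theorem cmp_nextPool {a b P : Input → ℕ} (ha : Cmp a) (hb : Cmp b) (hP : Cmp P) :
    Cmp fun d => nextPool (d.n .size) (a d) (b d) (P d) := by
  refine Cmp.strikeAll cmp_two_pow_width (fun d => Nat.two_pow_pos _) ha hb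
    (cmp_groups.mul cmp_groupSize) hP ?_
  refine Small.mono (small_two_pow (e := fun d => poolBits (d.n .size)) fun d => by
    simp only [memory]; omega) fun d => ?_
  rw [← pow_mul]
  exact le_rfl

theorem cmp_nextState {y a b h E P : Input → ℕ} (hy : Cmp y) (ha : Cmp a) (hb : Cmp b)
    (hh : Cmp h) (hE : Cmp E) (hP : Cmp P) :
    Cmp fun d => nextState (d.n .size) (d.n .turn) (y d) (a d) (b d) (h d) (E d) (P d) := by
  have hE' := cmp_nextProd ha hb hE
  have hP' := cmp_nextPool ha hb hP
  have hr := Cmp.recover cmp_two_pow_prodBits (fun d => Nat.two_pow_pos _) cmp_size hE'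
  have hp := Cmp.pick cmp_two_pow_width cmp_size cmp_groupSize hP'
  exact Cmp.ite (CmpP.eq hy hh).not (cmp_encode hy hh hE' hP')
    (Cmp.ite (CmpP.le cmp_size (cmp_turn.add cmp_threshold)) (cmp_encode hr hr hE' hP')
      (cmp_encode hp hp hE' (Cmp.divPow hP' cmp_two_pow_width cmp_groupSize)))

theorem cmp_transition : Cmp fun d : Input =>
    transition (d.n .size) (d.n .said) (d.n .memory) (d.n .turn) d.ρ (d.o (d.n .said)) := by
  have hw := cmp_two_pow_width
  have h1 := cmp_memory.div hw
  have h2 := h1.div hw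
  have hy : Cmp fun d : Input => d.o (d.n .said) := Cmp.oracleCall cmp_said
  exact (cmp_nextState hy (cmp_memory.mod hw) cmp_said (h1.mod hw) (h2.mod cmp_two_pow_prodBits)
    (Cmp.ite (CmpP.eq cmp_turn (Cmp.const 2)) cmp_random (h2.div cmp_two_pow_prodBits))).mod
    cmp_two_pow_memory

theorem cmp_output : Cmp fun d : Input => output (d.n .size) (d.n .memory) :=
  (cmp_memory.mod cmp_two_pow_width).mod cmp_size

end Input

/-- A computable function of the inputs is computed by a machine in linear space. -/
theorem Cmp.exists_machine {f : Input → ℕ} (hf : Cmp f) (out : Port) (hout : out ≠ .oracle) :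
    ∃ (T : OracleTM) (c : ℕ), ∀ (d : Input) (O : List Bool → List Bool)
      (_ : ∀ n, O n.bits = (d.o n).bits) (rnd : List Bool) (_ : rnd.length ≤ d.bits)
      (_ : d.ρ = value rnd),
      T.Computes O (c * d.bits) (fun i => (d.n i).bits) rnd out (f d) := by
  obtain ⟨p, c, h⟩ := hf
  have hne : (6 : ℕ) ≠ Cmd.portReg out := by cases out <;> decide
  -- The value appears in register 6, the first one free after the inputs, and is then moved to the
  -- output register.
  obtain ⟨T, c', hT⟩ := MirrorGame.exists_machine
    (.seq p (.seq (.clear (Cmd.portReg out)) (.move 6 (Cmd.portReg out))))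
  -- With `B = (c + 1) * d.bits` and at least one bit, `B + 7 ≤ (c + 8) * d.bits`.
  refine ⟨T, c' * (c + 8), fun d O hO rnd hrnd hρ => ?_⟩
  have hpos := d.pos
  set B := (c + 1) * d.bits with hB
  have hB1 : d.bits ≤ B := Nat.le_mul_of_pos_left _ (Nat.succ_pos _)
  have hB2 : c * d.bits ≤ B := Nat.mul_le_mul_right _ (Nat.le_succ _)
  have h1 : Exec d.o (2 ^ B) p (initRegs d.n (value rnd))
      (Function.update (initRegs d.n (value rnd)) 6 (f d)) := by
    rw [← hρ]
    exact (h d).2 B hB2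
  have hfd : f d < 2 ^ B := (h d).1.trans_le (Nat.pow_le_pow_right two_pos hB2)
  have h2 := @Exec.clear d.o (2 ^ B) (Cmd.portReg out)
    (Function.update (initRegs d.n (value rnd)) 6 (f d))
  have h3 := @Exec.move d.o (2 ^ B) 6 (Cmd.portReg out) hne
    (Function.update (Function.update (initRegs d.n (value rnd)) 6 (f d)) (Cmd.portReg out) 0)
    (by simpa [hne] using hfd)
  have := hT d.o O hO B d.n
    (fun i => (d.n_lt i).trans_le (Nat.pow_le_pow_right two_pos hB1)) rnd (hrnd.trans hB1) _
    (.seq h1 (.seq h2 h3)) out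
  have hv : (Function.update (Function.update (Function.update (Function.update
      (initRegs d.n (value rnd)) 6 (f d)) (Cmd.portReg out) 0) (Cmd.portReg out)
      ((Function.update (Function.update (initRegs d.n (value rnd)) 6 (f d))
        (Cmd.portReg out) 0) (Cmd.portReg out) +
      (Function.update (Function.update (initRegs d.n (value rnd)) 6 (f d))
        (Cmd.portReg out) 0) 6)) 6 0) (Cmd.portReg out) = f d := by
    simp [hne, hne.symm]
  rw [hv] at this
  refine ⟨this.1, fun c hc => (this.2 c hc).trans ?_⟩
  rw [mul_assoc]
  refine Nat.mul_le_mul_left _ ?_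
  rw [hB]
  nlinarith

/-- The match of a number, as a function on all natural numbers. -/
noncomputable def Matching.mateNat {N : ℕ} (M : Matching N) (x : ℕ) : ℕ :=
  if h : x < N then M.mate ⟨x, h⟩ else x

theorem Matching.oracle_bits {N : ℕ} (M : Matching N) (x : ℕ) :
    M.oracle x.bits = (M.mateNat x).bits := by
  simp only [Matching.oracle, Matching.mateNat, value_bits]
  split_ifs <;> rfl

theorem width_pos {N : ℕ} (h : 0 < N) : 0 < width N := Nat.size_pos.mpr h

theorem lt_two_pow_width (N : ℕ) : N < 2 ^ width N := Nat.lt_size_self N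

theorem width_le_prodBits {N : ℕ} : width N ≤ prodBits N := by
  rcases Nat.eq_zero_or_pos (width N) with h | h
  · omega
  · have : 0 < threshold N := Nat.mul_pos (Nat.succ_pos _) h
    rw [prodBits]
    nlinarith

theorem two_width_lt_memory {N : ℕ} (h : 0 < N) : 2 * width N < memory N := by
  have h1 := width_pos h
  have := width_le_prodBits (N := N)
  rw [memory]
  omega

/-- Alice's strategy. -/
noncomputable def strategy (N : ℕ) (h₀ : 0 < N) : Strategy N (memory N) (poolBits N) where
  -- This encodes `a = h = 0`, the empty product 1 and an empty pool.
  init := ⟨2 ^ (2 * width N), Nat.pow_lt_pow_right one_lt_two (two_width_lt_memory h₀)⟩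
  f M ω b s t := ⟨transition N b s t (value (List.ofFn ω)) (M.mate b),
    Nat.mod_lt _ (Nat.two_pow_pos _)⟩
  g s := ⟨output N s, Nat.mod_lt _ h₀⟩

theorem strategy_computable :
    ComputableInMemory memory poolBits fun N h₀ _ => strategy N h₀ := by
  obtain ⟨F, c, hF⟩ := Input.cmp_transition.exists_machine .memory (by decide)
  obtain ⟨G, c', hG⟩ := Input.cmp_output.exists_machine .said (by decide)
  refine ⟨F, G, c + c' + 1, fun N h₀ hN => ?_⟩
  have hm := two_width_lt_memory h₀
  have hw := width_pos h₀
  have hpos : 0 < memory N := by omega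
  have hNlt : N < 2 ^ memory N :=
    (lt_two_pow_width N).trans_le (Nat.pow_le_pow_right two_pos (by omega))
  have mono : ∀ {T : OracleTM} {O : List Bool → List Bool} {S S' : ℕ} {i r o v},
      S ≤ S' → T.Computes O S i r o v → T.Computes O S' i r o v :=
    fun h hT => ⟨hT.1, fun c hc => (hT.2 c hc).trans h⟩
  refine ⟨?_, fun M ω b s t => ?_, fun s => ?_⟩
  · calc poolBits N ≤ N + memory N := by rw [memory]; omega
      _ ≤ (N + memory N) ^ (c + c' + 1) := Nat.le_self_pow (by omega) _
      _ ≤ _ := Nat.le_mul_of_pos_left _ (by omega)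
  · have hρ : value (List.ofFn ω) < 2 ^ poolBits N := by
      simpa using value_lt (List.ofFn ω)
    let d : Input :=
      { n := fun
          | .size => N
          | .said => b
          | .memory => s
          | .turn => t
          | .oracle => 0
        ρ := value (List.ofFn ω)
        o := M.mateNat
        bits := memory N
        n_oracle := rfl
        n_lt := by
          rintro (_ | _)
          exacts [hNlt, b.2.trans hNlt, s.2, t.2.trans hNlt, Nat.two_pow_pos _]
        ρ_lt := hρ.trans_le (Nat.pow_le_pow_right two_pos (by rw [memory]; omega))
        o_lt := by
          intro x k hk hx
          rw [Matching.mateNat]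
          split_ifs with h
          · exact ((M.mate ⟨x, h⟩).2.trans hNlt).trans_le (Nat.pow_le_pow_right two_pos hk)
          · exact hx
        pos := hpos
        memory_le := le_rfl }
    have h := hF d M.oracle M.oracle_bits (List.ofFn ω) (by
      rw [List.length_ofFn]; show poolBits N ≤ memory N; rw [memory]; omega) rfl
    have hin : (fun i => (d.n i).bits) = transitionInput N b s t := by
      funext i
      cases i <;> simp [d, transitionInput]
    have hy : d.o (d.n .said) = M.mate b := dif_pos b.2
    rw [hin, hy] at h
    exact mono (Nat.mul_le_mul_right _ (by omega)) h
  · let d : Input :=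
      { n := fun
          | .size => N
          | .memory => s
          | _ => 0
        ρ := 0
        o := id
        bits := memory N
        n_oracle := rfl
        n_lt := by
          rintro (_ | _)
          exacts [hNlt, Nat.two_pow_pos _, s.2, Nat.two_pow_pos _, Nat.two_pow_pos _]
        ρ_lt := Nat.two_pow_pos _
        o_lt := fun x k _ hx => hx
        pos := hpos
        memory_le := le_rfl }
    have h := hG d id (fun _ => rfl) [] (Nat.zero_le _) rfl
    have hin : (fun i => (d.n i).bits) = outputInput N s := by
      funext i
      cases i <;> simp [d, outputInput]
    rw [hin] at h
    exact mono (Nat.mul_le_mul_right _ (by omega)) h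

end MirrorGame

namespace MirrorGame

/-! ### Matchings as involutions -/

namespace Matching

variable {N : ℕ} (M : Matching N)

theorem adj_iff (x y : Fin N) : M.1.Adj x y ↔ M.mate x = y := by
  have h := (SimpleGraph.Subgraph.isPerfectMatching_iff.mp M.2 x).choose_spec
  exact ⟨fun hxy => (h.2 y hxy).symm, fun hxy => hxy ▸ h.1⟩

theorem mate_mate (x : Fin N) : M.mate (M.mate x) = x :=
  (M.adj_iff _ _).mp ((M.adj_iff _ _).mpr rfl).symm

theorem mate_ne (x : Fin N) : M.mate x ≠ x := fun h =>
  ((M.adj_iff x x).mpr h).ne rfl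

theorem mate_injective : Function.Injective M.mate := fun x y h => by
  rw [← M.mate_mate x, h, M.mate_mate]

theorem ext_mate {M M' : Matching N} (h : ∀ x, M.mate x = M'.mate x) : M = M' := by
  refine Subtype.ext (SimpleGraph.Subgraph.ext ?_ ?_)
  · rw [M.2.2.verts_eq_univ, M'.2.2.verts_eq_univ]
  · funext x y
    rw [eq_iff_iff, adj_iff, adj_iff, h]

/-- The matching that belongs to an involution without fixed points. -/
def ofInvolution (f : Fin N → Fin N) (hf : ∀ x, f (f x) = x) (hne : ∀ x, f x ≠ x) :
    Matching N :=
  ⟨{ verts := Set.univ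
     Adj := fun x y => f x = y
     adj_sub := fun {x y} h => by
      rw [SimpleGraph.top_adj]
      rintro rfl
      exact hne _ h
     edge_vert := fun _ => Set.mem_univ _
     symm := ⟨fun x y h => by rw [← h, hf]⟩ }, by
    rw [SimpleGraph.Subgraph.isPerfectMatching_iff]
    exact fun x => ⟨f x, rfl, fun y (hy : f x = y) => Eq.symm hy⟩⟩

theorem mate_ofInvolution (f : Fin N → Fin N) (hf : ∀ x, f (f x) = x) (hne : ∀ x, f x ≠ x)
    (x : Fin N) : (ofInvolution f hf hne).mate x = f x :=
  ((adj_iff _ x (f x)).mp rfl)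

end Matching

/-! ### Fresh numbers -/

/-- The number `x` has not been said, and is the least such number. -/
def IsLeastUnsaid {N : ℕ} (A : List (Fin N)) (x : Fin N) : Prop := x ∉ A ∧ ∀ y < x, y ∈ A

theorem exists_isLeastUnsaid {N : ℕ} {A : List (Fin N)} (h : A.length < N) :
    ∃ x, IsLeastUnsaid A x := by
  have hne : (A.toFinsetᶜ).Nonempty := by
    rw [← Finset.card_pos, Finset.card_compl, Fintype.card_fin]
    have := A.toFinset_card_le
    omega
  refine ⟨(A.toFinsetᶜ).min' hne, ?_, fun y hy => ?_⟩
  · simpa using Finset.min'_mem _ hne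
  · by_contra hc
    exact (Finset.min'_le (A.toFinsetᶜ) y (by simpa using hc)).not_gt hy

/-- The number `d` can be said if `A` are the numbers said so far. -/
def Unsaid {N : ℕ} (A : List (Fin N)) (d : ℕ) : Prop := ∃ h : d < N, ⟨d, h⟩ ∉ A

theorem label_lt_two_pow {N x : ℕ} (h : x < N) : label x < 2 ^ (5 * width N) := by
  have h1 : x + 2 ≤ 2 ^ width N := by
    have := lt_two_pow_width N
    omega
  calc label x < (x + 2) ^ 5 := label_lt x
    _ ≤ (2 ^ width N) ^ 5 := Nat.pow_le_pow_left h1 5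
    _ = _ := by rw [← pow_mul, mul_comm]

/-- The product of the labels of the numbers that have been said. -/
noncomputable def labelProd {N : ℕ} (A : List (Fin N)) : ℕ := (A.map fun x : Fin N => label x).prod

/-- Odd labels make the stored product invertible modulo `X`, so the product `Q` of the missing
labels is determined modulo `X`. At most `threshold N` labels below `2 ^ (5 * width N)` are missing,
so `Q < X` and `Q` itself is recovered; a label divides it exactly if its number is unsaid. -/
theorem recover_eq {N : ℕ} {A : List (Fin N)} (hA : A.Nodup) (hlen : A.length < N)
    (hthr : N ≤ A.length + threshold N) {x : Fin N} (hx : IsLeastUnsaid A x) :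
    recover (2 ^ prodBits N) N (labelProd A % 2 ^ prodBits N) = x := by
  set X := 2 ^ prodBits N with hX
  set U : Finset (Fin N) := A.toFinsetᶜ with hU
  set Q : ℕ := ∏ y ∈ U, label y with hQ
  have hcard : U.card = N - A.length := by
    rw [hU, Finset.card_compl, Fintype.card_fin, List.toFinset_card_of_nodup hA]
  have hprod : labelProd A * Q = ∏ y ∈ Finset.range N, label y := by
    rw [labelProd, ← List.prod_toFinset _ hA, hQ, hU, Finset.prod_mul_prod_compl,
      Finset.prod_range]
  have hQX : Q < X := by
    have hne : U.Nonempty := by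
      rw [← Finset.card_pos]
      omega
    calc Q < ∏ _y ∈ U, 2 ^ (5 * width N) :=
          Finset.prod_lt_prod_of_nonempty (fun y _ => (label_prime y).pos)
            (fun y _ => label_lt_two_pow y.2) hne
      _ = 2 ^ (5 * width N * U.card) := by rw [Finset.prod_const, ← pow_mul]
      _ ≤ X := Nat.pow_le_pow_right two_pos (Nat.mul_le_mul_left _ (by omega))
  have hcop : Nat.Coprime X (labelProd A) := by
    refine Nat.Coprime.pow_left _ ?_
    rw [labelProd, Nat.coprime_list_prod_right_iff]
    intro n hn
    obtain ⟨y, -, rfl⟩ := List.mem_map.mp hn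
    exact (Nat.coprime_primes Nat.prime_two (label_prime y)).mpr (label_ne_two y).symm
  have hleast : least (fun R => labelProd A % X * R % X = allLabels X N) X = Q := by
    have h0 : ∀ R, labelProd A % X * R % X = allLabels X N ↔ R ≡ Q [MOD X] := by
      intro R
      rw [allLabels_eq, ← hprod, Nat.mod_mul_mod]
      exact ⟨fun h => Nat.ModEq.cancel_left_of_coprime hcop h, fun h => h.mul_left _⟩
    refine least_eq hQX.le (fun _ => (h0 Q).mpr rfl) fun R hR hc => ?_
    have := (h0 R).mp hc
    rw [Nat.ModEq, Nat.mod_eq_of_lt hQX, Nat.mod_eq_of_lt (hR.trans hQX)] at this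
    omega
  have hdvd : ∀ y : Fin N, label y ∣ Q ↔ y ∉ A := by
    intro y
    rw [hQ, (label_prime y).prime.dvd_finsetProd_iff]
    constructor
    · rintro ⟨z, hz, hyz⟩
      have := label_injective ((Nat.prime_dvd_prime_iff_eq (label_prime y) (label_prime z)).mp hyz)
      rw [Fin.ext this]
      simpa [hU] using hz
    · exact fun hy => ⟨y, by simpa [hU] using hy, dvd_rfl⟩
  rw [recover, hleast]
  refine least_eq x.2.le (fun _ => (hdvd x).mpr hx.1) fun y hy => ?_
  have hyN := hy.trans x.2
  have := (hdvd ⟨y, hyN⟩).not.mpr (not_not.mpr (hx.2 ⟨y, hyN⟩ hy))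
  exact this

/-- `x` is the first of the first `groupSize N` candidates in `P` that can be said. -/
def IsFresh {N : ℕ} (A : List (Fin N)) (P : ℕ) (x : Fin N) : Prop :=
  ∃ j < groupSize N, (x : ℕ) = digit (2 ^ width N) P j ∧ x ∉ A ∧
    ∀ i < j, ¬Unsaid A (digit (2 ^ width N) P i)

open Classical in
/-- The digits of the stored candidates: those that have been said are replaced. -/
def Tracks {N : ℕ} (A : List (Fin N)) (R P P' : ℕ) : Prop :=
  ∀ j < R * groupSize N, digit (2 ^ width N) P' j =
    if digit (2 ^ width N) P j ∈ A.map Fin.val then 2 ^ width N - 1 else digit (2 ^ width N) P j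

theorem mem_map_val_iff {N : ℕ} {A : List (Fin N)} {x : Fin N} :
    (x : ℕ) ∈ A.map Fin.val ↔ x ∈ A := by
  rw [List.mem_map]
  exact ⟨fun ⟨y, hy, h⟩ => Fin.ext h ▸ hy, fun h => ⟨x, h, rfl⟩⟩

/-- Since `N < 2 ^ width N`, the mark `2 ^ width N - 1` is not below `N`. Hence a struck candidate
looks like one that was never valid, and no history is needed to recognize it. -/
theorem Tracks.digit_lt_iff {N : ℕ} {A : List (Fin N)} {R P P' j : ℕ} (h : Tracks A R P P')
    (hj : j < R * groupSize N) :
    digit (2 ^ width N) P' j < N ↔ Unsaid A (digit (2 ^ width N) P j) := by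
  have hN := lt_two_pow_width N
  rw [h j hj]
  constructor
  · intro hlt
    split_ifs at hlt with hm
    · omega
    · exact ⟨hlt, fun hc => hm (mem_map_val_iff.mpr hc)⟩
  · rintro ⟨hlt, hm⟩
    rw [if_neg]
    · exact hlt
    · exact fun hc => hm (mem_map_val_iff (x := ⟨_, hlt⟩).mp hc)

theorem Tracks.pick_eq {N : ℕ} {A : List (Fin N)} {R P P' : ℕ} (h : Tracks A (R + 1) P P')
    {x : Fin N} (hx : IsFresh A P x) : pick (2 ^ width N) N (groupSize N) P' = x := by
  obtain ⟨j, hj, hxj, hxA, hlt⟩ := hx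
  have hK : ∀ i < groupSize N, i < (R + 1) * groupSize N := fun i hi =>
    hi.trans_le (Nat.le_mul_of_pos_left _ (Nat.succ_pos _))
  have hu : Unsaid A (digit (2 ^ width N) P j) := by
    rw [← hxj]
    exact ⟨x.2, hxA⟩
  have hl : least (fun j => digit (2 ^ width N) P' j < N) (groupSize N) = j :=
    least_eq hj.le (fun _ => (h.digit_lt_iff (hK j hj)).mpr hu) fun y hy =>
      (h.digit_lt_iff (hK y (hy.trans hj))).not.mpr (hlt y hy)
  rw [pick, hl, h j (hK j hj), ← hxj, if_neg]
  exact fun hc => hxA (mem_map_val_iff.mp hc)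

theorem Tracks.tail {N : ℕ} {A : List (Fin N)} {R P P' : ℕ} (h : Tracks A (R + 1) P P') :
    Tracks A R (P / (2 ^ width N) ^ groupSize N) (P' / (2 ^ width N) ^ groupSize N) := by
  intro j hj
  rw [digit_div_pow, digit_div_pow]
  exact h _ (by rw [Nat.succ_mul]; omega)

theorem Tracks.next {N : ℕ} {A : List (Fin N)} {R P P' : ℕ} (h : Tracks A R P P')
    (hR : R ≤ groups N) (a b : Fin N) : Tracks (A ++ [a, b]) R P (nextPool N a b P') := by
  intro j hj
  rw [nextPool, digit_strikeAll (Nat.two_pow_pos _) _ _ _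
    (hj.trans_le (Nat.mul_le_mul_right _ hR)), h j hj, strike]
  simp only [List.map_append, List.mem_append, List.map_cons, List.map_nil, List.mem_cons,
    List.not_mem_nil, or_false]
  by_cases h1 : digit (2 ^ width N) P j ∈ A.map Fin.val
  · simp only [h1, if_true, true_or, ite_self]
  · simp only [h1, if_false, false_or]

end MirrorGame

namespace MirrorGame

/-! ### The game without memory -/

variable {N : ℕ}

/-- Alice does not fail in the next `n` rounds, if `said` has been said, her next number is `a`,
the only number up to `a` whose match has not been said is `h`, and `P` holds `R` groups of
candidates. -/
def Survives (M : Matching N) (β : BobStrategy N) :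
    ℕ → List (Fin N) → Fin N → Fin N → ℕ → ℕ → Prop
  | 0, _, _, _, _, _ => True
  | n + 1, said, a, h, R, P =>
      β (said ++ [a]) ∈ said ++ [a] ∨ (said.length + 2 < N →
        (M.mate (β (said ++ [a])) ≠ h →
          Survives M β n (said ++ [a, β (said ++ [a])]) (M.mate (β (said ++ [a]))) h R P) ∧
        (M.mate (β (said ++ [a])) = h → N ≤ said.length + 2 + threshold N →
          ∀ x, IsLeastUnsaid (said ++ [a, β (said ++ [a])]) x →
            Survives M β n (said ++ [a, β (said ++ [a])]) x x R P) ∧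
        (M.mate (β (said ++ [a])) = h → ¬N ≤ said.length + 2 + threshold N →
          -- Running out of groups, or of usable candidates in the current group, counts as failure.
          ∃ R', R = R' + 1 ∧ ∃ x, IsFresh (said ++ [a, β (said ++ [a])]) P x ∧
            Survives M β n (said ++ [a, β (said ++ [a])]) x x R'
              (P / (2 ^ width N) ^ groupSize N)))

/-! ### Packing and unpacking Alice's memory. -/

section encode

variable {a h E P : ℕ}

theorem encode_mod (ha : a < 2 ^ width N) : encode N a h E P % 2 ^ width N = a := by
  rw [encode, Nat.add_mul_mod_self_left, Nat.mod_eq_of_lt ha]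

theorem encode_div (ha : a < 2 ^ width N) :
    encode N a h E P / 2 ^ width N = h + 2 ^ width N * (E + 2 ^ prodBits N * P) := by
  rw [encode, Nat.add_mul_div_left _ _ (Nat.two_pow_pos _), Nat.div_eq_of_lt ha, Nat.zero_add]

theorem encode_div_mod (ha : a < 2 ^ width N) (hh : h < 2 ^ width N) :
    encode N a h E P / 2 ^ width N % 2 ^ width N = h := by
  rw [encode_div ha, Nat.add_mul_mod_self_left, Nat.mod_eq_of_lt hh]

theorem encode_div_div (ha : a < 2 ^ width N) (hh : h < 2 ^ width N) :
    encode N a h E P / 2 ^ width N / 2 ^ width N = E + 2 ^ prodBits N * P := by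
  rw [encode_div ha, Nat.add_mul_div_left _ _ (Nat.two_pow_pos _), Nat.div_eq_of_lt hh,
    Nat.zero_add]

theorem memProd_encode (ha : a < 2 ^ width N) (hh : h < 2 ^ width N) (hE : E < 2 ^ prodBits N) :
    memProd N (encode N a h E P) = E := by
  rw [memProd, encode_div_div ha hh, Nat.add_mul_mod_self_left, Nat.mod_eq_of_lt hE]

theorem memPool_encode (ha : a < 2 ^ width N) (hh : h < 2 ^ width N) (hE : E < 2 ^ prodBits N) :
    memPool N (encode N a h E P) = P := by
  rw [memPool, encode_div_div ha hh, Nat.add_mul_div_left _ _ (Nat.two_pow_pos _),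
    Nat.div_eq_of_lt hE, Nat.zero_add]

theorem add_mul_two_pow_lt {x y m n : ℕ} (hx : x < 2 ^ m) (hy : y < 2 ^ n) :
    x + 2 ^ m * y < 2 ^ (m + n) := by
  rw [pow_add]
  calc x + 2 ^ m * y < 2 ^ m + 2 ^ m * y := by omega
    _ = 2 ^ m * (y + 1) := by ring
    _ ≤ 2 ^ m * 2 ^ n := Nat.mul_le_mul_left _ hy

theorem encode_lt (ha : a < 2 ^ width N) (hh : h < 2 ^ width N) (hE : E < 2 ^ prodBits N)
    (hP : P < 2 ^ poolBits N) : encode N a h E P < 2 ^ memory N := by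
  have := add_mul_two_pow_lt ha (add_mul_two_pow_lt hh (add_mul_two_pow_lt hE hP))
  rwa [show width N + (width N + (prodBits N + poolBits N)) = memory N by
    rw [memory]; omega] at this

end encode

/-- The numbers up to and including `a` form pairs of the matching, with the exception of `h`. -/
structure Paired (M : Matching N) (A : List (Fin N)) (h : Fin N) : Prop where
  nodup : A.Nodup
  mem : h ∈ A
  mate_mem : ∀ x ∈ A, x ≠ h → M.mate x ∈ A
  mate_notMem : M.mate h ∉ A

/-- If the match of `b` had been said and is not `h`, then its own match `b` would have been said
too. -/
theorem Paired.reply {M : Matching N} {A : List (Fin N)} {h b : Fin N} (hA : Paired M A h)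
    (hb : b ∉ A) (hne : M.mate b ≠ h) : Paired M (A ++ [b, M.mate b]) h := by
  have hmb : M.mate b ∉ A := fun hc => hb (by
    have := hA.mate_mem _ hc hne
    rwa [M.mate_mate] at this)
  refine ⟨?_, by simp [hA.mem], ?_, ?_⟩
  · rw [List.nodup_append]
    refine ⟨hA.nodup, ?_, ?_⟩
    · simpa using (M.mate_ne b).symm
    · intro x hx y hy
      simp only [List.mem_cons, List.not_mem_nil, or_false] at hy
      rintro rfl
      rcases hy with rfl | rfl
      exacts [hb hx, hmb hx]
  · intro x hx hxh
    simp only [List.mem_append, List.mem_cons, List.not_mem_nil, or_false] at hx ⊢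
    rcases hx with hx | rfl | rfl
    · exact .inl (hA.mate_mem x hx hxh)
    · exact .inr (.inr rfl)
    · exact .inr (.inl (M.mate_mate b))
  · simp only [List.mem_append, List.mem_cons, List.not_mem_nil, or_false, not_or]
    refine ⟨hA.mate_notMem, fun hc => hne ?_, fun hc => ?_⟩
    · rw [← hc, M.mate_mate]
    · exact hb (M.mate_injective hc ▸ hA.mem)

/-- Once `h` is matched, the said numbers are closed under matching, so the match of any unsaid `x`
is also unsaid. -/
theorem Paired.fresh {M : Matching N} {A : List (Fin N)} {h b x : Fin N} (hA : Paired M A h)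
    (hb : b ∉ A) (heq : M.mate b = h) (hx : x ∉ A ++ [b]) : Paired M (A ++ [b, x]) x := by
  have hx' := hx
  simp only [List.mem_append, List.mem_cons, List.not_mem_nil, or_false, not_or] at hx'
  have hclosed : ∀ y ∈ A ++ [b], M.mate y ∈ A ++ [b] := by
    intro y hy
    simp only [List.mem_append, List.mem_cons, List.not_mem_nil, or_false] at hy ⊢
    rcases hy with hy | rfl
    · by_cases hyh : y = h
      · right
        rw [hyh, ← heq, M.mate_mate]
      · exact .inl (hA.mate_mem y hy hyh)
    · exact .inl (heq ▸ hA.mem)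
  have hsplit : A ++ [b, x] = (A ++ [b]) ++ [x] := by simp
  refine ⟨?_, by simp, ?_, ?_⟩
  · rw [List.nodup_append]
    refine ⟨hA.nodup, by simpa using Ne.symm hx'.2, ?_⟩
    intro y hy z hz
    simp only [List.mem_cons, List.not_mem_nil, or_false] at hz
    rintro rfl
    rcases hz with rfl | rfl
    exacts [hb hy, hx'.1 hy]
  · intro y hy hyx
    rw [hsplit] at hy ⊢
    rcases List.mem_append.mp hy with hy | hy
    · exact List.mem_append_left _ (hclosed y hy)
    · exact absurd (by simpa using hy) hyx
  · rw [hsplit]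
    intro hc
    rcases List.mem_append.mp hc with hc | hc
    · have := hclosed _ hc
      rw [M.mate_mate] at this
      exact hx this
    · exact M.mate_ne x (by simpa using hc)

/-- The memory state `s` reflects the state of the game. -/
structure Reflects (ω : Fin N → Fin (poolBits N) → Bool) (said : List (Fin N)) (a h : Fin N)
    (R P s : ℕ) : Prop where
  mod_eq : s % 2 ^ width N = a
  div_mod_eq : s / 2 ^ width N % 2 ^ width N = h
  prod_eq : memProd N s = labelProd said % 2 ^ prodBits N
  le_groups : R ≤ groups N
  -- Before the first update the pool is still on the random tape of turn 2.
  tracks : ∀ ht : said.length + 2 < N, Tracks said R P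
    (if said.length + 2 = 2 then value (List.ofFn (ω ⟨_, ht⟩)) else memPool N s)

theorem nextProd_eq (said : List (Fin N)) (a b : Fin N) :
    nextProd N a b (labelProd said % 2 ^ prodBits N) =
      labelProd (said ++ [a, b]) % 2 ^ prodBits N := by
  have : labelProd (said ++ [a, b]) = labelProd said * label a * label b := by
    simp [labelProd, mul_assoc]
  rw [this, nextProd, Nat.mod_mul_mod, mul_assoc, mul_assoc, Nat.mod_mul_mod]

theorem Reflects.encode {ω : Fin N → Fin (poolBits N) → Bool} {said : List (Fin N)} {a b : Fin N}
    {R P P' : ℕ} (hR : R ≤ groups N) (hP' : P' < 2 ^ poolBits N)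
    (ht : Tracks (said ++ [a, b]) R P P') (x h : Fin N) :
    Reflects ω (said ++ [a, b]) x h R P
      (encode N x h (labelProd (said ++ [a, b]) % 2 ^ prodBits N) P' % 2 ^ memory N) := by
  have hx := x.2.trans (lt_two_pow_width N)
  have hh := h.2.trans (lt_two_pow_width N)
  have hE := Nat.mod_lt (labelProd (said ++ [a, b])) (Nat.two_pow_pos (prodBits N))
  rw [Nat.mod_eq_of_lt (encode_lt hx hh hE hP')]
  refine ⟨encode_mod hx, encode_div_mod hx hh, memProd_encode hx hh hE, hR, fun h' => ?_⟩
  rw [if_neg (by simp), memPool_encode hx hh hE]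
  exact ht

/-- The memory simulates the full history: `recover_eq` and `Tracks.pick_eq` find the same fresh
numbers as the game without memory, and `Paired` guarantees that Alice's next number is new. -/
theorem Survives.winsFrom (h₀ : 0 < N) (M : Matching N) (β : BobStrategy N)
    (ω : Fin N → Fin (poolBits N) → Bool) (n : ℕ) {said : List (Fin N)} {a h : Fin N} {R P : ℕ}
    {s : Fin (2 ^ memory N)} (hp : Paired M (said ++ [a]) h) (hr : Reflects ω said a h R P s)
    (hs : Survives M β n said a h R P) : (strategy N h₀).WinsFrom M ω β n said s := by
  induction n generalizing said a h R P s with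
  | zero => trivial
  | succ n ih =>
    have hg : (strategy N h₀).g s = a := by
      refine Fin.ext ?_
      show output N s = a
      rw [output, hr.mod_eq, Nat.mod_eq_of_lt a.2]
    have hnd := hp.nodup
    rw [List.nodup_append] at hnd
    simp only [Strategy.WinsFrom, hg]
    refine ⟨fun hc => hnd.2.2 a hc a (by simp) rfl, ?_⟩
    simp only [Survives] at hs
    set b := β (said ++ [a]) with hb
    by_cases hmem : b ∈ said ++ [a]
    · exact .inl hmem
    refine .inr fun ht => ?_
    obtain ⟨h1, h2, h3⟩ := (hs.resolve_left hmem) ht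
    have htr := (hr.tracks ht).next hr.le_groups a b
    set P' := nextPool N a b
      (if said.length + 2 = 2 then value (List.ofFn (ω ⟨_, ht⟩)) else memPool N s) with hP'
    have hPlt : P' < 2 ^ poolBits N := by
      have := strikeAll_lt (Nat.two_pow_pos (width N)) a b (groups N * groupSize N)
        (if said.length + 2 = 2 then value (List.ofFn (ω ⟨_, ht⟩)) else memPool N s)
      rwa [← pow_mul] at this
    have hsplit : said ++ [a, b] = said ++ [a] ++ [b] := by simp
    have hstep : (((strategy N h₀).f M (ω ⟨_, ht⟩) b s ⟨_, ht⟩ : Fin _) : ℕ) =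
        nextState N (said.length + 2) (M.mate b) a b h (labelProd said % 2 ^ prodBits N)
          (if said.length + 2 = 2 then value (List.ofFn (ω ⟨_, ht⟩)) else memPool N s) %
          2 ^ memory N := by
      show transition N b s (said.length + 2) (value (List.ofFn (ω ⟨_, ht⟩))) (M.mate b) = _
      rw [transition, hr.mod_eq, hr.div_mod_eq, hr.prod_eq]
    have hlen : (said ++ [a, b]).length = said.length + 2 := by simp
    rw [nextState, nextProd_eq, ← hP'] at hstep
    by_cases hy : M.mate b = h
    · rw [if_neg (not_not.mpr (by rw [hy]))] at hstep
      by_cases hthr : N ≤ said.length + 2 + threshold N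
      · obtain ⟨x, hx⟩ := exists_isLeastUnsaid (A := said ++ [a, b]) (by omega)
        have hnd' : (said ++ [a, b]).Nodup := by
          rw [hsplit, List.nodup_append]
          exact ⟨hp.nodup, by simp, fun y hy z hz => by
            rintro rfl
            exact hmem ((by simpa using hz : y = b) ▸ hy)⟩
        rw [if_pos hthr, recover_eq hnd' (by omega) (by omega) hx] at hstep
        refine ih (P := P) (R := R) (a := x) (h := x) ?_ ?_ (h2 hy hthr x hx)
        · have := hp.fresh hmem hy (hsplit ▸ hx.1)
          simpa using this
        · rw [hstep]
          exact Reflects.encode hr.le_groups hPlt htr x x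
      · obtain ⟨R', rfl, x, hx, hsx⟩ := h3 hy hthr
        rw [if_neg hthr, htr.pick_eq hx] at hstep
        refine ih (R := R') (a := x) (h := x) ?_ ?_ hsx
        · obtain ⟨_, _, _, hxA, _⟩ := hx
          have := hp.fresh hmem hy (hsplit ▸ hxA)
          simpa using this
        · rw [hstep]
          have hle := hr.le_groups
          exact Reflects.encode (by omega) ((Nat.div_le_self _ _).trans_lt hPlt) htr.tail x x
    · rw [if_pos (fun hc => hy (Fin.ext hc))] at hstep
      refine ih (P := P) (R := R) (a := M.mate b) (h := h) ?_ ?_ (h1 hy)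
      · have := hp.reply hmem hy
        simpa using this
      · rw [hstep]
        exact Reflects.encode hr.le_groups hPlt htr (M.mate b) h

theorem Survives.wins (h₀ : 0 < N) (M : Matching N) (β : BobStrategy N)
    (ω : Fin N → Fin (poolBits N) → Bool) {P : ℕ}
    (hP : ∀ h2 : 2 < N, P = value (List.ofFn (ω ⟨2, h2⟩)))
    (hs : Survives M β (N / 2) [] ⟨0, h₀⟩ ⟨0, h₀⟩ (groups N) P) :
    (strategy N h₀).Wins M ω β := by
  refine hs.winsFrom h₀ M β ω (N / 2) ?_ ?_
  · refine ⟨by simp, by simp, ?_, ?_⟩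
    · intro x hx hne
      exact absurd (by simpa using hx) hne
    · simpa using M.mate_ne ⟨0, h₀⟩
  · have hinit : (((strategy N h₀).init : Fin _) : ℕ) = MirrorGame.encode N 0 0 1 0 := by
      show 2 ^ (2 * width N) = _
      simp [MirrorGame.encode, two_mul, pow_add]
    have h0 : 0 < 2 ^ width N := Nat.two_pow_pos _
    have h1 : 1 < 2 ^ prodBits N :=
      Nat.one_lt_two_pow ((width_pos h₀).trans_le width_le_prodBits).ne'
    rw [hinit]
    refine ⟨encode_mod h0, encode_div_mod h0 h0, ?_, le_rfl, fun ht j hj => ?_⟩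
    · rw [memProd_encode h0 h0 h1]
      simp [labelProd, Nat.mod_eq_of_lt h1]
    · simp only [List.length_nil, Nat.zero_add, List.map_nil, List.not_mem_nil, if_false, if_true]
      rw [hP]

end MirrorGame

namespace MirrorGame

open Classical Finset

/-! ### Counting matchings -/

variable {N : ℕ}

/-- The matchings that agree with `φ` on `S`. -/
noncomputable def agreeing (φ : Fin N → Fin N) (S : Finset (Fin N)) : Finset (Matching N) :=
  univ.filter fun M => ∀ x ∈ S, M.mate x = φ x

theorem mem_agreeing {φ : Fin N → Fin N} {S : Finset (Fin N)} {M : Matching N} :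
    M ∈ agreeing φ S ↔ ∀ x ∈ S, M.mate x = φ x := by
  simp [agreeing]

/-- The image of a matching under a permutation of the vertices. -/
noncomputable def Matching.conj (M : Matching N) (e : Equiv.Perm (Fin N)) : Matching N :=
  .ofInvolution (fun x => e (M.mate (e.symm x))) (fun x => by simp [M.mate_mate])
    (fun x hx => M.mate_ne (e.symm x) (by rw [Equiv.eq_symm_apply]; exact hx))

theorem Matching.mate_conj (M : Matching N) (e : Equiv.Perm (Fin N)) (x : Fin N) :
    (M.conj e).mate x = e (M.mate (e.symm x)) :=
  mate_ofInvolution _ _ _ x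

theorem Matching.conj_injective (e : Equiv.Perm (Fin N)) :
    Function.Injective fun M : Matching N => M.conj e := by
  intro M M' h
  refine Matching.ext_mate fun x => ?_
  have := congrArg (fun M : Matching N => M.mate (e x)) h
  simpa [Matching.mate_conj] using this

section fiber

variable {φ : Fin N → Fin N} {S : Finset (Fin N)}

/-- Conjugation by the transposition of `y` and `z` fixes `b` and all revealed pairs, and maps one
fiber injectively into the other. -/
theorem card_fiber_le (hφ : ∀ x ∈ S, φ x ∈ S) {b y z : Fin N}
    (hy : y ∉ insert b S) (hz : z ∉ insert b S) :
    ((agreeing φ S).filter fun M => M.mate b = y).card ≤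
      ((agreeing φ S).filter fun M => M.mate b = z).card := by
  rw [mem_insert, not_or] at hy hz
  refine card_le_card_of_injOn (fun M => M.conj (Equiv.swap y z)) ?_
    (Matching.conj_injective _).injOn
  have hfix : ∀ x ∈ S, Equiv.swap y z x = x := fun x hx =>
    Equiv.swap_apply_of_ne_of_ne (fun h => hy.2 (h ▸ hx)) (fun h => hz.2 (h ▸ hx))
  intro M hM
  simp only [coe_filter, Set.mem_ofPred_eq, mem_agreeing, Matching.mate_conj, Equiv.symm_swap]
    at hM ⊢
  refine ⟨fun x hx => ?_, ?_⟩
  · rw [hfix x hx, hM.1 x hx, hfix _ (hφ x hx)]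
  · rw [Equiv.swap_apply_of_ne_of_ne (Ne.symm hy.1) (Ne.symm hz.1), hM.2, Equiv.swap_apply_left]

theorem mate_mem_compl (hφ : ∀ x ∈ S, φ x ∈ S) {b : Fin N} (hb : b ∉ S) {M : Matching N}
    (hM : M ∈ agreeing φ S) : M.mate b ∈ (insert b S)ᶜ := by
  rw [mem_compl, mem_insert, not_or]
  refine ⟨M.mate_ne b, fun h => hb ?_⟩
  have := hφ _ h
  rwa [← mem_agreeing.mp hM _ h, M.mate_mate] at this

/-- All fibers have the same size: given the revealed pairs, the match of `b` is uniformly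
distributed. -/
theorem card_fiber_mul (hφ : ∀ x ∈ S, φ x ∈ S) {b y : Fin N} (hb : b ∉ S)
    (hy : y ∈ (insert b S)ᶜ) :
    ((insert b S)ᶜ).card * ((agreeing φ S).filter fun M => M.mate b = y).card =
      (agreeing φ S).card := by
  rw [card_eq_sum_card_fiberwise (f := fun M : Matching N => M.mate b) (t := (insert b S)ᶜ)
    (fun M hM => mate_mem_compl hφ hb hM), sum_const_nat]
  intro z hz
  rw [mem_compl] at hy hz
  exact le_antisymm (card_fiber_le hφ hz hy) (card_fiber_le hφ hy hz)

theorem update_update_of_mem {b y x : Fin N} (hb : b ∉ S) (hy : y ∉ S) (hx : x ∈ S) :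
    Function.update (Function.update φ b y) y b x = φ x := by
  rw [Function.update_of_ne (by rintro rfl; exact hy hx),
    Function.update_of_ne (by rintro rfl; exact hb hx)]

/-- After the match of `b` is revealed, the possible matchings are again described by agreement on a
set, which lets the induction continue. -/
theorem fiber_eq {b y : Fin N} (hb : b ∉ S) (hy : y ∉ insert b S) :
    ((agreeing φ S).filter fun M => M.mate b = y) =
      agreeing (Function.update (Function.update φ b y) y b) (insert y (insert b S)) := by
  rw [mem_insert, not_or] at hy
  ext M
  simp only [mem_filter, mem_agreeing, forall_mem_insert, Function.update_self,
    Function.update_of_ne (Ne.symm hy.1)]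
  constructor
  · rintro ⟨h1, h2⟩
    refine ⟨by rw [← h2, M.mate_mate], h2, fun x hx => ?_⟩
    rw [update_update_of_mem hb hy.2 hx, h1 x hx]
  · rintro ⟨-, h2, h3⟩
    refine ⟨fun x hx => ?_, h2⟩
    have := h3 x hx
    rwa [update_update_of_mem hb hy.2 hx] at this

theorem update_update_mem (hφ : ∀ x ∈ S, φ x ∈ S) {b y : Fin N} (hb : b ∉ S)
    (hy : y ∉ insert b S) : ∀ x ∈ insert y (insert b S),
      Function.update (Function.update φ b y) y b x ∈ insert y (insert b S) := by
  rw [mem_insert, not_or] at hy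
  simp only [forall_mem_insert, Function.update_self, Function.update_of_ne (Ne.symm hy.1)]
  refine ⟨by simp, by simp, fun x hx => ?_⟩
  rw [update_update_of_mem hb hy.2 hx]
  simp [hφ x hx]

end fiber

/-! ### Counting candidates -/

/-- The indicator of a proposition. -/
noncomputable def ind (p : Prop) : ℝ := if p then 1 else 0

theorem ind_nonneg (p : Prop) : 0 ≤ ind p := by
  rw [ind]; split_ifs <;> norm_num

theorem ind_le_one (p : Prop) : ind p ≤ 1 := by
  rw [ind]; split_ifs <;> norm_num

theorem ind_mono {p q : Prop} (h : p → q) : ind p ≤ ind q := by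
  by_cases hp : p
  · simp [ind, hp, h hp]
  · simp only [ind, hp, if_false]
    exact ind_nonneg q

theorem ind_and (p q : Prop) : ind (p ∧ q) = ind p * ind q := by
  by_cases hp : p <;> by_cases hq : q <;> simp [ind, hp, hq]

/-- With `B` the number of possible groups, this separates the group used next from the rest of the
pool. -/
theorem sum_range_mul (B C : ℕ) (f : ℕ → ℝ) :
    ∑ P ∈ range (B * C), f P = ∑ g ∈ range B, ∑ q ∈ range C, f (g + B * q) := by
  rw [sum_comm]
  induction C with
  | zero => simp
  | succ C ih =>
    rw [Nat.mul_succ, sum_range_add, ih, sum_range_succ]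
    simp only [Nat.add_comm]

theorem digit_add_mul_zero {W d q : ℕ} (hd : d < W) : digit W (d + W * q) 0 = d := by
  rw [digit, pow_zero, Nat.div_one, Nat.add_mul_mod_self_left, Nat.mod_eq_of_lt hd]

theorem digit_add_mul_succ {W d q : ℕ} (hd : d < W) (j : ℕ) :
    digit W (d + W * q) (j + 1) = digit W q j := by
  rw [digit_succ, Nat.add_mul_div_left _ _ (by omega), Nat.div_eq_of_lt hd, Nat.zero_add]

theorem digit_add_pow_mul {W g q K j : ℕ} (hj : j < K) : digit W (g + W ^ K * q) j = digit W g j := by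
  rcases Nat.eq_zero_or_pos W with rfl | hW
  · simp [zero_pow (show K ≠ 0 by omega)]
  obtain ⟨i, rfl⟩ := Nat.exists_eq_add_of_lt hj
  rw [digit, digit, show W ^ (j + i + 1) * q = W ^ j * (W * (W ^ i * q)) by ring,
    Nat.add_mul_div_left _ _ (by positivity), Nat.add_mul_mod_self_left]

/-- The proportion of sequences of `K` digits all of which have the property `p`. -/
theorem sum_ind_forall_digit (W K : ℕ) (p : ℕ → Prop) :
    ∑ g ∈ range (W ^ K), ind (∀ j < K, p (digit W g j)) = (∑ d ∈ range W, ind (p d)) ^ K := by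
  induction K with
  | zero => simp [ind]
  | succ K ih =>
    rw [pow_succ', sum_range_mul, pow_succ', ← ih, sum_mul]
    refine sum_congr rfl fun d hd => ?_
    rw [mul_sum]
    refine sum_congr rfl fun q _ => ?_
    rw [mem_range] at hd
    have : (∀ j < K + 1, p (digit W (d + W * q) j)) ↔ p d ∧ ∀ j < K, p (digit W q j) := by
      constructor
      · intro h
        refine ⟨?_, fun j hj => ?_⟩
        · have := h 0 (Nat.succ_pos _)
          rwa [digit_add_mul_zero hd] at this
        · have := h (j + 1) (by omega)
          rwa [digit_add_mul_succ hd] at this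
      · rintro ⟨h1, h2⟩ (_ | j) hj
        · rwa [digit_add_mul_zero hd]
        · rw [digit_add_mul_succ hd]
          exact h2 j (by omega)
    rw [propext this, ind_and]

theorem sum_ind_not_unsaid {A : List (Fin N)} (hA : A.Nodup) {W : ℕ} (hW : N ≤ W) :
    ∑ d ∈ range W, ind (¬Unsaid A d) = W - (N - A.length : ℝ) := by
  have h1 : ∑ d ∈ range W, ind (Unsaid A d) = (N - A.length : ℝ) := by
    have : ∑ d ∈ range W, ind (Unsaid A d) = ((range W).filter (Unsaid A)).card := by
      simp [ind]
    rw [this]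
    have hcard : ((range W).filter (Unsaid A)).card = (A.toFinsetᶜ).card := by
      symm
      refine card_bij (fun x _ => (x : ℕ)) ?_ (fun x _ y _ h => Fin.ext h) ?_
      · intro x hx
        rw [mem_filter, mem_range]
        exact ⟨x.2.trans_le hW, x.2, by simpa using hx⟩
      · intro d hd
        obtain ⟨-, h, hd⟩ := mem_filter.mp hd
        exact ⟨⟨d, h⟩, by simpa using hd, rfl⟩
    rw [hcard, card_compl, Fintype.card_fin, List.toFinset_card_of_nodup hA, Nat.cast_sub]
    simpa using hA.length_le_card
  have h2 : ∀ d, ind (¬Unsaid A d) = 1 - ind (Unsaid A d) := by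
    intro d
    by_cases h : Unsaid A d <;> simp [ind, h]
  simp only [h2, sum_sub_distrib, h1]
  simp

theorem exists_isFresh_or {A : List (Fin N)} (g : ℕ) :
    (∃ x, IsFresh A g x) ∨ ∀ j < groupSize N, ¬Unsaid A (digit (2 ^ width N) g j) := by
  by_contra hc
  rw [not_or] at hc
  obtain ⟨h1, h2⟩ := hc
  push Not at h2
  have hex : ∃ j, j < groupSize N ∧ Unsaid A (digit (2 ^ width N) g j) := h2
  obtain ⟨hj, hN, hm⟩ := Nat.find_spec hex
  exact h1 ⟨⟨_, hN⟩, Nat.find hex, hj, rfl, hm,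
    fun i hi hu => Nat.find_min hex hi ⟨hi.trans hj, hu⟩⟩

theorem isFresh_add_mul {A : List (Fin N)} {g q : ℕ} {x : Fin N} (h : IsFresh A g x) :
    IsFresh A (g + (2 ^ width N) ^ groupSize N * q) x := by
  obtain ⟨j, hj, h1, h2, h3⟩ := h
  refine ⟨j, hj, by rw [digit_add_pow_mul hj, h1], h2, fun i hi => ?_⟩
  rw [digit_add_pow_mul (hi.trans hj)]
  exact h3 i hi

end MirrorGame

namespace MirrorGame

open Classical Finset

/-! ### The probability that Alice fails -/

variable {N : ℕ}

/-- The number of pairs of a matching in `Ms` and of candidates with which Alice fails. -/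
noncomputable def failures (β : BobStrategy N) (n : ℕ) (said : List (Fin N)) (a h : Fin N)
    (R : ℕ) (Ms : Finset (Matching N)) : ℝ :=
  ∑ M ∈ Ms, ∑ P ∈ range (((2 ^ width N) ^ groupSize N) ^ R), ind (¬Survives M β n said a h R P)

/-- The bound for the conditional probability of failure, if `u` numbers are left, `R` groups of
candidates remain, and `ε` is a bound for the probability that a group has been exhausted. -/
noncomputable def failBound (ε u : ℝ) (R : ℕ) : ℝ := R * ε + (u + 1) / 2 ^ R

theorem IsLeastUnsaid.unique {A : List (Fin N)} {x y : Fin N} (hx : IsLeastUnsaid A x)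
    (hy : IsLeastUnsaid A y) : x = y := by
  rcases lt_trichotomy x y with h | h | h
  · exact absurd (hy.2 x h) hx.1
  · exact h
  · exact absurd (hx.2 y h) hy.1

section failures

variable {β : BobStrategy N} {ε : ℝ} {n : ℕ}

/-- In the next `n` rounds, Alice fails for at most the proportion `failBound` of the matchings
that agree with what has been revealed, and of the candidates. -/
def FailsRarely (β : BobStrategy N) (ε : ℝ) (n : ℕ) : Prop :=
  ∀ (said : List (Fin N)) (a h : Fin N) (R : ℕ) (φ : Fin N → Fin N) (S : Finset (Fin N)),
    (said ++ [a]).Nodup → h ∈ said ++ [a] → S = (said ++ [a]).toFinset.erase h →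
    (∀ x ∈ S, φ x ∈ S) →
    failures β n said a h R (agreeing φ S) ≤
      failBound ε (N - (said.length + 1)) R *
        ((agreeing φ S).card * (((2 : ℝ) ^ width N) ^ groupSize N) ^ R)

variable {said : List (Fin N)} {a h b y : Fin N} {R : ℕ} {φ : Fin N → Fin N}
  {S : Finset (Fin N)}

theorem sum_ind_le (Ms : Finset (Matching N)) (p : Matching N → ℕ → Prop) :
    ∑ M ∈ Ms, ∑ P ∈ range (((2 ^ width N) ^ groupSize N) ^ R), ind (p M P) ≤
      Ms.card * (((2 : ℝ) ^ width N) ^ groupSize N) ^ R := by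
  calc _ ≤ ∑ M ∈ Ms, ∑ P ∈ range (((2 ^ width N) ^ groupSize N) ^ R), (1 : ℝ) :=
        sum_le_sum fun M _ => sum_le_sum fun P _ => ind_le_one _
    _ = _ := by simp

/-- The induction hypothesis on a single fiber: one more pair is known and two more numbers have
been said. -/
theorem FailsRarely.next (hn : FailsRarely β ε n) (hφ : ∀ x ∈ S, φ x ∈ S) (hb : b ∉ S)
    (hy : y ∉ insert b S) {x h' : Fin N} (hnd : (said ++ [a, b] ++ [x]).Nodup)
    (hmem : h' ∈ said ++ [a, b] ++ [x])
    (hS : insert y (insert b S) = (said ++ [a, b] ++ [x]).toFinset.erase h') :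
    failures β n (said ++ [a, b]) x h' R ((agreeing φ S).filter fun M => M.mate b = y) ≤
      failBound ε (N - (said.length + 3)) R *
        (((agreeing φ S).filter fun M => M.mate b = y).card *
          (((2 : ℝ) ^ width N) ^ groupSize N) ^ R) := by
  have := hn (said ++ [a, b]) x h' R _ _ hnd hmem hS (update_update_mem hφ hb hy)
  rw [← fiber_eq hb hy] at this
  convert! this using 3
  simp
  ring

theorem failures_mono {n' : ℕ} {said' : List (Fin N)} {a' h' : Fin N} {Ms : Finset (Matching N)}
    (hsub : ∀ M ∈ Ms, ∀ P, Survives M β n' said' a' h' R P → Survives M β n said a h R P) :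
    failures β n said a h R Ms ≤ failures β n' said' a' h' R Ms :=
  sum_le_sum fun M hM => sum_le_sum fun P _ => ind_mono (mt (hsub M hM P))

theorem failures_reply (hn : FailsRarely β ε n) (hnd : (said ++ [a]).Nodup)
    (hmem : h ∈ said ++ [a]) (hS : S = (said ++ [a]).toFinset.erase h)
    (hφ : ∀ x ∈ S, φ x ∈ S) (hb : β (said ++ [a]) = b) (hbA : b ∉ said ++ [a])
    (hy : y ∉ insert b S) (hyh : y ≠ h) :
    failures β (n + 1) said a h R ((agreeing φ S).filter fun M => M.mate b = y) ≤
      failBound ε (N - (said.length + 3)) R *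
        (((agreeing φ S).filter fun M => M.mate b = y).card *
          (((2 : ℝ) ^ width N) ^ groupSize N) ^ R) := by
  have hbS : b ∉ S := by
    rw [hS]
    exact fun hc => hbA (List.mem_toFinset.mp (mem_of_mem_erase hc))
  have hbh : b ≠ h := fun hc => hbA (hc ▸ hmem)
  have hyA : y ∉ said ++ [a] := fun hc => hy (by
    rw [hS]
    exact mem_insert_of_mem (mem_erase.mpr ⟨hyh, List.mem_toFinset.mpr hc⟩))
  have hyb : y ≠ b := fun hc => hy (by simp [hc])
  have hsplit : said ++ [a, b] ++ [y] = said ++ [a] ++ [b, y] := by simp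
  refine (failures_mono fun M hM P hs => ?_).trans (hn.next (h' := h) (a := a) hφ hbS hy
    (x := y) ?_ ?_ ?_)
  · obtain ⟨-, hM⟩ := mem_filter.mp hM
    simp only [Survives, hb, hM]
    refine .inr fun _ => ⟨fun _ => hs, fun hc => absurd hc hyh, fun hc => absurd hc hyh⟩
  · rw [hsplit, List.nodup_append]
    refine ⟨hnd, by simpa using hyb.symm, fun z hz w hw => ?_⟩
    simp only [List.mem_cons, List.not_mem_nil, or_false] at hw
    rintro rfl
    rcases hw with rfl | rfl
    exacts [hbA hz, hyA hz]
  · rw [hsplit]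
    exact List.mem_append_left _ hmem
  · ext z
    rw [hsplit, hS]
    simp only [mem_insert, mem_erase, List.toFinset_append, mem_union, List.mem_toFinset,
      List.mem_cons, List.not_mem_nil, or_false]
    constructor
    · rintro (rfl | rfl | h)
      · exact ⟨hyh, .inr (.inr rfl)⟩
      · exact ⟨hbh, .inr (.inl rfl)⟩
      · exact ⟨h.1, .inl h.2⟩
    · rintro ⟨h1, h2 | rfl | rfl⟩
      · exact .inr (.inr ⟨h1, h2⟩)
      · exact .inr (.inl rfl)
      · exact .inl rfl

/-- If the match of `h` has just been said, then a fresh number `x` is said next. -/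
theorem FailsRarely.fresh (hn : FailsRarely β ε n) (hnd : (said ++ [a]).Nodup)
    (hmem : h ∈ said ++ [a]) (hS : S = (said ++ [a]).toFinset.erase h)
    (hφ : ∀ x ∈ S, φ x ∈ S) (hbA : b ∉ said ++ [a]) {x : Fin N} (hx : x ∉ said ++ [a, b]) :
    failures β n (said ++ [a, b]) x x R ((agreeing φ S).filter fun M => M.mate b = h) ≤
      failBound ε (N - (said.length + 3)) R *
        (((agreeing φ S).filter fun M => M.mate b = h).card *
          (((2 : ℝ) ^ width N) ^ groupSize N) ^ R) := by
  have hbS : b ∉ S := by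
    rw [hS]
    exact fun hc => hbA (List.mem_toFinset.mp (mem_of_mem_erase hc))
  have hbh : b ≠ h := fun hc => hbA (hc ▸ hmem)
  have hh : h ∉ insert b S := by
    rw [hS]
    simp [hbh.symm]
  have hsplit : said ++ [a, b] = said ++ [a] ++ [b] := by simp
  refine hn.next hφ hbS hh ?_ (by simp) ?_
  · rw [List.nodup_append, hsplit, List.nodup_append]
    refine ⟨⟨hnd, by simp, fun z hz w hw => ?_⟩, by simp, fun z hz w hw => ?_⟩
    · rintro rfl
      exact hbA ((by simpa using hw : z = b) ▸ hz)
    · rintro rfl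
      exact hx (hsplit ▸ (by simpa using hw : z = x) ▸ hz)
  · ext z
    rw [hsplit] at hx ⊢
    simp only [hS, mem_insert, mem_erase, List.toFinset_append, mem_union, List.mem_toFinset,
      List.mem_append, List.mem_cons, List.not_mem_nil, or_false] at hx hmem ⊢
    constructor
    · rintro (rfl | rfl | h)
      · exact ⟨by rintro rfl; exact hx (.inl hmem), .inl (.inl hmem)⟩
      · exact ⟨by rintro rfl; exact hx (.inr rfl), .inl (.inr rfl)⟩
      · exact ⟨by rintro rfl; exact hx (.inl h.2), .inl (.inl h.2)⟩
    · rintro ⟨h1, (h2 | rfl) | rfl⟩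
      · by_cases hz : z = h
        · exact .inl hz
        · exact .inr (.inr ⟨hz, h2⟩)
      · exact .inr (.inl rfl)
      · exact absurd rfl h1

theorem failures_late (hn : FailsRarely β ε n) (hnd : (said ++ [a]).Nodup)
    (hmem : h ∈ said ++ [a]) (hS : S = (said ++ [a]).toFinset.erase h)
    (hφ : ∀ x ∈ S, φ x ∈ S) (hb : β (said ++ [a]) = b) (hbA : b ∉ said ++ [a])
    (ht : said.length + 2 < N) (hthr : N ≤ said.length + 2 + threshold N) :
    failures β (n + 1) said a h R ((agreeing φ S).filter fun M => M.mate b = h) ≤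
      failBound ε (N - (said.length + 3)) R *
        (((agreeing φ S).filter fun M => M.mate b = h).card *
          (((2 : ℝ) ^ width N) ^ groupSize N) ^ R) := by
  obtain ⟨x, hx⟩ := exists_isLeastUnsaid (A := said ++ [a, b]) (by simpa using ht)
  refine (failures_mono fun M hM P hs => ?_).trans (hn.fresh hnd hmem hS hφ hbA hx.1)
  obtain ⟨-, hM⟩ := mem_filter.mp hM
  simp only [Survives, hb, hM]
  exact .inr fun _ => ⟨fun hc => absurd rfl hc, fun _ _ y hy => hy.unique hx ▸ hs,
    fun _ hc => absurd hthr hc⟩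

/-- Write the pool as `g + B * q`. At most the proportion `ε` of the groups `g` is exhausted, and
these are counted as failures. For the others the fresh number depends on `g` alone, so `q` remains
uniform and the induction hypothesis applies. -/
theorem failures_early (hn : FailsRarely β ε n) (hnd : (said ++ [a]).Nodup)
    (hmem : h ∈ said ++ [a]) (hS : S = (said ++ [a]).toFinset.erase h)
    (hφ : ∀ x ∈ S, φ x ∈ S) (hb : β (said ++ [a]) = b) (hbA : b ∉ said ++ [a])
    (hu : 0 ≤ failBound ε (N - (said.length + 3)) R)
    (hε : ∑ g ∈ range ((2 ^ width N) ^ groupSize N),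
      ind (∀ j < groupSize N, ¬Unsaid (said ++ [a, b]) (digit (2 ^ width N) g j)) ≤
        ε * ((2 : ℝ) ^ width N) ^ groupSize N)
    (hthr : ¬N ≤ said.length + 2 + threshold N) :
    failures β (n + 1) said a h (R + 1) ((agreeing φ S).filter fun M => M.mate b = h) ≤
      (ε + failBound ε (N - (said.length + 3)) R) *
        (((agreeing φ S).filter fun M => M.mate b = h).card *
          (((2 : ℝ) ^ width N) ^ groupSize N) ^ (R + 1)) := by
  set Ms := (agreeing φ S).filter fun M => M.mate b = h with hMs
  set B := (2 ^ width N) ^ groupSize N with hB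
  have hB0 : 0 < B := by positivity
  have hBR : (B : ℝ) = ((2 : ℝ) ^ width N) ^ groupSize N := by simp [hB]
  rw [← hBR] at hε ⊢
  rw [failures, ← hB]
  have hexp : ∀ M, ∑ P ∈ range (B ^ (R + 1)), ind (¬Survives M β (n + 1) said a h (R + 1) P) =
      ∑ g ∈ range B, ∑ q ∈ range (B ^ R),
        ind (¬Survives M β (n + 1) said a h (R + 1) (g + B * q)) := by
    intro M
    rw [pow_succ', sum_range_mul]
  simp only [hexp]
  rw [sum_comm]
  set c : ℝ := Ms.card * (B : ℝ) ^ R with hc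
  have hc0 : 0 ≤ c := by positivity
  have key : ∀ g ∈ range B, ∑ M ∈ Ms, ∑ q ∈ range (B ^ R),
      ind (¬Survives M β (n + 1) said a h (R + 1) (g + B * q)) ≤
        ind (∀ j < groupSize N, ¬Unsaid (said ++ [a, b]) (digit (2 ^ width N) g j)) * c +
          failBound ε (N - (said.length + 3)) R * c := by
    intro g hg
    rcases exists_isFresh_or (A := said ++ [a, b]) g with ⟨x, hx⟩ | hall
    · refine le_trans ?_ (le_add_of_nonneg_left (mul_nonneg (ind_nonneg _) hc0))
      have hxA : x ∉ said ++ [a, b] := by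
        obtain ⟨_, _, _, hxA, _⟩ := hx
        exact hxA
      have h1 := hn.fresh (R := R) hnd hmem hS hφ hbA hxA
      rw [← hBR, ← hMs, ← hc] at h1
      refine le_trans ?_ h1
      rw [failures, ← hB]
      refine sum_le_sum fun M hM => sum_le_sum fun q _ => ind_mono (mt fun hs => ?_)
      obtain ⟨-, hM⟩ := mem_filter.mp hM
      simp only [Survives, hb, hM]
      refine .inr fun _ => ⟨fun hc => absurd rfl hc, fun _ hc => absurd hc hthr, fun _ _ =>
        ⟨R, rfl, x, isFresh_add_mul hx, ?_⟩⟩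
      rw [← hB, Nat.add_mul_div_left _ _ hB0, Nat.div_eq_of_lt (mem_range.mp hg), Nat.zero_add]
      exact hs
    · have h1 : ind (∀ j < groupSize N, ¬Unsaid (said ++ [a, b]) (digit (2 ^ width N) g j)) = 1 :=
        if_pos hall
      rw [h1, one_mul]
      refine le_trans ?_ (le_add_of_nonneg_right (mul_nonneg hu hc0))
      have := sum_ind_le (R := R) Ms
        fun M q => ¬Survives M β (n + 1) said a h (R + 1) (g + B * q)
      rwa [← hBR, ← hB, ← hc] at this
  refine (sum_le_sum key).trans ?_
  rw [sum_add_distrib, ← sum_mul, sum_const, card_range, nsmul_eq_mul]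
  calc _ ≤ ε * B * c + B * (failBound ε (N - (said.length + 3)) R * c) := by
        gcongr
    _ = _ := by rw [hc, pow_succ]; ring

theorem failBound_nonneg {u : ℝ} (hε : 0 ≤ ε) (hu : 0 ≤ u + 1) (R : ℕ) : 0 ≤ failBound ε u R := by
  rw [failBound]
  positivity

theorem failBound_le {u v : ℝ} (huv : u ≤ v) (R : ℕ) : failBound ε u R ≤ failBound ε v R := by
  rw [failBound, failBound]
  gcongr

/-- The inequality behind the induction for `FailsRarely`: the case of a reply to the match of `h`
has the proportion `1 / u`. -/
theorem failBound_step {u : ℝ} (hu : 1 ≤ u) {R : ℕ} {z : ℝ}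
    (hz : z ≤ failBound ε (u - 2) R ∨ R = 0 ∧ z ≤ 1 ∨
      ∃ R', R = R' + 1 ∧ z ≤ ε + failBound ε (u - 2) R') :
    (u - 1) * failBound ε (u - 2) R + z ≤ failBound ε u R * u := by
  rcases hz with hz | ⟨rfl, hz⟩ | ⟨R, rfl, hz⟩
  · have := failBound_le (ε := ε) (show u - 2 ≤ u by linarith) R
    nlinarith
  · simp only [failBound, Nat.cast_zero, zero_mul, pow_zero, div_one, zero_add] at hz ⊢
    nlinarith
  -- The terms with `ε` balance exactly. The others give ((u - 1)² + 2(u - 1))/2^(R+1) = (u² -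
  -- 1)/2^(R+1), at most u(u + 1)/2^(R+1).
  · have h2 : (0 : ℝ) < (2 ^ R)⁻¹ := by positivity
    simp only [failBound, Nat.cast_add, Nat.cast_one, pow_succ, div_eq_mul_inv, mul_inv] at hz ⊢
    nlinarith

/-- Induction on the rounds, splitting the matchings by the match of Bob's number. Of the u equally
large fibers only the one of `h` may use up a group; the remaining u - 1 lead to a reply with `R`
unchanged. -/
theorem failsRarely (hε : 0 ≤ ε)
    (hβ : ∀ A : List (Fin N), A.Nodup → ¬N ≤ A.length + threshold N →
      ∑ g ∈ range ((2 ^ width N) ^ groupSize N),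
        ind (∀ j < groupSize N, ¬Unsaid A (digit (2 ^ width N) g j)) ≤
          ε * ((2 : ℝ) ^ width N) ^ groupSize N) (n : ℕ) : FailsRarely β ε n := by
  induction n with
  | zero =>
    intro said a h R φ S hnd _ _ _
    have hlen : said.length + 1 ≤ N := by simpa using hnd.length_le_card
    have hlen' : ((said.length : ℝ) + 1) ≤ N := by exact_mod_cast hlen
    have : failures β 0 said a h R (agreeing φ S) = 0 := by simp [failures, Survives, ind]
    rw [this]
    exact mul_nonneg (failBound_nonneg hε (by linarith) R) (by positivity)
  | succ n ih =>
    intro said a h R φ S hnd hmem hS hφ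
    have hlen : said.length + 1 ≤ N := by simpa using hnd.length_le_card
    have hlen' : ((said.length : ℝ) + 1) ≤ N := by exact_mod_cast hlen
    obtain ⟨b, hb⟩ : ∃ b, β (said ++ [a]) = b := ⟨_, rfl⟩
    by_cases htriv : b ∈ said ++ [a] ∨ ¬said.length + 2 < N
    · have hsurv : ∀ M P, Survives M β (n + 1) said a h R P := by
        intro M P
        simp only [Survives, hb]
        exact htriv.imp id fun h1 h2 => absurd h2 h1
      have : failures β (n + 1) said a h R (agreeing φ S) = 0 := by
        simp [failures, ind, hsurv]
      rw [this]
      exact mul_nonneg (failBound_nonneg hε (by linarith) R) (by positivity)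
    rw [not_or, not_not] at htriv
    obtain ⟨hbA, ht⟩ := htriv
    have ht' : ((said.length : ℝ) + 3) ≤ N := by exact_mod_cast ht
    have hbS : b ∉ S := by
      rw [hS]
      exact fun hc => hbA (List.mem_toFinset.mp (mem_of_mem_erase hc))
    have hbh : b ≠ h := fun hc => hbA (hc ▸ hmem)
    have hhT : h ∈ (insert b S)ᶜ := by
      rw [hS]
      simp [hbh.symm]
    set Q : ℝ := (((2 : ℝ) ^ width N) ^ groupSize N) ^ R with hQ
    set c : ℝ := (((agreeing φ S).filter fun M => M.mate b = h).card : ℝ) with hc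
    set u : ℝ := N - (said.length + 1) with hu
    have hu2 : (N : ℝ) - (said.length + 3) = u - 2 := by rw [hu]; ring
    have hcT : (((insert b S)ᶜ).card : ℝ) = u := by
      rw [card_compl, card_insert_of_notMem hbS, hS, card_erase_of_mem (List.mem_toFinset.mpr hmem),
        List.toFinset_card_of_nodup hnd, Fintype.card_fin, hu]
      simp only [List.length_append, List.length_singleton, Nat.add_sub_cancel]
      rw [Nat.cast_sub hlen]
      simp
    have hcard : ∀ y ∈ (insert b S)ᶜ,
        (((agreeing φ S).filter fun M => M.mate b = y).card : ℝ) = c := by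
      intro y hy
      have h1 := card_fiber_mul hφ hbS hy
      rw [← card_fiber_mul hφ hbS hhT] at h1
      rw [hc, Nat.eq_of_mul_eq_mul_left (card_pos.mpr ⟨h, hhT⟩) h1]
    have htot : ((agreeing φ S).card : ℝ) = u * c := by
      rw [← card_fiber_mul hφ hbS hhT, Nat.cast_mul, hcT]
    have hsplit : failures β (n + 1) said a h R (agreeing φ S) =
        ∑ y ∈ (insert b S)ᶜ, failures β (n + 1) said a h R
          ((agreeing φ S).filter fun M => M.mate b = y) :=
      (sum_fiberwise_of_maps_to (fun M hM => mate_mem_compl hφ hbS hM) _).symm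
    have hcQ : 0 ≤ c * Q := by positivity
    have hone : ∃ z, (z ≤ failBound ε (u - 2) R ∨ R = 0 ∧ z ≤ 1 ∨
        ∃ R', R = R' + 1 ∧ z ≤ ε + failBound ε (u - 2) R') ∧
        failures β (n + 1) said a h R ((agreeing φ S).filter fun M => M.mate b = h) ≤
          z * (c * Q) := by
      by_cases hthr : N ≤ said.length + 2 + threshold N
      · refine ⟨_, .inl le_rfl, ?_⟩
        rw [← hu2]
        exact failures_late ih hnd hmem hS hφ hb hbA ht hthr
      -- With no group left, a hit is counted as certain failure.
      · rcases R with _ | R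
        · refine ⟨1, .inr (.inl ⟨rfl, le_rfl⟩), ?_⟩
          rw [one_mul]
          exact sum_ind_le _ _
        · refine ⟨_, .inr (.inr ⟨R, rfl, le_rfl⟩), ?_⟩
          rw [← hu2]
          refine failures_early ih hnd hmem hS hφ hb hbA
            (failBound_nonneg hε (by linarith) R) (hβ _ ?_ (by simpa using hthr)) hthr
          rw [show said ++ [a, b] = said ++ [a] ++ [b] by simp, List.nodup_append]
          exact ⟨hnd, by simp, fun z hz w hw => by
            rintro rfl
            exact hbA ((by simpa using hw : z = b) ▸ hz)⟩
    obtain ⟨z, hz, hfz⟩ := hone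
    rw [hsplit, ← add_sum_erase _ _ hhT, htot]
    have hothers : ∑ y ∈ ((insert b S)ᶜ).erase h, failures β (n + 1) said a h R
        ((agreeing φ S).filter fun M => M.mate b = y) ≤
          (u - 1) * (failBound ε (u - 2) R * (c * Q)) := by
      refine (sum_le_card_nsmul _ _ (failBound ε (u - 2) R * (c * Q)) fun y hy => ?_).trans_eq ?_
      · obtain ⟨hyh, hyT⟩ := mem_erase.mp hy
        have := failures_reply (R := R) ih hnd hmem hS hφ hb hbA (mem_compl.mp hyT) hyh
        rwa [hcard y hyT, hu2] at this
      · rw [nsmul_eq_mul, card_erase_of_mem hhT, Nat.cast_sub (card_pos.mpr ⟨h, hhT⟩), hcT]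
        simp
    have hstep := mul_le_mul_of_nonneg_right
      (failBound_step (show 1 ≤ u by rw [hu]; linarith) hz) hcQ
    calc _ ≤ z * (c * Q) + (u - 1) * (failBound ε (u - 2) R * (c * Q)) := add_le_add hfz hothers
      _ = ((u - 1) * failBound ε (u - 2) R + z) * (c * Q) := by ring
      _ ≤ _ := hstep
      _ = _ := by ring

end failures

end MirrorGame

namespace MirrorGame

open Classical Finset

/-! ### The probability that Alice wins -/

variable {N : ℕ}

theorem two_pow_width_le (h₀ : 0 < N) : 2 ^ width N ≤ 2 * N := by
  have h1 : 2 ^ (width N - 1) ≤ N := Nat.lt_size.mp (Nat.sub_lt (width_pos h₀) one_pos)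
  calc 2 ^ width N = 2 * 2 ^ (width N - 1) := by
        rw [← pow_succ', Nat.sub_add_cancel (width_pos h₀)]
    _ ≤ 2 * N := Nat.mul_le_mul_left _ h1

theorem le_side_sq (N : ℕ) : N ≤ side N ^ 2 := (Nat.sqrt_lt'.mp (Nat.lt_succ_self _)).le

theorem exp_neg_width_le (h₀ : 0 < N) : Real.exp (-(2 * width N)) ≤ 1 / (N : ℝ) ^ 2 := by
  have hN : (0 : ℝ) < N := by exact_mod_cast h₀
  have h1 : (N : ℝ) ≤ Real.exp (width N) := by
    calc (N : ℝ) ≤ 2 ^ width N := by exact_mod_cast (lt_two_pow_width N).le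
      _ ≤ Real.exp 1 ^ width N := by
        gcongr
        linarith [Real.add_one_le_exp (1 : ℝ)]
      _ = _ := by rw [← Real.exp_nat_mul, mul_one]
  rw [Real.exp_neg, one_div, two_mul, Real.exp_add, ← sq]
  gcongr

/-- A random candidate is usable with probability at least `threshold N / 2 ^ width N`. With r =
`side N` and w = `width N`, all 4r candidates fail with probability at most exp(-4r²w/2^w) ≤
exp(-2w), since 2^w ≤ 2N ≤ 2r². -/
theorem sum_ind_exhausted_le (h₀ : 0 < N) {A : List (Fin N)} (hA : A.Nodup)
    (hthr : ¬N ≤ A.length + threshold N) :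
    ∑ g ∈ range ((2 ^ width N) ^ groupSize N),
      ind (∀ j < groupSize N, ¬Unsaid A (digit (2 ^ width N) g j)) ≤
        1 / (N : ℝ) ^ 2 * ((2 : ℝ) ^ width N) ^ groupSize N := by
  rw [sum_ind_forall_digit _ _ fun d => ¬Unsaid A d, sum_ind_not_unsaid hA (lt_two_pow_width N).le]
  have hW : (0 : ℝ) < 2 ^ width N := by positivity
  have hNW : (N : ℝ) ≤ 2 ^ width N := by exact_mod_cast (lt_two_pow_width N).le
  have hWN : (2 : ℝ) ^ width N ≤ 2 * N := by exact_mod_cast two_pow_width_le h₀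
  have hthr' : (A.length : ℝ) + threshold N ≤ N := by exact_mod_cast (not_le.mp hthr).le
  have hside : (N : ℝ) ≤ side N ^ 2 := by exact_mod_cast le_side_sq N
  have hlen : (0 : ℝ) ≤ A.length := by positivity
  push_cast
  have hbase : (2 : ℝ) ^ width N - (N - A.length) ≤
      2 ^ width N * Real.exp (-(threshold N / 2 ^ width N)) := by
    calc (2 : ℝ) ^ width N - (N - A.length) ≤ 2 ^ width N - threshold N := by linarith
      _ = 2 ^ width N * (-(threshold N / 2 ^ width N) + 1) := by field_simp; ring
      _ ≤ _ := mul_le_mul_of_nonneg_left (Real.add_one_le_exp _) hW.le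
  refine (pow_le_pow_left₀ (by linarith) hbase _).trans ?_
  rw [mul_pow, mul_comm, ← Real.exp_nat_mul]
  refine mul_le_mul_of_nonneg_right (le_trans ?_ (exp_neg_width_le h₀)) (by positivity)
  rw [Real.exp_le_exp, mul_neg, neg_le_neg_iff, ← mul_div_assoc, le_div_iff₀ hW, threshold,
    groupSize]
  push_cast
  have hw : (0 : ℝ) ≤ width N := by positivity
  calc 2 * (width N : ℝ) * 2 ^ width N ≤ 2 * width N * (2 * side N ^ 2) := by
        gcongr
        linarith
    _ = _ := by ring

/-- With 2w groups, w = `width N`, the exhausted groups contribute 2w/N² ≤ 2/N, and too many hits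
contribute N/4^w ≤ 1/N because N ≤ 2^w. -/
theorem failBound_groups_le (h₀ : 0 < N) :
    failBound (1 / (N : ℝ) ^ 2) (N - 1) (groups N) ≤ 3 / N := by
  have hN : (0 : ℝ) < N := by exact_mod_cast h₀
  have hw : (width N : ℝ) ≤ N := by exact_mod_cast Nat.size_le.mpr Nat.lt_two_pow_self
  have hNW : (N : ℝ) ≤ 2 ^ width N := by exact_mod_cast (lt_two_pow_width N).le
  have h1 : (groups N : ℝ) * (1 / (N : ℝ) ^ 2) ≤ 2 / N := by
    rw [groups, mul_one_div, div_le_div_iff₀ (by positivity) hN]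
    push_cast
    nlinarith
  have h2 : ((N : ℝ) - 1 + 1) / 2 ^ groups N ≤ 1 / N := by
    rw [sub_add_cancel, div_le_div_iff₀ (by positivity) hN, groups, mul_comm 2, pow_mul]
    nlinarith
  calc _ ≤ 2 / (N : ℝ) + 1 / N := add_le_add h1 h2
    _ = 3 / N := by ring

theorem failures_start_le (h₀ : 0 < N) (β : BobStrategy N) :
    ∑ M : Matching N, ∑ P ∈ range (2 ^ poolBits N),
      ind (¬Survives M β (N / 2) [] ⟨0, h₀⟩ ⟨0, h₀⟩ (groups N) P) ≤
        3 / N * (Fintype.card (Matching N) * 2 ^ poolBits N) := by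
  have h := failsRarely (β := β) (ε := 1 / (N : ℝ) ^ 2) (by positivity)
    (fun A hA => sum_ind_exhausted_le h₀ hA) (N / 2) [] ⟨0, h₀⟩ ⟨0, h₀⟩ (groups N) id ∅
    (by simp) (by simp) (by simp) (by simp)
  have huniv : agreeing (id : Fin N → Fin N) ∅ = univ := by simp [agreeing]
  have hpow : poolBits N = width N * (groupSize N * groups N) := by rw [poolBits]; ring
  rw [huniv, failures, ← pow_mul, ← pow_mul, ← pow_mul, ← pow_mul, ← hpow] at h
  refine h.trans ?_
  rw [List.length_nil, Nat.cast_zero, zero_add, card_univ]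
  exact mul_le_mul_of_nonneg_right (failBound_groups_le h₀) (by positivity)

/-! ### From random bits to pools, and from deterministic to randomized strategies of Bob. -/

theorem testBit_value (w : List Bool) (i : ℕ) : (value w).testBit i = w[i]?.getD false := by
  induction w generalizing i with
  | nil => simp [value]
  | cons b w ih =>
    cases i with
    | zero => exact Nat.testBit_bit_zero b (value w)
    | succ i => exact (Nat.testBit_bit_succ i b (value w)).trans (by simpa using ih i)

theorem value_ofFn_injective (L : ℕ) :
    Function.Injective fun x : Fin L → Bool => value (List.ofFn x) := by
  intro x y h
  funext i
  have := congrArg (fun n => n.testBit i) h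
  simpa [testBit_value, List.getElem?_ofFn] using this

theorem sum_value_ofFn (L : ℕ) (F : ℕ → ℝ) :
    ∑ x : Fin L → Bool, F (value (List.ofFn x)) = ∑ P ∈ range (2 ^ L), F P := by
  have himage : (univ : Finset (Fin L → Bool)).image (fun x => value (List.ofFn x)) =
      range (2 ^ L) := by
    refine eq_of_subset_of_card_le (fun P hP => ?_) ?_
    · obtain ⟨x, -, rfl⟩ := mem_image.mp hP
      simpa using value_lt (List.ofFn x)
    · rw [card_image_of_injective _ (value_ofFn_injective L)]
      simp
  rw [← himage, sum_image (value_ofFn_injective L).injOn]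

/-- The marginal distribution of the uniform distribution on a power. -/
theorem card_mul_sum_apply {ι X : Type*} [Fintype ι] [DecidableEq ι] [Fintype X] (i : ι)
    (F : X → ℝ) :
    Fintype.card X * ∑ ω : ι → X, F (ω i) = Fintype.card (ι → X) * ∑ x, F x := by
  have h1 : ∑ ω : ι → X, F (ω i) = ∑ p : X × ({j // j ≠ i} → X), F p.1 :=
    Fintype.sum_equiv (Equiv.funSplitAt i X) _ _ fun ω => rfl
  have h2 : Fintype.card (ι → X) = Fintype.card X * Fintype.card ({j // j ≠ i} → X) := by
    rw [← Fintype.card_prod]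
    exact Fintype.card_congr (Equiv.funSplitAt i X)
  rw [h1, h2, Fintype.sum_prod_type]
  simp only [sum_const, card_univ, nsmul_eq_mul, ← mul_sum]
  push_cast
  ring

theorem sum_ind_not_wins_le (h2 : 2 < N) (β : BobStrategy N) :
    ∑ M : Matching N, ∑ ω : Fin N → Fin (poolBits N) → Bool,
      ind (¬(strategy N (by omega)).Wins M ω β) ≤
        3 / N * (Fintype.card (Matching N) *
          Fintype.card (Fin N → Fin (poolBits N) → Bool)) := by
  have h₀ : 0 < N := by omega
  set F : Matching N → ℕ → ℝ := fun M P =>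
    ind (¬Survives M β (N / 2) [] ⟨0, h₀⟩ ⟨0, h₀⟩ (groups N) P)
  have hX : (Fintype.card (Fin (poolBits N) → Bool) : ℝ) = 2 ^ poolBits N := by simp
  have hX0 : (0 : ℝ) < Fintype.card (Fin (poolBits N) → Bool) := by rw [hX]; positivity
  have hle : ∑ M : Matching N, ∑ ω : Fin N → Fin (poolBits N) → Bool,
      ind (¬(strategy N h₀).Wins M ω β) ≤
        ∑ M : Matching N, ∑ ω : Fin N → Fin (poolBits N) → Bool,
          F M (value (List.ofFn (ω ⟨2, h2⟩))) :=
    sum_le_sum fun M _ => sum_le_sum fun ω _ => ind_mono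
      (mt fun hs => Survives.wins h₀ M β ω (fun _ => rfl) hs)
  refine hle.trans (le_of_mul_le_mul_left ?_ hX0)
  have hmarg : ∀ M, (Fintype.card (Fin (poolBits N) → Bool) : ℝ) *
      ∑ ω : Fin N → Fin (poolBits N) → Bool, F M (value (List.ofFn (ω ⟨2, h2⟩))) =
        Fintype.card (Fin N → Fin (poolBits N) → Bool) * ∑ P ∈ range (2 ^ poolBits N), F M P :=
    fun M => (card_mul_sum_apply (⟨2, h2⟩ : Fin N)
      fun x : Fin (poolBits N) → Bool => F M (value (List.ofFn x))).trans (by rw [sum_value_ofFn])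
  rw [mul_sum, sum_congr rfl fun M _ => hmarg M, ← mul_sum, hX]
  calc _ ≤ (Fintype.card (Fin N → Fin (poolBits N) → Bool) : ℝ) *
        (3 / N * (Fintype.card (Matching N) * 2 ^ poolBits N)) :=
        mul_le_mul_of_nonneg_left (failures_start_le h₀ β) (by positivity)
    _ = _ := by ring

/-- By independence Bob's strategy can be drawn first, so that the winning probability is an average
over deterministic strategies. -/
theorem law_eq_bind {L : ℕ} (hN : Even N) (B : PMF (BobStrategy N)) :
    haveI := nonempty_matching hN
    Strategy.law L hN B = B.bind fun β => (PMF.uniformOfFintype (Matching N)).bind fun M =>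
      (PMF.uniformOfFintype (Fin N → Fin L → Bool)).bind fun ω => PMF.pure (M, ω, β) := by
  have := nonempty_matching hN
  have h1 : ∀ M : Matching N, ((PMF.uniformOfFintype (Fin N → Fin L → Bool)).bind fun ω =>
      B.map fun β => (M, ω, β)) = B.bind fun β =>
        (PMF.uniformOfFintype (Fin N → Fin L → Bool)).bind fun ω => PMF.pure (M, ω, β) :=
    fun M => PMF.bind_comm _ _ _
  simp only [Strategy.law, h1]
  exact PMF.bind_comm _ _ _

/-- A bound for deterministic strategies of Bob is a bound for all his strategies. -/
theorem Strategy.le_winProb {m L : ℕ} (σ : Strategy N m L) (hN : Even N) {c : ℝ}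
    (hc : ∀ β, ∑ M : Matching N, ∑ ω : Fin N → Fin L → Bool, ind (¬σ.Wins M ω β) ≤
      c * (Fintype.card (Matching N) * Fintype.card (Fin N → Fin L → Bool)))
    (B : PMF (BobStrategy N)) : ENNReal.ofReal (1 - c) ≤ σ.winProb hN B := by
  have := nonempty_matching hN
  set cM := Fintype.card (Matching N) with hcM
  set cΩ := Fintype.card (Fin N → Fin L → Bool) with hcΩ
  have hM0 : (0 : ℝ) < cM := by exact_mod_cast Fintype.card_pos
  have hΩ0 : (0 : ℝ) < cΩ := by exact_mod_cast Fintype.card_pos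
  have key : ∀ β, ENNReal.ofReal (1 - c) ≤
      ∑ M : Matching N, (cM : ENNReal)⁻¹ * ∑ ω : Fin N → Fin L → Bool,
        (cΩ : ENNReal)⁻¹ * (if σ.Wins M ω β then 1 else 0) := by
    intro β
    have hreal : ∑ M : Matching N, (cM : ENNReal)⁻¹ * ∑ ω : Fin N → Fin L → Bool,
        (cΩ : ENNReal)⁻¹ * (if σ.Wins M ω β then 1 else 0) =
        ENNReal.ofReal (∑ M : Matching N, (cM : ℝ)⁻¹ * ∑ ω : Fin N → Fin L → Bool,
          (cΩ : ℝ)⁻¹ * ind (σ.Wins M ω β)) := by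
      have hi : ∀ p : Prop, (if p then 1 else 0 : ENNReal) = ENNReal.ofReal (ind p) := by
        intro p
        by_cases hp : p <;> simp [ind, hp]
      have hn : ∀ M ω, 0 ≤ (cΩ : ℝ)⁻¹ * ind (σ.Wins M ω β) := fun M ω =>
        mul_nonneg (by positivity) (ind_nonneg _)
      rw [ENNReal.ofReal_sum_of_nonneg fun M _ =>
        mul_nonneg (by positivity) (sum_nonneg fun ω _ => hn M ω)]
      refine sum_congr rfl fun M _ => ?_
      rw [ENNReal.ofReal_mul (by positivity), ENNReal.ofReal_inv_of_pos hM0,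
        ENNReal.ofReal_natCast, ENNReal.ofReal_sum_of_nonneg fun ω _ => hn M ω]
      congr 1
      refine sum_congr rfl fun ω _ => ?_
      rw [ENNReal.ofReal_mul (by positivity), ENNReal.ofReal_inv_of_pos hΩ0,
        ENNReal.ofReal_natCast, hi]
    rw [hreal]
    refine ENNReal.ofReal_le_ofReal ?_
    have hneg : ∀ p : Prop, ind p = 1 - ind (¬p) := by
      intro p
      by_cases hp : p <;> simp [ind, hp]
    have hsum : ∑ M : Matching N, (cM : ℝ)⁻¹ * ∑ ω : Fin N → Fin L → Bool,
        (cΩ : ℝ)⁻¹ * ind (σ.Wins M ω β) =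
        1 - (∑ M : Matching N, ∑ ω : Fin N → Fin L → Bool, ind (¬σ.Wins M ω β)) /
          (cM * cΩ) := by
      simp only [← mul_sum]
      simp_rw [fun M ω => hneg (σ.Wins M ω β), sum_sub_distrib]
      simp only [sum_const, card_univ, ← hcM, ← hcΩ, nsmul_eq_mul, mul_one]
      field_simp
    rw [hsum]
    have := (div_le_iff₀ (by positivity)).mpr (hc β)
    linarith
  rw [Strategy.winProb, law_eq_bind, PMF.toOuterMeasure_bind_apply]
  calc ENNReal.ofReal (1 - c) = ∑' β, B β * ENNReal.ofReal (1 - c) := by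
        rw [ENNReal.tsum_mul_right, B.tsum_coe, one_mul]
    _ ≤ _ := by
      refine ENNReal.tsum_le_tsum fun β => mul_le_mul_right ((key β).trans_eq ?_) _
      simp only [PMF.toOuterMeasure_bind_apply, PMF.uniformOfFintype_apply, tsum_fintype,
        PMF.toOuterMeasure_pure_apply, Set.mem_ofPred_eq, ← hcM, ← hcΩ]

theorem le_winProb_strategy (h₀ : 0 < N) (hN : Even N) (B : PMF (BobStrategy N)) :
    ENNReal.ofReal (1 - 3 / N) ≤ (strategy N h₀).winProb hN B := by
  by_cases h2 : 2 < N
  · exact (strategy N h₀).le_winProb hN (fun β => sum_ind_not_wins_le h2 β) B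
  -- For `N ≤ 2` there is no turn 2, hence no pool, but the bound is trivial since `3 / N ≥ 1`.
  · have hN' : (0 : ℝ) < N := by exact_mod_cast h₀
    have hN2 : (N : ℝ) ≤ 2 := by exact_mod_cast not_lt.mp h2
    have : (1 : ℝ) ≤ 3 / N := (one_le_div hN').mpr (by linarith)
    rw [ENNReal.ofReal_of_nonpos (by linarith)]
    exact zero_le

/-! ### The memory -/

theorem width_le_log (h2 : 2 ≤ N) : (width N : ℝ) ≤ 3 * Real.log N := by
  have h₀ : 0 < N := by omega
  have hN : (0 : ℝ) < N := by exact_mod_cast h₀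
  have h1 : (2 : ℝ) ^ width N ≤ N * N := by
    exact_mod_cast (two_pow_width_le h₀).trans (Nat.mul_le_mul_right N h2)
  have h3 := Real.log_le_log (by positivity) h1
  rw [Real.log_pow, Real.log_mul hN.ne' hN.ne'] at h3
  have h4 := Real.log_two_gt_d9
  have hw : (0 : ℝ) ≤ width N := by positivity
  nlinarith

theorem memory_le (h2 : 2 ≤ N) : (memory N : ℝ) ≤ 270 * (√N * Real.log N ^ 2) := by
  have h₀ : 0 < N := by omega
  have hw : (1 : ℝ) ≤ width N := by exact_mod_cast width_pos h₀
  have hsqrt : (1 : ℝ) ≤ √N := by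
    rw [Real.one_le_sqrt]
    exact_mod_cast h₀
  have hside : (side N : ℝ) ≤ 2 * √N := by
    have := Real.nat_sqrt_le_real_sqrt (a := N)
    rw [side]
    push_cast
    linarith
  have hside1 : (1 : ℝ) ≤ side N := by rw [side]; push_cast; linarith [N.sqrt.cast_nonneg (α := ℝ)]
  -- The product of labels contributes 5 and the pool 2 · 4 = 8 to the factor 13. The final constant
  -- is 270 = 15 · 3² · 2.
  have hmem : (memory N : ℝ) = 2 * width N + 13 * (width N ^ 2 * side N) := by
    rw [memory, prodBits, poolBits, threshold, groups, groupSize]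
    push_cast
    ring
  have h1 : (width N : ℝ) ≤ width N ^ 2 * side N := by nlinarith
  calc (memory N : ℝ) ≤ 15 * ((width N : ℝ) ^ 2 * side N) := by linarith
    _ ≤ 15 * ((3 * Real.log N) ^ 2 * (2 * √N)) := by
      gcongr
      exact width_le_log h2
    _ = _ := by ring

end MirrorGame

theorem theorem4p3 :
    ∃ (m L : ℕ → ℕ) (σ : ∀ N, 0 < N → Even N → MirrorGame.Strategy N (m N) (L N)),
      MirrorGame.ComputableInMemory m L σ ∧
      ∃ C : ℝ, ∀ (N : ℕ) (h₀ : 0 < N) (hN : Even N),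
        (m N : ℝ) ≤ C * (Real.sqrt N * Real.log N ^ 2) ∧
        ∀ B : PMF (MirrorGame.BobStrategy N),
          ENNReal.ofReal (1 - C / N) ≤ (σ N h₀ hN).winProb hN B := by
  -- The constant 270 of the memory bound also covers the 3 of the failure probability.
  refine ⟨MirrorGame.memory, MirrorGame.poolBits, fun N h₀ _ => MirrorGame.strategy N h₀,
    MirrorGame.strategy_computable, 270, fun N h₀ hN => ⟨?_, fun B => ?_⟩⟩
  · refine MirrorGame.memory_le ?_
    obtain ⟨k, rfl⟩ := hN
    omega
  · refine (ENNReal.ofReal_le_ofReal ?_).trans (MirrorGame.le_winProb_strategy h₀ hN B)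
    gcongr
    norm_num
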